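/- Let $z=x+\mathrm{i}y=\rho\,\mathrm{e}^{\mathrm{i}\theta}$, and for $0<\alpha\le\pi/2$ let $\mathfrak S_\alpha=\{\rho\,\mathrm{e}^{\mathrm{i}\theta}:\rho\ge 0,\ -\alpha\le\theta\le 0\}$ be the closed planar sector of angle $\alpha$. Put $$\mu=\mu_\alpha=\frac{\pi}{2\alpha},\qquad \chi_{\alpha,N}=\frac{\pi}{4}(1-\mu_\alpha),\qquad \chi_{\alpha,D}=\frac{\pi}{4}(1+\mu_\alpha).$$ A *solution of the Robin–Neumann problem* in $\mathfrak S_\alpha$ is a real-valued function $\phi$ that is continuous on $\mathfrak S_\alpha$, harmonic in a neighbourhood of every point of $\mathfrak S_\alpha\setminus\{0\}$, and satisfies $\partial\phi/\partial y=\phi$ on the ray $\{\theta=0,\rho>0\}$ and $\partial\phi/\partial n=0$ on the ray $\{\theta=-\alpha,\rho>0\}$, where $n$ is the outward unit normal. A *solution of the Robin–Dirichlet problem* is defined in the same way, with the last condition replaced by $\phi=0$ on $\{\theta=-\alpha,\rho>0\}$. **Theorem.** For any $0<\alpha<\pi/2$ there exist solutions $\phi_{\alpha,N}$ and $\phi_{\alpha,D}$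 of the Robin–Neumann and of the Robin–Dirichlet problem in $\mathfrak S_\alpha$, respectively, and a constant $C>0$ such that: * $\phi_{\alpha,N}$ and $\phi_{\alpha,D}$ are bounded on $\mathfrak S_\alpha$; * $\phi_{\alpha,N}(x,y)=\mathrm{e}^{y}\cos(x-\chi_{\alpha,N})+R_{\alpha,N}(x,y)$, where on $\mathfrak S_\alpha\setminus\{0\}$ $$|R_{\alpha,N}|\le C\rho^{-\mu},\qquad |\nabla R_{\alpha,N}|\le C\rho^{-\mu-1};$$ * $\phi_{\alpha,D}(x,y)=\mathrm{e}^{y}\cos(x-\chi_{\alpha,D})+R_{\alpha,D}(x,y)$, where on $\mathfrak S_\alpha\setminus\{0\}$ $$|R_{\alpha,D}|\le C\rho^{-2\mu},\qquad |\nabla R_{\alpha,D}|\le C\rho^{-2\mu-1};$$ * for every monomial differential operator $\mathcal P=\partial_x^a\partial_y^b$ of order $k=a+b$, as $\rho\to0$ in $\mathfrak S_\alpha\setminus\{0\}$, $$|\mathcal P\phi_{\alpha,N}|=o(\rho^{-k})\quad(k\ge 1),\qquad |\mathcal P\phi_{\alpha,D}|=O(\rho^{\mu-k})\quad(k\ge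 0),$$ and for every $k\ge0$ there is a constant $C_k$ such that for all such $\mathcal P$ of order $k$, on all of $\mathfrak S_\alpha\setminus\{0\}$, $$|\mathcal P R_{\alpha,N}|\le C_k\rho^{-\mu-k},\qquad |\mathcal P R_{\alpha,D}|\le C_k\rho^{-2\mu-k}.$$ For $\alpha=\pi/2$, the functions $\phi_{\frac\pi2,N}=\mathrm{e}^y\cos x$ and $\phi_{\frac\pi2,D}=\mathrm{e}^y\sin x$ are bounded solutions of the Robin–Neumann and Robin–Dirichlet problems in $\mathfrak S_{\pi/2}$, and they equal $\mathrm{e}^y\cos(x-\chi_{\frac\pi2,N})$ and $\mathrm{e}^y\cos(x-\chi_{\frac\pi2,D})$, respectively. -/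

import Mathlib

open Filter Topology Asymptotics

noncomputable section

namespace SlopingBeach

/-- The closed planar sector `-α ≤ θ ≤ 0` in polar coordinates `z = x + i y = ρ e^{iθ}`,
vertex included. -/
def sector (α : ℝ) : Set ℂ :=
  {z | ∃ ρ θ : ℝ, 0 ≤ ρ ∧ -α ≤ θ ∧ θ ≤ 0 ∧ z = ρ * Complex.exp (θ * Complex.I)}

/-- The closed sector without its vertex. -/
def puncturedSector (α : ℝ) : Set ℂ := sector α \ {0}

/-- The open boundary ray `θ = 0`. -/
def surfaceRay : Set ℂ := {z | ∃ ρ : ℝ, 0 < ρ ∧ z = ρ}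

/-- The open boundary ray `θ = -α`. -/
def wallRay (α : ℝ) : Set ℂ :=
  {z | ∃ ρ : ℝ, 0 < ρ ∧ z = ρ * Complex.exp (-α * Complex.I)}

/-- The partial derivative `∂/∂x`. -/
def dx (f : ℂ → ℝ) : ℂ → ℝ := fun z => fderiv ℝ f z 1

/-- The partial derivative `∂/∂y`. -/
def dy (f : ℂ → ℝ) : ℂ → ℝ := fun z => fderiv ℝ f z Complex.I

/-- The monomial differential operator `∂_x^a ∂_y^b`, of order `a + b`, with coefficient `1`. -/
def partialD (a b : ℕ) (f : ℂ → ℝ) : ℂ → ℝ := dx^[a] (dy^[b] f)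

/-- The outward unit normal `(-sin α, -cos α)` to the sector on the ray `θ = -α`. -/
def wallNormal (α : ℝ) : ℂ := -Complex.I * Complex.exp (-α * Complex.I)

/-- Solutions of the Robin–Neumann sloping beach problem. They are continuous on the closed sector
and harmonic up to its boundary except at the vertex, that is, harmonic in a neighbourhood of every
point of the punctured closed sector, so that the derivatives on the rays are ordinary ones. -/
structure IsRobinNeumannSolution (α : ℝ) (φ : ℂ → ℝ) : Prop where
  continuousOn : ContinuousOn φ (sector α)
  harmonic : InnerProductSpace.HarmonicOnNhd φ (puncturedSector α)
  robin : ∀ z ∈ surfaceRay, dy φ z = φ z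
  neumann : ∀ z ∈ wallRay α, fderiv ℝ φ z (wallNormal α) = 0

/-- Solutions of the Robin–Dirichlet sloping beach problem (same regularity). -/
structure IsRobinDirichletSolution (α : ℝ) (φ : ℂ → ℝ) : Prop where
  continuousOn : ContinuousOn φ (sector α)
  harmonic : InnerProductSpace.HarmonicOnNhd φ (puncturedSector α)
  robin : ∀ z ∈ surfaceRay, dy φ z = φ z
  dirichlet : ∀ z ∈ wallRay α, φ z = 0

/-- `μ_α = π / (2α)`. -/
def mu (α : ℝ) : ℝ := Real.pi / (2 * α)

/-- `χ_{α,N} = π (1 - μ_α) / 4`. -/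
def chiN (α : ℝ) : ℝ := Real.pi / 4 * (1 - mu α)

/-- `χ_{α,D} = π (1 + μ_α) / 4`. -/
def chiD (α : ℝ) : ℝ := Real.pi / 4 * (1 + mu α)

/-- The surface wave `e^y cos (x - χ)`. -/
def wave (χ : ℝ) : ℂ → ℝ := fun z => Real.exp z.im * Real.cos (z.re - χ)

end SlopingBeach

end

noncomputable section

namespace SlopingBeach

open Complex MeasureTheory Set

/-! For `0 < α < π/2` (so `μ > 1`) both solutions are real parts of Laplace-type contour integrals
`F(z) = ∫ T(w) e^{l w} e^{z e^w} dw`. The contour comes in from `+∞` along `Im w = -U` and returns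
along `Im w = U`, with `U > π/2 + α`, so that `e^{z e^w}` decays at both ends for every `z` in the
sector. Differentiation in `z` multiplies the symbol by `e^w`. Dirichlet is `l = 0`, Neumann is `l =
μ`; everything rests on one symbol `T(w) = B(w) / (e^w + i)`.

Boundary conditions become symmetries of the symbol. Conjugation reverses the contour, so an
integrand symmetric under conjugation has a purely imaginary integral, and an antisymmetric one a
real integral. On `θ = 0` the combination `F' + iF` has symbol `B e^{l w}`, so `B` should commute
with conjugation (`beachF_robin`). On `θ = -α` the contour is recentred at `Im w = α`, and `T`
should be antisymmetric under reflection in that line (`beachT_wall`); with `μα = π/2` this yields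
Dirichlet for `l = 0` and Neumann for `l = μ` (`beachF_dirichlet`, `beachF_neumann`).

Both demands are met by `B(w) = e^{-(μ-1)w/2} E(w)`, where `E` is even, zero free and commutes with
conjugation, and `E(w + iα) / E(w - iα)` is a prescribed rational function of `e^w` (`beachE_wall`).
The logarithmic derivative of `E` is the convolution of `μ coth(μw) - coth w` with `-1/(2π cosh)`.
The Cauchy formula for the kernel `1/sinh` gives its difference equation with step `2iα` and a
second one with step `iπ`; integrated, the latter is `E(w + iπ/2) E(w - iπ/2) sinh(μw) = c sinh w`
(`exists_beachE_mul_beachE`).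

For large `z` the segment of the contour is moved left across the simple pole `e^w = -i`, whose
residue is the wave `e^{-iz}` with the phase of `B e^{l w}` there (`hook_one_sub_hook_neg_one`,
`beachNorm_mul`). The second equation continues `T` to `Re w < 0` up to `Im w = ± π`, so the segment
can be pushed to `-∞`. Apart from contributions on rays and arcs where `e^{z e^w}` is small, there
remain a constant, invisible in the real part of the normalised potential, and the jump of the
symbol between `Im w = π` and `Im w = -π` (`exists_hook_sub_le`). A jump of size `e^{m Re w}` gives
`ρ^{-m}`: `m = μ` for Neumann directly, and `m = 2μ` for Dirichlet because the two continuations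
differ only in a factor `1 + O(e^{2μ Re w})` (`exists_beachText_jump`).

Near the vertex the segment is moved right to `|z| e^{Re w} = 2`. Since `T e^{μw}` tends to a
constant at `+∞` with error `e^{-Re w/2}`, this gives `O(ρ^{μ-k})` for Dirichlet and, for Neumann, a
constant plus `O(ρ^{1/2})`, with derivatives `O(ρ^{1/2-k})` (`exists_hook_le_rpow`). At `α = π/2`
the waves themselves are solutions. -/

/-! ### Contour shifts in strips and half strips. -/

theorem rectangle_integral_eq_zero {H : ℂ → ℂ} {s R a b : ℝ} (hsR : s ≤ R) (hab : a ≤ b)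
    (hd : ∀ w : ℂ, s ≤ w.re → w.re ≤ R → a ≤ w.im → w.im ≤ b → DifferentiableAt ℂ H w) :
    (∫ x in s..R, H (x + a * I)) - (∫ x in s..R, H (x + b * I))
      + I * (∫ y in a..b, H (R + y * I)) - I * (∫ y in a..b, H (s + y * I)) = 0 := by
  have := Complex.integral_boundary_rect_eq_zero_of_differentiableOn H (s + a * I) (R + b * I)
    (by
      intro w hw
      simp only [mem_reProdIm, add_re, ofReal_re, mul_re, I_re, mul_zero, ofReal_im, I_im, mul_one,
        sub_self, add_zero, add_im, mul_im, zero_add, uIcc_of_le hsR, uIcc_of_le hab, mem_Icc] at hw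
      exact (hd w hw.1.1 hw.1.2 hw.2.1 hw.2.2).differentiableWithinAt)
  simpa using this

theorem tendsto_verticalIntegral_zero {H : ℂ → ℂ} {a b : ℝ} (hab : a ≤ b) {l : Filter ℝ}
    {B : ℝ → ℝ} (hB : Tendsto B l (𝓝 0))
    (hH : ∀ᶠ x : ℝ in l, ∀ y ∈ Icc a b, ‖H (x + y * I)‖ ≤ B x) :
    Tendsto (fun x : ℝ => ∫ y in a..b, H (x + y * I)) l (𝓝 0) := by
  have h2 : Tendsto (fun x => B x * |b - a|) l (𝓝 0) := by simpa using hB.mul_const _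
  refine squeeze_zero_norm' ?_ h2
  filter_upwards [hH] with x hx
  refine intervalIntegral.norm_integral_le_of_norm_le_const fun y hy => hx y ?_
  rw [uIoc_of_le hab] at hy
  exact ⟨hy.1.le, hy.2⟩

theorem integrable_exp_mul_sub_abs {a : ℝ} (ha : |a| < 1) :
    Integrable fun u : ℝ => Real.exp (a * u - |u|) := by
  have h := abs_lt.1 ha
  rw [← integrableOn_univ, ← Iic_union_Ioi (a := (0 : ℝ)), integrableOn_union]
  constructor
  · refine (integrableOn_exp_mul_Iic (a := a + 1) (by linarith) 0).congr_fun (fun u hu => ?_)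
      measurableSet_Iic
    simp only [abs_of_nonpos (mem_Iic.1 hu)]
    ring_nf
  · refine (integrableOn_exp_mul_Ioi (a := a - 1) (by linarith) 0).congr_fun (fun u hu => ?_)
      measurableSet_Ioi
    simp only [abs_of_pos (mem_Ioi.1 hu)]
    ring_nf

theorem integrable_exp_neg_abs : Integrable fun u : ℝ => Real.exp (-|u|) := by
  simpa using integrable_exp_mul_sub_abs (a := 0) (by simp)

/-- Horizontal lines of integration may be shifted inside a strip of holomorphy. -/
theorem integral_line_shift {H : ℂ → ℂ} {a b C : ℝ} (hab : a ≤ b)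
    (hd : ∀ w : ℂ, a ≤ w.im → w.im ≤ b → DifferentiableAt ℂ H w)
    (hb : ∀ w : ℂ, a ≤ w.im → w.im ≤ b → ‖H w‖ ≤ C * Real.exp (-|w.re|)) :
    ∫ u : ℝ, H (u + a * I) = ∫ u : ℝ, H (u + b * I) := by
  have hexp : Integrable fun u : ℝ => C * Real.exp (-|u|) := integrable_exp_neg_abs.const_mul C
  have hInt : ∀ y ∈ Icc a b, Integrable fun u : ℝ => H (u + y * I) := by
    intro y hy
    refine hexp.mono' ?_ (Eventually.of_forall fun u => ?_)
    · refine Continuous.aestronglyMeasurable ?_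
      refine continuous_iff_continuousAt.2 fun u => ?_
      have h1 : ContinuousAt H (u + y * I) := (hd _ (by simpa using hy.1) (by simpa using hy.2)).continuousAt
      exact ContinuousAt.comp (f := fun u : ℝ => (u + y * I : ℂ)) h1 (by fun_prop)
    · simpa using hb (u + y * I) (by simpa using hy.1) (by simpa using hy.2)
  have hlim : ∀ y ∈ Icc a b, Tendsto (fun R : ℝ => ∫ x in (-R)..R, H (x + y * I)) atTop
      (𝓝 (∫ u : ℝ, H (u + y * I))) := fun y hy =>
    intervalIntegral_tendsto_integral (hInt y hy) tendsto_neg_atTop_atBot tendsto_id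
  have hB : Tendsto (fun x : ℝ => C * Real.exp (-|x|)) atTop (𝓝 0) := by
    simpa using (Real.tendsto_exp_neg_atTop_nhds_zero.comp tendsto_abs_atTop_atTop).const_mul C
  have hB' : Tendsto (fun x : ℝ => C * Real.exp (-|x|)) atBot (𝓝 0) := by
    simpa using (Real.tendsto_exp_neg_atTop_nhds_zero.comp tendsto_abs_atBot_atTop).const_mul C
  have hHb : ∀ x : ℝ, ∀ y ∈ Icc a b, ‖H (x + y * I)‖ ≤ C * Real.exp (-|x|) := fun x y hy => by
    simpa using hb (x + y * I) (by simpa using hy.1) (by simpa using hy.2)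
  have hr := tendsto_verticalIntegral_zero hab hB (Eventually.of_forall hHb)
  have hl := (tendsto_verticalIntegral_zero hab hB' (Eventually.of_forall hHb)).comp
    tendsto_neg_atTop_atBot
  have htot := (((hlim a (left_mem_Icc.2 hab)).sub (hlim b (right_mem_Icc.2 hab))).add
    (hr.const_mul I)).sub (hl.const_mul I)
  have hz : ∀ᶠ R : ℝ in atTop, (∫ x in (-R)..R, H (x + a * I)) - (∫ x in (-R)..R, H (x + b * I))
      + I * (∫ y in a..b, H (R + y * I)) - I * (∫ y in a..b, H ((-R : ℝ) + y * I)) = 0 := by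
    filter_upwards [eventually_ge_atTop 0] with R hR
    exact rectangle_integral_eq_zero (by linarith) hab fun w _ _ h3 h4 => hd w h3 h4
  have := tendsto_nhds_unique (htot.congr' hz) tendsto_const_nhds
  simpa [sub_eq_zero] using this

/-- The contour that comes in from `+∞` along `Im w = a`, runs up the segment `Re w = s` and goes
back to `+∞` along `Im w = b`. -/
def hook (H : ℂ → ℂ) (s a b : ℝ) : ℂ :=
  (∫ u in Ioi s, H (u + b * I)) + I * (∫ y in a..b, H (s + y * I)) - ∫ u in Ioi s, H (u + a * I)

/-- Cauchy's theorem in a half strip: the contour bounds a region of holomorphy, and the closing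
side at `Re w = R` vanishes as `R → ∞`. -/
theorem hook_eq_zero {H : ℂ → ℂ} {s a b : ℝ} (hab : a ≤ b) {B : ℝ → ℝ}
    (hd : ∀ w : ℂ, s ≤ w.re → a ≤ w.im → w.im ≤ b → DifferentiableAt ℂ H w)
    (hb : ∀ x : ℝ, s ≤ x → ∀ y ∈ Icc a b, ‖H (x + y * I)‖ ≤ B x)
    (hB : IntegrableOn B (Ioi s)) (hB0 : Tendsto B atTop (𝓝 0)) : hook H s a b = 0 := by
  have hInt : ∀ y ∈ Icc a b, IntegrableOn (fun u : ℝ => H (u + y * I)) (Ioi s) := by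
    intro y hy
    refine Integrable.mono' hB ?_ ((ae_restrict_mem measurableSet_Ioi).mono fun u hu => ?_)
    · refine ContinuousOn.aestronglyMeasurable (fun u hu => ?_) measurableSet_Ioi
      have h1 : ContinuousAt H (u + y * I) :=
        (hd _ (by simpa using (mem_Ioi.1 hu).le) (by simpa using hy.1) (by simpa using hy.2)).continuousAt
      exact (ContinuousAt.comp (f := fun u : ℝ => (u + y * I : ℂ)) h1
        (by fun_prop)).continuousWithinAt
    · exact hb u (mem_Ioi.1 hu).le y hy
  have hlim : ∀ y ∈ Icc a b, Tendsto (fun R : ℝ => ∫ x in s..R, H (x + y * I)) atTop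
      (𝓝 (∫ u in Ioi s, H (u + y * I))) := fun y hy =>
    intervalIntegral_tendsto_integral_Ioi s (hInt y hy) tendsto_id
  have hr := tendsto_verticalIntegral_zero hab hB0
    ((eventually_ge_atTop s).mono fun x hx => hb x hx)
  have htot := (((hlim a (left_mem_Icc.2 hab)).sub (hlim b (right_mem_Icc.2 hab))).add
    (hr.const_mul I)).sub (tendsto_const_nhds (x := I * ∫ y in a..b, H (s + y * I)))
  have hz : ∀ᶠ R : ℝ in atTop, (∫ x in s..R, H (x + a * I)) - (∫ x in s..R, H (x + b * I))
      + I * (∫ y in a..b, H (R + y * I)) - I * (∫ y in a..b, H (s + y * I)) = 0 := by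
    filter_upwards [eventually_ge_atTop s] with R hR
    exact rectangle_integral_eq_zero hR hab fun w h1 _ h3 h4 => hd w h1 h3 h4
  have := tendsto_nhds_unique (htot.congr' hz) tendsto_const_nhds
  rw [hook]
  linear_combination -this

/-- The two rays along `Im w = b` cancel identically, so integrability matters only on the segment.
-/
theorem hook_add {H : ℂ → ℂ} {s a b c : ℝ}
    (hab : IntervalIntegrable (fun y : ℝ => H (s + y * I)) volume a b)
    (hbc : IntervalIntegrable (fun y : ℝ => H (s + y * I)) volume b c) :
    hook H s a b + hook H s b c = hook H s a c := by
  simp only [hook]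
  rw [← intervalIntegral.integral_add_adjacent_intervals hab hbc]
  ring

theorem exists_bound_of_strip {E : Type*} [SeminormedAddCommGroup E] {f : ℂ → E} {a b : ℝ} (R : ℝ)
    (hf : ContinuousOn f {w | a ≤ w.im ∧ w.im ≤ b}) :
    ∃ C, 0 ≤ C ∧ ∀ w : ℂ, |w.re| ≤ R → a ≤ w.im → w.im ≤ b → ‖f w‖ ≤ C := by
  have hK : IsCompact (Icc (-R) R ×ℂ Icc a b) := isCompact_Icc.reProdIm isCompact_Icc
  obtain ⟨C, hC⟩ := hK.exists_bound_of_continuousOn (f := f)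
    (hf.mono fun w hw => ⟨hw.2.1, hw.2.2⟩)
  exact ⟨max C 0, le_max_right _ _, fun w h1 h2 h3 =>
    (hC w ⟨abs_le.1 h1, h2, h3⟩).trans (le_max_left _ _)⟩

/-! ### Bounds and line integrals for `1 / cosh` and `1 / sinh`. -/

theorem exp_abs_le_two_cosh (x : ℝ) : Real.exp |x| ≤ 2 * Real.cosh x := by
  rw [Real.cosh_eq]
  rcases abs_cases x with ⟨h, -⟩ | ⟨h, -⟩ <;> rw [h] <;>
    linarith [Real.exp_pos x, Real.exp_pos (-x)]

/-- The modulus dominates the real part `cosh x cos y`. -/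
theorem cosh_mul_abs_cos_le_norm_cosh (w : ℂ) :
    Real.cosh w.re * |Real.cos w.im| ≤ ‖Complex.cosh w‖ := by
  have h : (Complex.cosh w).re = Real.cosh w.re * Real.cos w.im := by
    conv_lhs => rw [← re_add_im w, Complex.cosh_add, Complex.cosh_mul_I, Complex.sinh_mul_I]
    simp [← ofReal_cosh, ← ofReal_sinh, ← ofReal_cos, ← ofReal_sin]
  calc _ = |(Complex.cosh w).re| := by rw [h, abs_mul, abs_of_pos (Real.cosh_pos _)]
    _ ≤ _ := abs_re_le_norm _

theorem norm_inv_cosh_le {c : ℝ} (hc : 0 < c) {w : ℂ} (hw : c ≤ |Real.cos w.im|) :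
    ‖(Complex.cosh w)⁻¹‖ ≤ 2 / c * Real.exp (-|w.re|) := by
  have h1 := cosh_mul_abs_cos_le_norm_cosh w
  have h2 := exp_abs_le_two_cosh w.re
  have h3 : Real.exp |w.re| / 2 * c ≤ ‖Complex.cosh w‖ :=
    (mul_le_mul (by linarith) hw hc.le (Real.cosh_pos _).le).trans h1
  rw [norm_inv]
  calc _ ≤ (Real.exp |w.re| / 2 * c)⁻¹ := inv_anti₀ (by positivity) h3
    _ = _ := by rw [Real.exp_neg]; field_simp

theorem cosh_ne_zero_of_abs_im_lt {w : ℂ} (hw : |w.im| < Real.pi / 2) : Complex.cosh w ≠ 0 := by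
  have h := abs_lt.1 hw
  have h1 := cosh_mul_abs_cos_le_norm_cosh w
  have h2 : 0 < Real.cos w.im := Real.cos_pos_of_mem_Ioo ⟨by linarith, h.2⟩
  rw [← norm_pos_iff]
  exact lt_of_lt_of_le (mul_pos (Real.cosh_pos _) (abs_pos.2 h2.ne')) h1

theorem cos_le_abs_cos_of_abs_le {x b : ℝ} (hx : |x| ≤ b) (hb : b < Real.pi / 2) :
    Real.cos b ≤ |Real.cos x| := by
  rw [← Real.cos_abs x]
  exact (Real.cos_le_cos_of_nonneg_of_le_pi (abs_nonneg x) (by linarith [Real.pi_pos]) hx).trans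
    (le_abs_self _)

theorem abs_sub_le_add {u x : ℝ} : -|u - x| ≤ |x| - |u| := by
  have := abs_sub_abs_le_abs_sub u x
  linarith

theorem integral_inv_cosh : ∫ u : ℝ, (Real.cosh u)⁻¹ = Real.pi := by
  have hderiv : ∀ u : ℝ, HasDerivAt (fun u => 2 * Real.arctan (Real.exp u)) (Real.cosh u)⁻¹ u := by
    intro u
    refine (((Real.hasDerivAt_exp u).arctan).const_mul 2).congr_deriv ?_
    have := Real.exp_pos u
    rw [Real.cosh_eq, Real.exp_neg]
    field_simp
    ring
  have hInt : Integrable fun u : ℝ => (Real.cosh u)⁻¹ := by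
    refine (integrable_exp_neg_abs.const_mul 2).mono' ?_ (Eventually.of_forall fun u => ?_)
    · exact (Real.continuous_cosh.inv₀ fun u => (Real.cosh_pos u).ne').aestronglyMeasurable
    · have := norm_inv_cosh_le one_pos (w := u) (by simp)
      simpa [← ofReal_cosh] using this
  rw [integral_of_hasDerivAt_of_tendsto hderiv hInt (m := 0) (n := Real.pi)]
  · simp
  · have h := (Real.continuous_arctan.tendsto 0).comp Real.tendsto_exp_atBot
    simpa using h.const_mul 2
  · have h := (Real.tendsto_arctan_atTop.mono_right nhdsWithin_le_nhds).comp Real.tendsto_exp_atTop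
    simpa [mul_div_cancel₀] using h.const_mul 2

theorem integral_inv_cosh_line {b : ℝ} (hb : |b| < Real.pi / 2) :
    ∫ u : ℝ, (Complex.cosh (u + b * I))⁻¹ = Real.pi := by
  have h0 : ∫ u : ℝ, (Complex.cosh (u + (0 : ℝ) * I))⁻¹ = Real.pi := by
    rw [← integral_inv_cosh, ← integral_complex_ofReal]
    simp
  have key : ∀ w : ℂ, |w.im| ≤ |b| →
      ‖(Complex.cosh w)⁻¹‖ ≤ 2 / Real.cos |b| * Real.exp (-|w.re|) := fun w hw =>
    norm_inv_cosh_le (Real.cos_pos_of_mem_Ioo ⟨by linarith [abs_nonneg b, Real.pi_pos], hb⟩)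
      (cos_le_abs_cos_of_abs_le hw hb)
  have hd : ∀ w : ℂ, |w.im| ≤ |b| → DifferentiableAt ℂ (fun w => (Complex.cosh w)⁻¹) w :=
    fun w hw => (Complex.differentiable_cosh w).inv (cosh_ne_zero_of_abs_im_lt (hw.trans_lt hb))
  rw [← h0]
  rcases le_total 0 b with h | h
  · refine (integral_line_shift h (fun w h1 h2 => hd w ?_) (fun w h1 h2 => key w ?_)).symm <;>
    · rw [abs_of_nonneg h1]; exact h2.trans (le_abs_self b)
  · refine (integral_line_shift h (fun w h1 h2 => hd w ?_) (fun w h1 h2 => key w ?_)) <;>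
    · rw [abs_of_nonpos h2]; exact (neg_le_neg h1).trans (neg_le_abs b)

theorem sinh_eq_I_mul_cosh (w : ℂ) : Complex.sinh w = I * Complex.cosh (w - Real.pi / 2 * I) := by
  rw [Complex.cosh_sub, Complex.cosh_mul_I, Complex.sinh_mul_I, Complex.cos_pi_div_two,
    Complex.sin_pi_div_two]
  linear_combination Complex.sinh w * I_sq

theorem sinh_eq_neg_I_mul_cosh (w : ℂ) :
    Complex.sinh w = -I * Complex.cosh (w + Real.pi / 2 * I) := by
  rw [Complex.cosh_add, Complex.cosh_mul_I, Complex.sinh_mul_I, Complex.cos_pi_div_two,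
    Complex.sin_pi_div_two]
  linear_combination Complex.sinh w * I_sq

/-- A rotation by `iπ/2` turns `1/sinh` into `1/cosh` on a line inside its pole-free strip. The
opposite values above and below the real axis encode the residue of `1/sinh` at the origin. -/
theorem integral_inv_sinh_line_of_pos {b : ℝ} (h0 : 0 < b) (h1 : b < Real.pi) :
    ∫ u : ℝ, (Complex.sinh (u + b * I))⁻¹ = -I * Real.pi := by
  have hb : |b - Real.pi / 2| < Real.pi / 2 := abs_lt.2 ⟨by linarith, by linarith⟩
  rw [← integral_inv_cosh_line hb, ← integral_const_mul]
  congr 1 with u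
  rw [sinh_eq_I_mul_cosh, mul_inv, inv_I]
  congr 3
  push_cast
  ring

theorem integral_inv_sinh_line_of_neg {b : ℝ} (h0 : b < 0) (h1 : -Real.pi < b) :
    ∫ u : ℝ, (Complex.sinh (u + b * I))⁻¹ = I * Real.pi := by
  have hb : |b + Real.pi / 2| < Real.pi / 2 := abs_lt.2 ⟨by linarith, by linarith⟩
  rw [← integral_inv_cosh_line hb, ← integral_const_mul]
  congr 1 with u
  rw [sinh_eq_neg_I_mul_cosh, mul_inv, inv_neg, inv_I, neg_neg]
  congr 3
  push_cast
  ring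

theorem sinh_ne_zero_of_abs_im_lt {w : ℂ} (hw : |w.im| < Real.pi) (h0 : w ≠ 0) :
    Complex.sinh w ≠ 0 := by
  rcases lt_trichotomy w.im 0 with h | h | h
  · rw [sinh_eq_neg_I_mul_cosh]
    refine mul_ne_zero (by simp) (cosh_ne_zero_of_abs_im_lt ?_)
    have := abs_lt.1 hw
    simpa [abs_lt] using ⟨by linarith, by linarith⟩
  · intro hs
    have h1 : w = (w.re : ℂ) := by apply Complex.ext <;> simp [h]
    rw [h1, ← ofReal_sinh] at hs
    have h2 : w.re = 0 := Real.sinh_eq_zero.1 (by exact_mod_cast hs)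
    exact h0 (by rw [h1, h2]; simp)
  · rw [sinh_eq_I_mul_cosh]
    refine mul_ne_zero (by simp) (cosh_ne_zero_of_abs_im_lt ?_)
    have := abs_lt.1 hw
    simpa [abs_lt] using ⟨by linarith, by linarith⟩

/-- The quotient `sinh w / w`, extended to the origin. -/
def sinhc : ℂ → ℂ := dslope Complex.sinh 0

theorem sinhc_mul (w : ℂ) : w * sinhc w = Complex.sinh w := by
  have := sub_smul_dslope Complex.sinh 0 w
  simpa [sinhc] using this

theorem differentiable_sinhc : Differentiable ℂ sinhc := by
  have := (differentiableOn_dslope (c := (0 : ℂ)) (f := Complex.sinh) (s := univ)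
    univ_mem).2 Complex.differentiable_sinh.differentiableOn
  exact differentiableOn_univ.1 this

theorem sinhc_zero : sinhc 0 = 1 := by
  simp [sinhc]

theorem sinhc_neg (w : ℂ) : sinhc (-w) = sinhc w := by
  rcases eq_or_ne w 0 with rfl | h
  · simp
  · have h1 := sinhc_mul (-w)
    rw [Complex.sinh_neg, ← sinhc_mul w] at h1
    exact mul_left_cancel₀ h (by linear_combination -h1)

theorem sinhc_ne_zero {w : ℂ} (hw : |w.im| < Real.pi) : sinhc w ≠ 0 := by
  rcases eq_or_ne w 0 with rfl | h
  · simp [sinhc_zero]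
  · intro h1
    have := sinhc_mul w
    rw [h1, mul_zero] at this
    exact sinh_ne_zero_of_abs_im_lt hw h this.symm

theorem norm_inv_sinh_le {w : ℂ} (hw : 1 ≤ |w.re|) :
    ‖(Complex.sinh w)⁻¹‖ ≤ 4 * Real.exp (-|w.re|) := by
  have h1 : Real.exp |w.re| - Real.exp (-|w.re|) ≤ 2 * ‖Complex.sinh w‖ := by
    have h3 : ‖Complex.exp w - Complex.exp (-w)‖ = 2 * ‖Complex.sinh w‖ := by
      rw [← Complex.two_sinh, norm_mul]; simp
    rw [← h3]
    have h4 := norm_sub_norm_le (Complex.exp w) (Complex.exp (-w))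
    have h5 := norm_sub_norm_le (Complex.exp (-w)) (Complex.exp w)
    rw [norm_sub_rev] at h5
    simp only [Complex.norm_exp, neg_re] at h4 h5
    rcases abs_cases w.re with ⟨h, -⟩ | ⟨h, -⟩ <;> rw [h]
    · exact h4
    · simpa using h5
  have h2 : Real.exp (-|w.re|) ≤ 1 := Real.exp_le_one_iff.2 (by linarith)
  have h3 : 2 ≤ Real.exp |w.re| := by
    have := Real.add_one_le_exp |w.re|
    linarith
  rw [norm_inv]
  calc _ ≤ (Real.exp |w.re| / 4)⁻¹ := inv_anti₀ (by positivity) (by linarith)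
    _ = _ := by rw [Real.exp_neg]; field_simp

/-! ### The Cauchy formula in a strip. -/

theorem integral_line_translate (F : ℂ → ℂ) (y : ℝ) (w : ℂ) :
    ∫ u : ℝ, F (u + y * I - w) = ∫ u : ℝ, F (u + (y - w.im : ℝ) * I) := by
  rw [← integral_add_right_eq_self (fun u : ℝ => F (u + y * I - w)) w.re]
  congr 1 with u
  congr 1
  apply Complex.ext <;> simp

theorem abs_im_sub_lt {a b d : ℝ} {v w : ℂ} (hav : a ≤ v.im) (hvb : v.im ≤ b)
    (hwb : b - w.im < d) (haw : w.im - a < d) : |(v - w).im| < d :=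
  abs_lt.2 ⟨by simp only [sub_im]; linarith, by simp only [sub_im]; linarith⟩

/-- The Cauchy formula in a strip, for the kernel `1 / sinh`. -/
theorem integral_line_sub_integral_line_div_sinh {K : ℂ → ℂ} {a b C : ℝ} {w : ℂ}
    (haw : a < w.im) (hwb : w.im < b) (haw' : w.im - a < Real.pi) (hwb' : b - w.im < Real.pi)
    (hd : ∀ v : ℂ, a ≤ v.im → v.im ≤ b → DifferentiableAt ℂ K v)
    (hb : ∀ v : ℂ, a ≤ v.im → v.im ≤ b → ‖K v‖ ≤ C) :
    (∫ u : ℝ, K (u + b * I) * (Complex.sinh (u + b * I - w))⁻¹)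
      - ∫ u : ℝ, K (u + a * I) * (Complex.sinh (u + a * I - w))⁻¹
      = -(2 * Real.pi * I) * K w := by
  have hC : 0 ≤ C := (norm_nonneg _).trans (hb w haw.le hwb.le)
  set S : Set ℂ := {v | a ≤ v.im ∧ v.im ≤ b} with hS
  have hSw : S ∈ 𝓝 w := by
    have h1 : IsOpen {v : ℂ | a < v.im ∧ v.im < b} :=
      (isOpen_lt continuous_const Complex.continuous_im).inter
        (isOpen_lt Complex.continuous_im continuous_const)
    exact mem_of_superset (h1.mem_nhds ⟨haw, hwb⟩) fun v hv => ⟨hv.1.le, hv.2.le⟩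
  -- Subtracting the constant `K w` removes the pole of the kernel: `Φ` continues `(K v - K w) /
  -- sinh (v - w)` holomorphically through `w`, so its integral is the same over both lines. The
  -- subtracted constant contributes the explicit integrals of `1/sinh`.
  set Φ : ℂ → ℂ := fun v => dslope K w v * (sinhc (v - w))⁻¹ with hΦ
  have hΦd : ∀ v : ℂ, a ≤ v.im → v.im ≤ b → DifferentiableAt ℂ Φ v := by
    intro v h1 h2
    refine DifferentiableAt.mul ?_ ?_
    · rcases eq_or_ne v w with rfl | hne
      · have hdo : DifferentiableOn ℂ K S := fun x hx => (hd x hx.1 hx.2).differentiableWithinAt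
        exact ((differentiableOn_dslope hSw).2 hdo).differentiableAt hSw
      · exact (differentiableAt_dslope_of_ne hne).2 (hd v h1 h2)
    · refine DifferentiableAt.inv ?_ (sinhc_ne_zero (abs_im_sub_lt h1 h2 hwb' haw'))
      exact (differentiable_sinhc _).comp v (by fun_prop)
  have hΦeq : ∀ v, v ≠ w → Φ v = (K v - K w) * (Complex.sinh (v - w))⁻¹ := by
    intro v hv
    have : v - w ≠ 0 := sub_ne_zero.2 hv
    simp only [hΦ]
    rw [dslope_of_ne _ hv, slope_def_field, ← sinhc_mul (v - w), mul_inv]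
    ring
  obtain ⟨C₁, hC₁, hC₁b⟩ := exists_bound_of_strip (|w.re| + 1) (f := Φ) (a := a) (b := b)
    fun v hv => (hΦd v hv.1 hv.2).continuousAt.continuousWithinAt
  have hΦb : ∀ v : ℂ, a ≤ v.im → v.im ≤ b → ‖Φ v‖ ≤
      (C₁ * Real.exp (|w.re| + 1) + 8 * C * Real.exp |w.re|) * Real.exp (-|v.re|) := by
    intro v h1 h2
    rcases le_total |v.re| (|w.re| + 1) with h | h
    · calc ‖Φ v‖ ≤ C₁ := hC₁b v h h1 h2
        _ ≤ C₁ * (Real.exp (|w.re| + 1) * Real.exp (-|v.re|)) := by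
          rw [← Real.exp_add]
          exact le_mul_of_one_le_right hC₁ (Real.one_le_exp (by linarith))
        _ ≤ _ := by
          rw [add_mul, mul_assoc]
          exact le_add_of_nonneg_right (by positivity)
    · have h3 := abs_sub_abs_le_abs_sub v.re w.re
      have hvw : v ≠ w := by
        rintro rfl
        linarith
      have h4 : 1 ≤ |(v - w).re| := by simp only [sub_re]; linarith
      rw [hΦeq v hvw, norm_mul]
      calc _ ≤ (2 * C) * (4 * Real.exp (-|(v - w).re|)) := by
            gcongr
            · calc _ ≤ ‖K v‖ + ‖K w‖ := norm_sub_le _ _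
                _ ≤ _ := by linarith [hb v h1 h2, hb w haw.le hwb.le]
            · exact norm_inv_sinh_le h4
        _ ≤ (2 * C) * (4 * (Real.exp |w.re| * Real.exp (-|v.re|))) := by
            rw [← Real.exp_add]
            gcongr
            simp only [sub_re]; linarith
        _ ≤ _ := by
            rw [add_mul]
            have : 0 ≤ C₁ * Real.exp (|w.re| + 1) * Real.exp (-|v.re|) := by positivity
            nlinarith
  have hInt : ∀ y ∈ Icc a b, Integrable fun u : ℝ => Φ (u + y * I) := by
    intro y hy
    refine (integrable_exp_neg_abs.const_mul _).mono' ?_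
      (Eventually.of_forall fun u => by simpa using hΦb (u + y * I) (by simpa using hy.1) (by simpa using hy.2))
    refine (continuous_iff_continuousAt.2 fun u => ?_).aestronglyMeasurable
    exact ContinuousAt.comp (f := fun u : ℝ => (u + y * I : ℂ))
      (hΦd _ (by simpa using hy.1) (by simpa using hy.2)).continuousAt (by fun_prop)
  have hinv : ∀ y ∈ Icc a b, y ≠ w.im →
      Integrable fun u : ℝ => (Complex.sinh (u + y * I - w))⁻¹ := by
    intro y hy hyw
    -- A non-integrable function has integral `0` by default, whereas this integral equals `± iπ`;
    -- integrability is therefore read off from the value.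
    by_contra hni
    have h0 := integral_line_translate (fun v => (Complex.sinh v)⁻¹) y w
    rw [integral_undef hni] at h0
    rcases lt_or_gt_of_ne hyw with h | h
    · rw [integral_inv_sinh_line_of_neg (by linarith) (by linarith [hy.1])] at h0
      simp [Real.pi_ne_zero] at h0
    · rw [integral_inv_sinh_line_of_pos (by linarith) (by linarith [hy.2])] at h0
      simp [Real.pi_ne_zero] at h0
  have hsplit : ∀ y ∈ Icc a b, y ≠ w.im →
      ∫ u : ℝ, K (u + y * I) * (Complex.sinh (u + y * I - w))⁻¹
        = (∫ u : ℝ, Φ (u + y * I)) + K w * ∫ u : ℝ, (Complex.sinh (u + (y - w.im : ℝ) * I))⁻¹ := by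
    intro y hy hyw
    rw [← integral_line_translate (fun v => (Complex.sinh v)⁻¹), ← integral_const_mul,
      ← integral_add (hInt y hy) ((hinv y hy hyw).const_mul _)]
    congr 1 with u
    rw [hΦeq]
    · ring
    · intro h0
      have := congrArg Complex.im h0
      exact hyw (by simpa using this)
  rw [hsplit b (right_mem_Icc.2 (haw.trans hwb).le) hwb.ne',
    hsplit a (left_mem_Icc.2 (haw.trans hwb).le) haw.ne,
    integral_inv_sinh_line_of_pos (by linarith) hwb',
    integral_inv_sinh_line_of_neg (by linarith) (by linarith),
    integral_line_shift (haw.trans hwb).le hΦd hΦb]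
  ring

/-! ### The kernel `μ coth (μ w) - coth w`. -/

/-- The function `μ coth (μ w) - coth w`; its value at the origin is its limit there. -/
def cothDiff (μ : ℝ) (w : ℂ) : ℂ :=
  μ * (Complex.cosh (μ * w) / Complex.sinh (μ * w)) - Complex.cosh w / Complex.sinh w

theorem cothDiff_neg (μ : ℝ) (w : ℂ) : cothDiff μ (-w) = -cothDiff μ w := by
  simp only [cothDiff, mul_neg, Complex.cosh_neg, Complex.sinh_neg, div_neg]
  ring

theorem cothDiff_conj (μ : ℝ) (w : ℂ) :
    cothDiff μ (starRingEnd ℂ w) = starRingEnd ℂ (cothDiff μ w) := by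
  have h : (μ : ℂ) * starRingEnd ℂ w = starRingEnd ℂ (μ * w) := by simp
  rw [cothDiff, cothDiff, h]
  simp only [← Complex.cosh_conj, ← Complex.sinh_conj, map_sub, map_mul, map_div₀, conj_ofReal]

theorem deriv_zero_of_even {p : ℂ → ℂ} (hp : ∀ w, p (-w) = p w) : deriv p 0 = 0 := by
  have h := deriv_comp_neg p 0
  simp only [hp, neg_zero] at h
  exact self_eq_neg.1 h

theorem abs_im_ofReal_mul_lt {μ b : ℝ} (hμ : 0 < μ) {w : ℂ} (hw : |w.im| < b / μ) :
    |((μ : ℂ) * w).im| < b := by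
  simp only [mul_im, ofReal_re, ofReal_im, zero_mul, add_zero, abs_mul, abs_of_pos hμ]
  rwa [lt_div_iff₀' hμ] at hw

theorem div_lt_of_one_lt {μ b : ℝ} (hμ : 1 < μ) (hb : 0 < b) : b / μ < b :=
  div_lt_self hb hμ

/-- The poles of the two terms at the origin cancel. The function under `dslope` is even, hence has
derivative `0` at the origin, which agrees with the value that division by zero gives to `cothDiff μ
0`. -/
theorem cothDiff_eq_dslope {μ : ℝ} (hμ : 1 < μ) :
    cothDiff μ = dslope (fun w => Complex.cosh (μ * w) / sinhc (μ * w)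
      - Complex.cosh w / sinhc w) 0 := by
  funext w
  rcases eq_or_ne w 0 with rfl | hw
  · rw [dslope_same, deriv_zero_of_even]
    · simp [cothDiff]
    · intro w
      simp only [mul_neg, Complex.cosh_neg, sinhc_neg]
  · have h0 : (μ : ℂ) ≠ 0 := by exact_mod_cast (by linarith : μ ≠ 0)
    rw [dslope_of_ne _ hw, slope_def_field, cothDiff, ← sinhc_mul (μ * w), ← sinhc_mul w]
    simp only [mul_zero, Complex.cosh_zero, sinhc_zero]
    simp only [div_eq_mul_inv, mul_inv, inv_one, mul_one, sub_self, sub_zero]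
    linear_combination (Complex.cosh (μ * w) * w⁻¹ * (sinhc (μ * w))⁻¹) * mul_inv_cancel₀ h0

theorem differentiableAt_cothDiff {μ : ℝ} (hμ : 1 < μ) {w : ℂ} (hw : |w.im| < Real.pi / μ) :
    DifferentiableAt ℂ (cothDiff μ) w := by
  have hμ0 : 0 < μ := by linarith
  set S : Set ℂ := {w | |w.im| < Real.pi / μ} with hS
  have hSo : IsOpen S := isOpen_lt (by fun_prop) continuous_const
  have h0 : S ∈ 𝓝 (0 : ℂ) := hSo.mem_nhds (by simp [hS]; positivity)
  have hp : DifferentiableOn ℂ (fun w => Complex.cosh (μ * w) / sinhc (μ * w)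
      - Complex.cosh w / sinhc w) S := by
    intro v hv
    have h1 : sinhc (μ * v) ≠ 0 := sinhc_ne_zero (abs_im_ofReal_mul_lt hμ0 hv)
    have h2 : sinhc v ≠ 0 := sinhc_ne_zero (lt_trans hv (div_lt_of_one_lt hμ Real.pi_pos))
    refine DifferentiableAt.differentiableWithinAt ?_
    have h3 : DifferentiableAt ℂ (fun w => sinhc (μ * w)) v :=
      (differentiable_sinhc _).comp v (by fun_prop)
    exact ((by fun_prop : DifferentiableAt ℂ (fun w => Complex.cosh (μ * w)) v).div h3 h1).sub
      ((Complex.differentiable_cosh v).div (differentiable_sinhc v) h2)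
  rw [cothDiff_eq_dslope hμ]
  exact ((differentiableOn_dslope h0).2 hp).differentiableAt (hSo.mem_nhds hw)

theorem norm_coth_sub_one_le {w : ℂ} (hw : 1 ≤ w.re) :
    ‖Complex.cosh w / Complex.sinh w - 1‖ ≤ 4 * Real.exp (-w.re) := by
  have h1 := norm_inv_sinh_le (w := w) (hw.trans (le_abs_self _))
  rw [abs_of_nonneg (by linarith)] at h1
  have h0 : Complex.sinh w ≠ 0 := by
    intro h0
    have h3 : Complex.exp w = Complex.exp (-w) := by
      have := Complex.two_sinh w
      rw [h0, mul_zero] at this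
      exact (sub_eq_zero.1 this.symm)
    have h4 := congrArg norm h3
    rw [Complex.norm_exp, Complex.norm_exp, Real.exp_eq_exp, neg_re] at h4
    linarith
  have h2 : Complex.cosh w / Complex.sinh w - 1 = Complex.exp (-w) * (Complex.sinh w)⁻¹ := by
    rw [← Complex.cosh_sub_sinh]
    field_simp
  rw [h2, norm_mul, Complex.norm_exp, neg_re]
  calc _ ≤ 1 * (4 * Real.exp (-w.re)) := by
        gcongr
        exact Real.exp_le_one_iff.2 (by linarith)
    _ = _ := one_mul _

/-- To the right both hyperbolic cotangents are `1 + O(e^{-Re w})`; oddness and compactness give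
boundedness on the rest of the strip. The weaker rate `1/2` is kept because `e^{-u/2}`, which grows
to the left, must remain integrable against `1/cosh`. -/
theorem exists_norm_cothDiff_sub_le {μ b : ℝ} (hμ : 1 < μ) (hb : b < Real.pi / μ) :
    ∃ C, 0 ≤ C ∧ ∀ w : ℂ, |w.im| ≤ b →
      ‖cothDiff μ w‖ ≤ C ∧ ‖cothDiff μ w - (μ - 1)‖ ≤ C * Real.exp (-(w.re / 2)) := by
  obtain ⟨C₀, hC₀, hC₀b⟩ := exists_bound_of_strip 1 (f := cothDiff μ) (a := -b) (b := b)
    fun v hv => (differentiableAt_cothDiff hμ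
      ((abs_le.2 hv).trans_lt hb)).continuousAt.continuousWithinAt
  have hfar : ∀ w : ℂ, 1 ≤ w.re → ‖cothDiff μ w - (μ - 1)‖ ≤ (4 * μ + 4) * Real.exp (-w.re) := by
    intro w hw
    have h1 := norm_coth_sub_one_le hw
    have h2 := norm_coth_sub_one_le (w := μ * w) (by simp; nlinarith)
    have h3 : Real.exp (-((μ : ℂ) * w).re) ≤ Real.exp (-w.re) := by
      rw [Real.exp_le_exp]; simp; nlinarith
    have h4 : cothDiff μ w - (μ - 1) = μ * (Complex.cosh (μ * w) / Complex.sinh (μ * w) - 1)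
        - (Complex.cosh w / Complex.sinh w - 1) := by rw [cothDiff]; ring
    rw [h4]
    calc _ ≤ ‖(μ : ℂ) * (Complex.cosh (μ * w) / Complex.sinh (μ * w) - 1)‖
          + ‖Complex.cosh w / Complex.sinh w - 1‖ := norm_sub_le _ _
      _ ≤ μ * (4 * Real.exp (-w.re)) + 4 * Real.exp (-w.re) := by
        rw [norm_mul, norm_real, Real.norm_of_nonneg (by linarith)]
        gcongr
        linarith
      _ = _ := by ring
  have hnear : ∀ w : ℂ, 1 ≤ w.re → ‖cothDiff μ w‖ ≤ 5 * μ + 4 := by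
    intro w hw
    have h1 := hfar w hw
    have h2 : Real.exp (-w.re) ≤ 1 := Real.exp_le_one_iff.2 (by linarith)
    have h3 : ‖(μ - 1 : ℂ)‖ = μ - 1 := by
      rw [← ofReal_one, ← ofReal_sub, norm_real, Real.norm_of_nonneg (by linarith)]
    have h4 := norm_sub_norm_le (cothDiff μ w) (μ - 1)
    nlinarith
  have hbd : ∀ w : ℂ, |w.im| ≤ b → ‖cothDiff μ w‖ ≤ C₀ + 5 * μ + 4 := by
    intro w hw
    rcases le_total |w.re| 1 with h | h
    · linarith [hC₀b w h (abs_le.1 hw).1 (abs_le.1 hw).2]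
    · rcases le_abs.1 h with h | h
      · linarith [hnear w h]
      · have := hnear (-w) (by simpa using h)
        rw [cothDiff_neg, norm_neg] at this
        linarith
  refine ⟨Real.exp 1 * (C₀ + 6 * μ + 4), by positivity, fun w hw => ⟨?_, ?_⟩⟩
  · have h1 := hbd w hw
    have h2 : 1 ≤ Real.exp 1 := Real.one_le_exp (by norm_num)
    nlinarith
  · rcases le_total 1 w.re with h | h
    · have h2 : 1 ≤ Real.exp 1 := Real.one_le_exp (by norm_num)
      calc _ ≤ (4 * μ + 4) * Real.exp (-w.re) := hfar w h
        _ ≤ _ := by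
          gcongr
          · nlinarith
          · linarith
    · have h3 : ‖(μ - 1 : ℂ)‖ = μ - 1 := by
        rw [← ofReal_one, ← ofReal_sub, norm_real, Real.norm_of_nonneg (by linarith)]
      have h4 : 1 ≤ Real.exp 1 * Real.exp (-(w.re / 2)) := by
        rw [← Real.exp_add]
        exact Real.one_le_exp (by linarith)
      calc _ ≤ ‖cothDiff μ w‖ + ‖(μ - 1 : ℂ)‖ := norm_sub_le _ _
        _ ≤ 1 * (C₀ + 6 * μ + 4) := by rw [h3]; linarith [hbd w hw]
        _ ≤ (Real.exp 1 * Real.exp (-(w.re / 2))) * (C₀ + 6 * μ + 4) := by gcongr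
        _ = _ := by ring

theorem norm_sinh_le_cosh_re (w : ℂ) : ‖Complex.sinh w‖ ≤ Real.cosh w.re := by
  have h3 : ‖Complex.exp w - Complex.exp (-w)‖ = 2 * ‖Complex.sinh w‖ := by
    rw [← Complex.two_sinh, norm_mul]; simp
  have h4 := norm_sub_le (Complex.exp w) (Complex.exp (-w))
  simp only [Complex.norm_exp, neg_re] at h4
  rw [Real.cosh_eq]
  linarith

/-! ### The convolution that defines the logarithmic derivative of `E`. -/

/-- The convolution of `cothDiff μ` with `1 / cosh`, along the line `Im = β`. -/
def cothConv (μ β : ℝ) (w : ℂ) : ℂ :=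
  -(1 / (2 * Real.pi)) * ∫ u : ℝ, cothDiff μ (u + β * I) * (Complex.cosh (u + β * I - w))⁻¹

theorem norm_inv_cosh_sub_le {b : ℝ} (hb0 : 0 ≤ b) (hb : b < Real.pi / 2) {v w : ℂ}
    (hvw : |v.im - w.im| ≤ b) :
    ‖(Complex.cosh (v - w))⁻¹‖ ≤ 2 / Real.cos b * Real.exp (-|v.re - w.re|) := by
  simpa using norm_inv_cosh_le (w := v - w)
    (Real.cos_pos_of_mem_Ioo ⟨by linarith [Real.pi_pos], hb⟩)
    (cos_le_abs_cos_of_abs_le (by simpa using hvw) hb)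

theorem exp_neg_abs_sub_le {u x r : ℝ} (hx : |x| ≤ r) :
    Real.exp (-|u - x|) ≤ Real.exp r * Real.exp (-|u|) := by
  rw [← Real.exp_add, Real.exp_le_exp]
  linarith [abs_sub_le_add (u := u) (x := x)]

theorem continuous_cothDiff_line {μ β : ℝ} (hμ : 1 < μ) (hβ : |β| < Real.pi / μ) :
    Continuous fun u : ℝ => cothDiff μ (u + β * I) := by
  refine continuous_iff_continuousAt.2 fun u => ?_
  exact ContinuousAt.comp (f := fun u : ℝ => (u + β * I : ℂ))
    (differentiableAt_cothDiff hμ (by simpa using hβ)).continuousAt (by fun_prop)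

theorem continuous_inv_cosh_line {β : ℝ} {w : ℂ} (hw : |β - w.im| < Real.pi / 2) :
    Continuous fun u : ℝ => (Complex.cosh (u + β * I - w))⁻¹ := by
  refine Continuous.inv₀ (by fun_prop) fun u => cosh_ne_zero_of_abs_im_lt (by simpa using hw)

theorem differentiableAt_cothConv {μ β : ℝ} (hμ : 1 < μ) (hβ : |β| < Real.pi / μ) {w : ℂ}
    (hw : |β - w.im| < Real.pi / 2) : DifferentiableAt ℂ (cothConv μ β) w := by
  obtain ⟨b, hb1, hb2⟩ := exists_between hw
  have hb0 : 0 ≤ b := (abs_nonneg _).trans hb1.le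
  obtain ⟨C, hC0, hC⟩ := exists_norm_cothDiff_sub_le hμ hβ
  have hcb : 0 < Real.cos b := Real.cos_pos_of_mem_Ioo ⟨by linarith [Real.pi_pos], hb2⟩
  set S : Set ℂ := {v | |β - v.im| < b ∧ |v.re| < |w.re| + 1} with hS
  have hSo : IsOpen S := by
    have h1 : IsOpen {v : ℂ | |β - v.im| < b} := isOpen_lt (by fun_prop) continuous_const
    have h2 : IsOpen {v : ℂ | |v.re| < |w.re| + 1} := isOpen_lt (by fun_prop) continuous_const
    exact h1.inter h2
  have hSw : S ∈ 𝓝 w := hSo.mem_nhds ⟨hb1, by linarith⟩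
  have hF : ∀ v ∈ S, ∀ u : ℝ, ‖(Complex.cosh (u + β * I - v))⁻¹‖
      ≤ 2 / Real.cos b * (Real.exp (|w.re| + 1) * Real.exp (-|u|)) := by
    intro v hv u
    have h1 := norm_inv_cosh_sub_le (v := u + β * I) hb0 hb2 (by simpa using hv.1.le)
    refine h1.trans ?_
    gcongr
    simpa using exp_neg_abs_sub_le (u := u) hv.2.le
  have hexp := integrable_exp_neg_abs
  have hmeas : ∀ v ∈ S, AEStronglyMeasurable
      (fun u : ℝ => cothDiff μ (u + β * I) * (Complex.cosh (u + β * I - v))⁻¹) := fun v hv =>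
    ((continuous_cothDiff_line hμ hβ).mul
      (continuous_inv_cosh_line (hv.1.trans hb2))).aestronglyMeasurable
  have key := hasDerivAt_integral_of_dominated_loc_of_deriv_le (𝕜 := ℂ) (x₀ := w) (s := S)
    (μ := (volume : Measure ℝ))
    (F := fun v u => cothDiff μ (u + β * I) * (Complex.cosh (u + β * I - v))⁻¹)
    (F' := fun v u => cothDiff μ (u + β * I) *
      (Complex.sinh (u + β * I - v) * (Complex.cosh (u + β * I - v))⁻¹
        * (Complex.cosh (u + β * I - v))⁻¹))
    (bound := fun u => C * ((Real.cos b)⁻¹ * (2 / Real.cos b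
      * (Real.exp (|w.re| + 1) * Real.exp (-|u|))))) hSw
    (by filter_upwards [hSw] with v hv using hmeas v hv) ?_ ?_ ?_ ?_ ?_
  · exact (key.2.const_mul _).differentiableAt
  · refine (((hexp.const_mul (Real.exp (|w.re| + 1))).const_mul (2 / Real.cos b)).const_mul C).mono' (hmeas w (mem_of_mem_nhds hSw))
      (Eventually.of_forall fun u => ?_)
    rw [norm_mul]
    gcongr
    · exact (hC _ (by simp)).1
    · exact hF w (mem_of_mem_nhds hSw) u
  · refine ((continuous_cothDiff_line hμ hβ).mul (Continuous.mul (Continuous.mul (by fun_prop) ?_) ?_)).aestronglyMeasurable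
    all_goals exact continuous_inv_cosh_line hw
  · refine Eventually.of_forall fun u v hv => ?_
    rw [norm_mul, norm_mul]
    gcongr
    · exact (hC _ (by simp)).1
    · rw [norm_mul, norm_inv]
      have h1 := norm_sinh_le_cosh_re (u + β * I - v)
      have h2 := cosh_mul_abs_cos_le_norm_cosh (u + β * I - v)
      have h3 := cos_le_abs_cos_of_abs_le (x := (u + β * I - v).im) (by simpa using hv.1.le) hb2
      have h4 := Real.cosh_pos (u + β * I - v).re
      have h5 : 0 < ‖Complex.cosh (u + β * I - v)‖ := norm_pos_iff.2
        (cosh_ne_zero_of_abs_im_lt (by simpa using hv.1.trans hb2))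
      rw [← div_eq_mul_inv, div_le_iff₀ h5, inv_mul_eq_div, le_div_iff₀ hcb]
      nlinarith
    · exact hF v hv u
  · exact ((((hexp.const_mul _).const_mul _).const_mul _).const_mul _)
  · refine Eventually.of_forall fun u v hv => ?_
    have hne : Complex.cosh (u + β * I - v) ≠ 0 :=
      cosh_ne_zero_of_abs_im_lt (by simpa using hv.1.trans hb2)
    have h1 : HasDerivAt (fun v => (u + β * I - v : ℂ)) (-1) v := by
      simpa using (hasDerivAt_id v).const_sub (u + β * I : ℂ)
    have h2 := ((h1.ccosh).inv hne).const_mul (cothDiff μ (u + β * I))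
    refine h2.congr_deriv ?_
    field_simp

/-- No pole of `cothDiff` and no pole of `1 / cosh (v - w)` lies between the two lines, so the
integral does not see which one is used. -/
theorem cothConv_eq_of_le {μ β γ : ℝ} (hμ : 1 < μ) (hβγ : β ≤ γ) (hβ : |β| < Real.pi / μ)
    (hγ : |γ| < Real.pi / μ) {w : ℂ} (hβw : |β - w.im| < Real.pi / 2)
    (hγw : |γ - w.im| < Real.pi / 2) : cothConv μ β w = cothConv μ γ w := by
  have hin : ∀ y, β ≤ y → y ≤ γ → |y| ≤ max |β| |γ| ∧ |y - w.im| ≤ max |β - w.im| |γ - w.im| :=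
    fun y h1 h2 => ⟨abs_le_max_abs_abs h1 h2, abs_le_max_abs_abs (by linarith) (by linarith)⟩
  have hb1 := max_lt hβ hγ
  have hb2 := max_lt hβw hγw
  obtain ⟨C, hC0, hC⟩ := exists_norm_cothDiff_sub_le hμ hb1
  have hb0 : 0 ≤ max |β - w.im| |γ - w.im| := (abs_nonneg _).trans (le_max_left _ _)
  have hcb := Real.cos_pos_of_mem_Ioo ⟨by linarith [Real.pi_pos], hb2⟩
  rw [cothConv, cothConv]
  congr 1
  refine integral_line_shift (H := fun v => cothDiff μ v * (Complex.cosh (v - w))⁻¹)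
    (C := C * (2 / Real.cos (max |β - w.im| |γ - w.im|) * Real.exp |w.re|)) hβγ
    (fun v h1 h2 => ?_) (fun v h1 h2 => ?_)
  · obtain ⟨h3, h4⟩ := hin v.im h1 h2
    refine (differentiableAt_cothDiff hμ (h3.trans_lt hb1)).mul (DifferentiableAt.inv (by fun_prop) ?_)
    exact cosh_ne_zero_of_abs_im_lt (by simpa using h4.trans_lt hb2)
  · obtain ⟨h3, h4⟩ := hin v.im h1 h2
    rw [norm_mul, mul_assoc, mul_assoc]
    gcongr
    · exact (hC v h3).1
    · refine (norm_inv_cosh_sub_le hb0 hb2 h4).trans ?_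
      gcongr
      exact exp_neg_abs_sub_le le_rfl

theorem cothConv_eq {μ β γ : ℝ} (hμ : 1 < μ) (hβ : |β| < Real.pi / μ)
    (hγ : |γ| < Real.pi / μ) {w : ℂ} (hβw : |β - w.im| < Real.pi / 2)
    (hγw : |γ - w.im| < Real.pi / 2) : cothConv μ β w = cothConv μ γ w := by
  rcases le_total β γ with h | h
  · exact cothConv_eq_of_le hμ h hβ hγ hβw hγw
  · exact (cothConv_eq_of_le hμ h hγ hβ hγw hβw).symm

theorem cothConv_neg (μ β : ℝ) (w : ℂ) : cothConv μ (-β) (-w) = -cothConv μ β w := by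
  rw [cothConv, cothConv, ← mul_neg, ← integral_neg, ← integral_neg_eq_self]
  congr 2 with u
  have h1 : (((-u : ℝ) : ℂ) + ((-β : ℝ) : ℂ) * I) = -(u + β * I) := by push_cast; ring
  have h2 : -(u + β * I) - -w = -(u + β * I - w) := by ring
  rw [h1, h2, cothDiff_neg, Complex.cosh_neg]
  ring

theorem cothConv_conj (μ β : ℝ) (w : ℂ) :
    cothConv μ (-β) (starRingEnd ℂ w) = starRingEnd ℂ (cothConv μ β w) := by
  rw [cothConv, cothConv, map_mul, ← integral_conj]
  congr 1
  · simp [map_ofNat]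
  · congr 1 with u
    have h1 : ((u : ℂ) + ((-β : ℝ) : ℂ) * I) = starRingEnd ℂ (u + β * I) := by
      simp
    rw [h1, cothDiff_conj, ← map_sub, Complex.cosh_conj]
    simp

/-- The limit is `-1/(2π)` times the limit `μ - 1` of the kernel times the mass `π` of `1/cosh`. The
error is `e^{-u/2}` convolved with `e^{-|u|}`, again a multiple of `e^{-u/2}`. -/
theorem exists_norm_cothConv_add_le {μ b c : ℝ} (hμ : 1 < μ) (hb : b < Real.pi / μ)
    (hc0 : 0 ≤ c) (hc : c < Real.pi / 2) :
    ∃ C, 0 ≤ C ∧ ∀ β : ℝ, ∀ w : ℂ, |β| ≤ b → |β - w.im| ≤ c →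
      ‖cothConv μ β w + (μ - 1) / 2‖ ≤ C * Real.exp (-(w.re / 2)) := by
  obtain ⟨C, hC0, hC⟩ := exists_norm_cothDiff_sub_le hμ hb
  have hcc := Real.cos_pos_of_mem_Ioo ⟨by linarith [Real.pi_pos], hc⟩
  have hexp := integrable_exp_mul_sub_abs (a := -1 / 2) (by norm_num [abs_lt])
  set J := ∫ u : ℝ, Real.exp (-1 / 2 * u - |u|) with hJ
  have hJ0 : 0 ≤ J := integral_nonneg fun u => (Real.exp_pos _).le
  refine ⟨1 / (2 * Real.pi) * (C * (2 / Real.cos c) * J), by positivity, fun β w hβ hw => ?_⟩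
  have hβ' := hβ.trans_lt hb
  have hw' := hw.trans_lt hc
  have hInt : Integrable fun u : ℝ =>
      (cothDiff μ (u + β * I)) * (Complex.cosh (u + β * I - w))⁻¹ := by
    refine ((integrable_exp_neg_abs.const_mul (Real.exp |w.re|)).const_mul (C * (2 / Real.cos c))).mono'
      ((continuous_cothDiff_line hμ hβ').mul (continuous_inv_cosh_line hw')).aestronglyMeasurable
      (Eventually.of_forall fun u => ?_)
    rw [norm_mul, mul_assoc]
    gcongr
    · exact (hC _ (by simpa using hβ)).1
    · refine (norm_inv_cosh_sub_le hc0 hc (by simpa using hw)).trans ?_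
      gcongr
      simpa using exp_neg_abs_sub_le (u := u) (x := w.re) le_rfl
  have hint2 : Integrable fun u : ℝ => (Complex.cosh (u + β * I - w))⁻¹ := by
    refine ((integrable_exp_neg_abs.const_mul (Real.exp |w.re|)).const_mul ((2 / Real.cos c))).mono'
      (continuous_inv_cosh_line hw').aestronglyMeasurable
      (Eventually.of_forall fun u => ?_)
    refine (norm_inv_cosh_sub_le hc0 hc (by simpa using hw)).trans ?_
    gcongr
    simpa using exp_neg_abs_sub_le (u := u) (x := w.re) le_rfl
  have hpi : ∫ u : ℝ, (Complex.cosh (u + β * I - w))⁻¹ = Real.pi := by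
    rw [integral_line_translate (fun v => (Complex.cosh v)⁻¹), integral_inv_cosh_line hw']
  have heq : cothConv μ β w + (μ - 1) / 2 = -(1 / (2 * Real.pi)) *
      ∫ u : ℝ, (cothDiff μ (u + β * I) - (μ - 1)) * (Complex.cosh (u + β * I - w))⁻¹ := by
    simp only [sub_mul (cothDiff μ _)]
    rw [integral_sub hInt (hint2.const_mul _), integral_const_mul, hpi, cothConv]
    have : (Real.pi : ℂ) ≠ 0 := by exact_mod_cast Real.pi_ne_zero
    field_simp
    ring
  have hnorm : ‖∫ u : ℝ, (cothDiff μ (u + β * I) - (μ - 1)) * (Complex.cosh (u + β * I - w))⁻¹‖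
      ≤ ∫ u : ℝ, C * (2 / Real.cos c) * (Real.exp (-(w.re / 2)) *
        Real.exp (-1 / 2 * (u - w.re) - |u - w.re|)) := by
    refine norm_integral_le_of_norm_le
      (((hexp.comp_sub_right w.re).const_mul _).const_mul _) (Eventually.of_forall fun u => ?_)
    rw [norm_mul]
    calc _ ≤ (C * Real.exp (-(u / 2))) * (2 / Real.cos c * Real.exp (-|u - w.re|)) := by
          gcongr
          · simpa using (hC (u + β * I) (by simpa using hβ)).2
          · simpa using norm_inv_cosh_sub_le (v := u + β * I) hc0 hc (by simpa using hw)
      _ = C * (2 / Real.cos c) * (Real.exp (-(u / 2)) * Real.exp (-|u - w.re|)) := by ring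
      _ = _ := by
          rw [← Real.exp_add, ← Real.exp_add]
          ring_nf
  rw [heq, norm_mul]
  have h2 : ‖(-(1 / (2 * Real.pi)) : ℂ)‖ = 1 / (2 * Real.pi) := by
    rw [norm_neg]
    have : (1 / (2 * Real.pi) : ℂ) = ((1 / (2 * Real.pi) : ℝ) : ℂ) := by push_cast; ring
    rw [this, norm_real, Real.norm_of_nonneg (by positivity)]
  rw [h2]
  refine (mul_le_mul_of_nonneg_left hnorm (by positivity)).trans (le_of_eq ?_)
  rw [integral_const_mul, integral_const_mul,
    integral_sub_right_eq_self (fun u : ℝ => Real.exp (-1 / 2 * u - |u|)) w.re]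
  ring

/-- The convolution of `μ coth (μ w) - coth w` with `-1 / (2π cosh)`, continued to the strip
`|Im w| < π / 2 + π / μ` by tilting the line of integration. -/
def logDerivE (μ : ℝ) (w : ℂ) : ℂ := cothConv μ (2 / (μ + 2) * w.im) w

/-- A line at height `β` serves for `Im w = y` when `|β| < π/μ` and `|β - y| < π/2`. With `β =
2y/(μ+2)` the height is divided in the ratio of the two allowances, and both conditions become `|y|
< π/2 + π/μ`. -/
theorem logDerivE_line {μ y : ℝ} (hμ : 1 < μ) :
    |2 / (μ + 2) * y| = 2 / (μ + 2) * |y| ∧ |2 / (μ + 2) * y - y| = μ / (μ + 2) * |y| := by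
  have h2 : 2 / (μ + 2) * y - y = -(μ / (μ + 2) * y) := by
    field_simp
    ring
  constructor
  · rw [abs_mul, abs_of_pos (by positivity)]
  · rw [h2, abs_neg, abs_mul, abs_of_pos (by positivity)]

theorem logDerivE_line_lt {μ y : ℝ} (hμ : 1 < μ) (hy : |y| < Real.pi / 2 + Real.pi / μ) :
    2 / (μ + 2) * |y| < Real.pi / μ ∧ μ / (μ + 2) * |y| < Real.pi / 2 := by
  have h0 : 0 < μ := by linarith
  have e1 : 2 / (μ + 2) * (Real.pi / 2 + Real.pi / μ) = Real.pi / μ := by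
    field_simp
  have e2 : μ / (μ + 2) * (Real.pi / 2 + Real.pi / μ) = Real.pi / 2 := by
    field_simp
  constructor
  · rw [← e1]
    exact mul_lt_mul_of_pos_left hy (by positivity)
  · rw [← e2]
    exact mul_lt_mul_of_pos_left hy (by positivity)

theorem logDerivE_eq {μ β : ℝ} (hμ : 1 < μ) {w : ℂ} (hβ : |β| < Real.pi / μ)
    (hw : |β - w.im| < Real.pi / 2) : logDerivE μ w = cothConv μ β w := by
  have h1 : |w.im| < Real.pi / 2 + Real.pi / μ := by
    have := abs_sub_abs_le_abs_sub w.im β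
    rw [abs_sub_comm w.im] at this
    linarith
  obtain ⟨h2, h3⟩ := logDerivE_line_lt hμ h1
  obtain ⟨h4, h5⟩ := logDerivE_line (y := w.im) hμ
  exact cothConv_eq hμ (h4 ▸ h2) hβ (h5 ▸ h3) hw

theorem differentiableAt_logDerivE {μ : ℝ} (hμ : 1 < μ) {w : ℂ}
    (hw : |w.im| < Real.pi / 2 + Real.pi / μ) : DifferentiableAt ℂ (logDerivE μ) w := by
  obtain ⟨h2, h3⟩ := logDerivE_line_lt hμ hw
  obtain ⟨h4, h5⟩ := logDerivE_line (y := w.im) hμ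
  rw [← h4] at h2
  rw [← h5] at h3
  -- The tilted height depends on `w.im`, which is not holomorphic in `w`; near a given point it may
  -- be frozen by independence of the line.
  refine (differentiableAt_cothConv hμ h2 h3).congr_of_eventuallyEq ?_
  have h6 : {v : ℂ | |2 / (μ + 2) * w.im - v.im| < Real.pi / 2} ∈ 𝓝 w :=
    (isOpen_lt (by fun_prop) continuous_const).mem_nhds h3
  filter_upwards [h6] with v hv
  exact logDerivE_eq hμ h2 hv

theorem logDerivE_neg (μ : ℝ) (w : ℂ) : logDerivE μ (-w) = -logDerivE μ w := by
  rw [logDerivE, logDerivE, ← cothConv_neg, neg_im, mul_neg]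

theorem logDerivE_conj (μ : ℝ) (w : ℂ) :
    logDerivE μ (starRingEnd ℂ w) = starRingEnd ℂ (logDerivE μ w) := by
  rw [logDerivE, logDerivE, ← cothConv_conj, conj_im, mul_neg]

theorem exists_norm_logDerivE_add_le {μ U : ℝ} (hμ : 1 < μ)
    (hU : |U| < Real.pi / 2 + Real.pi / μ) :
    ∃ C, 0 ≤ C ∧ ∀ w : ℂ, |w.im| ≤ |U| →
      ‖logDerivE μ w + (μ - 1) / 2‖ ≤ C * Real.exp (-(w.re / 2)) := by
  obtain ⟨h2, h3⟩ := logDerivE_line_lt hμ hU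
  obtain ⟨C, hC0, hC⟩ := exists_norm_cothConv_add_le hμ h2 (by positivity) h3
  refine ⟨C, hC0, fun w hw => hC _ _ ?_ ?_⟩
  · rw [(logDerivE_line hμ).1]; gcongr
  · rw [(logDerivE_line hμ).2]; gcongr

/-! ### The two difference equations of the logarithmic derivative. -/

theorem inv_cosh_sub (x : ℂ) : (Complex.cosh (x - Real.pi / 2 * I))⁻¹ = I * (Complex.sinh x)⁻¹ := by
  rw [sinh_eq_I_mul_cosh x, mul_inv, inv_I]
  linear_combination ((Complex.cosh (x - Real.pi / 2 * I))⁻¹) * I_sq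

theorem inv_cosh_add (x : ℂ) :
    (Complex.cosh (x + Real.pi / 2 * I))⁻¹ = -I * (Complex.sinh x)⁻¹ := by
  rw [sinh_eq_neg_I_mul_cosh x, mul_inv, inv_neg, inv_I]
  linear_combination ((Complex.cosh (x + Real.pi / 2 * I))⁻¹) * I_sq

/-- At `w ± iπ/2` the factor `1/cosh` becomes `± i / sinh (v - w)`, and the admissible lines pass
just above and just below the pole `v = w`. The sum is then a residue, by the Cauchy formula in the
strip. -/
theorem logDerivE_add_logDerivE {μ : ℝ} (hμ : 1 < μ) {w : ℂ} (hw : |w.im| < Real.pi / μ) :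
    logDerivE μ (w + Real.pi / 2 * I) + logDerivE μ (w - Real.pi / 2 * I) = -cothDiff μ w := by
  have hπ := Real.pi_pos
  obtain ⟨η, hη0, hη⟩ := exists_between
    (lt_min (sub_pos.2 hw) (by positivity : (0 : ℝ) < Real.pi / 2))
  have hη1 : η < Real.pi / μ - |w.im| := hη.trans_le (min_le_left _ _)
  have hη2 : η < Real.pi / 2 := hη.trans_le (min_le_right _ _)
  have hb : |w.im + η| < Real.pi / μ := by
    have := abs_add_le w.im η
    rw [abs_of_pos hη0] at this; linarith
  have ha : |w.im - η| < Real.pi / μ := by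
    have := abs_sub w.im η
    rw [abs_of_pos hη0] at this; linarith
  obtain ⟨C, -, hC⟩ := exists_norm_cothDiff_sub_le hμ (max_lt ha hb)
  have key := integral_line_sub_integral_line_div_sinh (K := cothDiff μ) (w := w) (C := C)
    (a := w.im - η) (b := w.im + η) (by linarith) (by linarith) (by linarith) (by linarith)
    (fun v h1 h2 => differentiableAt_cothDiff hμ
      ((abs_le_max_abs_abs h1 h2).trans_lt (max_lt ha hb)))
    (fun v h1 h2 => (hC v (abs_le_max_abs_abs h1 h2)).1)
  rw [logDerivE_eq (β := w.im + η) hμ hb (by simp [abs_lt]; constructor <;> linarith),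
    logDerivE_eq (β := w.im - η) hμ ha (by simp [abs_lt]; constructor <;> linarith),
    cothConv, cothConv]
  simp only [← sub_sub, inv_cosh_sub, sub_sub_eq_add_sub, add_sub_right_comm _ (Real.pi / 2 * I),
    inv_cosh_add]
  simp only [mul_left_comm _ I, mul_left_comm _ (-I), integral_const_mul]
  have hπ' : (Real.pi : ℂ) ≠ 0 := by exact_mod_cast Real.pi_ne_zero
  generalize (∫ u : ℝ, cothDiff μ (u + (w.im + η : ℝ) * I) *
    (Complex.sinh (u + (w.im + η : ℝ) * I - w))⁻¹) = T at key ⊢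
  generalize (∫ u : ℝ, cothDiff μ (u + (w.im - η : ℝ) * I) *
    (Complex.sinh (u + (w.im - η : ℝ) * I - w))⁻¹) = T' at key ⊢
  field_simp
  linear_combination (-I) * key + 2 * Real.pi * cothDiff μ w * I_sq

theorem exp_eq_exp_mul_I {v : ℂ} {φ : ℝ} (h : Complex.exp v = Complex.exp (φ * I)) :
    ∃ n : ℤ, v.im = φ + n * (2 * Real.pi) := by
  obtain ⟨n, hn⟩ := Complex.exp_eq_exp_iff_exists_int.1 h
  refine ⟨n, ?_⟩
  have := congrArg Complex.im hn
  simpa using this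

theorem exp_pi_div_two_add (α : ℝ) :
    Complex.exp ((-(Real.pi / 2 + α) : ℝ) * I) = -(I * Complex.exp (-α * I)) := by
  have : ((-(Real.pi / 2 + α) : ℝ) : ℂ) * I = -(Real.pi / 2 * I) + -α * I := by push_cast; ring
  rw [this, Complex.exp_add, Complex.exp_neg, Complex.exp_pi_div_two_mul_I, inv_I]
  ring

theorem exp_add_ne_zero {α : ℝ} (hα : 0 < α) (hα' : α < Real.pi / 2) {v : ℂ}
    (hv : |v.im| < Real.pi / 2 + α) : Complex.exp v + I * Complex.exp (-α * I) ≠ 0 := by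
  intro h
  have h1 : Complex.exp v = Complex.exp ((-(Real.pi / 2 + α) : ℝ) * I) := by
    rw [exp_pi_div_two_add]
    exact eq_neg_of_add_eq_zero_left h
  obtain ⟨n, hn⟩ := exp_eq_exp_mul_I h1
  have h2 := abs_lt.1 hv
  have hπ := Real.pi_pos
  rcases le_or_gt n 0 with h3 | h3
  · have h4 : (n : ℝ) ≤ 0 := by exact_mod_cast h3
    nlinarith
  · have h4 : (1 : ℝ) ≤ n := by exact_mod_cast h3
    nlinarith

theorem exp_sub_ne_zero {α : ℝ} (hα : 0 < α) (hα' : α < Real.pi / 2) {v : ℂ}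
    (hv : |v.im| < Real.pi / 2 + α) : Complex.exp v - I * Complex.exp (α * I) ≠ 0 := by
  have h := exp_add_ne_zero hα hα' (v := starRingEnd ℂ v) (by simpa using hv)
  intro h0
  apply h
  have h1 := congrArg (starRingEnd ℂ) h0
  simp only [map_sub, map_mul, conj_I, ← Complex.exp_conj, conj_ofReal, map_zero] at h1
  rw [← h1]
  ring_nf

/-- The logarithmic derivative of `(e^w + i e^{-iα}) / (e^w - i e^{iα})`. -/
def wallKernel (α : ℝ) (w : ℂ) : ℂ :=
  Complex.exp w / (Complex.exp w + I * Complex.exp (-α * I))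
    - Complex.exp w / (Complex.exp w - I * Complex.exp (α * I))

theorem differentiableAt_wallKernel {α : ℝ} (hα : 0 < α) (hα' : α < Real.pi / 2) {v : ℂ}
    (hv : |v.im| < Real.pi / 2 + α) : DifferentiableAt ℂ (wallKernel α) v := by
  have h1 := exp_add_ne_zero hα hα' hv
  have h2 := exp_sub_ne_zero hα hα' hv
  unfold wallKernel
  fun_prop (disch := assumption)

theorem norm_exp_div_le {v c : ℂ} (hc : ‖c‖ = 1) (hv : 1 ≤ |v.re|) :
    ‖Complex.exp v / (Complex.exp v + c)‖ ≤ 2 := by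
  have h1 := norm_sub_norm_le (Complex.exp v) (-c)
  have h2 := norm_sub_norm_le (-c) (Complex.exp v)
  rw [norm_sub_rev] at h2
  rw [sub_neg_eq_add, norm_neg, hc, Complex.norm_exp] at h1 h2
  have he : 2 ≤ Real.exp |v.re| := by
    have := Real.add_one_le_exp |v.re|
    linarith
  rw [norm_div, Complex.norm_exp]
  have hpos := Real.exp_pos v.re
  have h3 : Real.exp v.re ≤ 2 * ‖Complex.exp v + c‖ := by
    rcases abs_cases v.re with ⟨h, -⟩ | ⟨h, -⟩ <;> rw [h] at he
    · linarith
    · have h4 : Real.exp (-v.re) * Real.exp v.re = 1 := by rw [← Real.exp_add]; simp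
      nlinarith
  exact div_le_of_le_mul₀ (norm_nonneg _) (by norm_num) h3

theorem exists_norm_wallKernel_le {α : ℝ} (hα : 0 < α) (hα' : α < Real.pi / 2) :
    ∃ C, ∀ v : ℂ, |v.im| ≤ Real.pi / 2 → ‖wallKernel α v‖ ≤ C := by
  obtain ⟨C, -, hC⟩ := exists_bound_of_strip 1 (f := wallKernel α) (a := -(Real.pi / 2))
    (b := Real.pi / 2) fun v hv => (differentiableAt_wallKernel hα hα'
      ((abs_le.2 hv).trans_lt (by linarith))).continuousAt.continuousWithinAt
  refine ⟨max C 4, fun v hv => ?_⟩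
  rcases le_total |v.re| 1 with h | h
  · exact (hC v h (abs_le.1 hv).1 (abs_le.1 hv).2).trans (le_max_left _ _)
  · have h1 := norm_exp_div_le (v := v) (c := I * Complex.exp (-α * I))
      (by simp [Complex.norm_exp]) h
    have h2 := norm_exp_div_le (v := v) (c := -(I * Complex.exp (α * I)))
      (by simp [Complex.norm_exp]) h
    rw [← sub_eq_add_neg] at h2
    refine (norm_sub_le _ _).trans (le_trans ?_ (le_max_right _ _))
    linarith

/-- With `x = e^u` and `A = e^{iα}`, the left side is `coth (u - iα) - coth (u + iα)` and the right
side its expansion in partial fractions. -/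
theorem coth_identity {x A : ℂ} (hx : x ≠ 0) (hA : A ≠ 0) (h1 : x ^ 2 * A ^ 2 - 1 ≠ 0)
    (h2 : x ^ 2 - A ^ 2 ≠ 0) :
    (x * A⁻¹ + (x * A⁻¹)⁻¹) / (x * A⁻¹ - (x * A⁻¹)⁻¹) - (x * A + (x * A)⁻¹) / (x * A - (x * A)⁻¹)
      = -((I * x / (I * x + I * A⁻¹) - I * x / (I * x - I * A))
        + (-I * x / (-I * x + I * A⁻¹) - -I * x / (-I * x - I * A))) := by
  have a1 : x * A + 1 ≠ 0 := fun h => h1 (by linear_combination (x * A - 1) * h)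
  have a2 : x * A - 1 ≠ 0 := fun h => h1 (by linear_combination (x * A + 1) * h)
  have a3 : x + A ≠ 0 := fun h => h2 (by linear_combination (x - A) * h)
  have a4 : x - A ≠ 0 := fun h => h2 (by linear_combination (x + A) * h)
  have e1 : I * x / (I * x + I * A⁻¹) = x * A / (x * A + 1) := by
    rw [← mul_add, mul_div_mul_left _ _ I_ne_zero, div_eq_div_iff ?_ a1]
    · field_simp
    · intro h; apply a1; field_simp at h; linear_combination h
  have e2 : I * x / (I * x - I * A) = x / (x - A) := by
    rw [← mul_sub, mul_div_mul_left _ _ I_ne_zero]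
  have e3 : -I * x / (-I * x + I * A⁻¹) = x * A / (x * A - 1) := by
    have : -I * x + I * A⁻¹ = -I * (x - A⁻¹) := by ring
    rw [this, mul_div_mul_left _ _ (neg_ne_zero.2 I_ne_zero), div_eq_div_iff ?_ a2]
    · field_simp
    · intro h; apply a2; field_simp at h; linear_combination h
  have e4 : -I * x / (-I * x - I * A) = x / (x + A) := by
    have : -I * x - I * A = -I * (x + A) := by ring
    rw [this, mul_div_mul_left _ _ (neg_ne_zero.2 I_ne_zero)]
  have e5 : (x * A⁻¹ + (x * A⁻¹)⁻¹) / (x * A⁻¹ - (x * A⁻¹)⁻¹) = (x ^ 2 + A ^ 2) / (x ^ 2 - A ^ 2) := by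
    have b : x * A⁻¹ - (x * A⁻¹)⁻¹ = (x ^ 2 - A ^ 2) / (x * A) := by field_simp
    rw [b]
    field_simp
  have e6 : (x * A + (x * A)⁻¹) / (x * A - (x * A)⁻¹)
      = (x ^ 2 * A ^ 2 + 1) / (x ^ 2 * A ^ 2 - 1) := by
    have b : x * A - (x * A)⁻¹ = (x ^ 2 * A ^ 2 - 1) / (x * A) := by field_simp
    rw [b]
    field_simp
  rw [e1, e2, e3, e4, e5, e6]
  field_simp
  ring

theorem coth_add_eq (x : ℂ) :
    Complex.cosh (x + Real.pi / 2 * I) / Complex.sinh (x + Real.pi / 2 * I)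
      = Complex.sinh x / Complex.cosh x := by
  rw [Complex.cosh_add, Complex.sinh_add, Complex.cosh_mul_I, Complex.sinh_mul_I,
    Complex.cos_pi_div_two, Complex.sin_pi_div_two]
  simp only [mul_zero, zero_add, one_mul]
  rw [mul_div_mul_right _ _ I_ne_zero]

theorem coth_sub_eq (x : ℂ) :
    Complex.cosh (x - Real.pi / 2 * I) / Complex.sinh (x - Real.pi / 2 * I)
      = Complex.sinh x / Complex.cosh x := by
  rw [Complex.cosh_sub, Complex.sinh_sub, Complex.cosh_mul_I, Complex.sinh_mul_I,
    Complex.cos_pi_div_two, Complex.sin_pi_div_two]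
  simp only [mul_zero, zero_sub, one_mul]
  rw [neg_div_neg_eq, mul_div_mul_right _ _ I_ne_zero]

theorem coth_eq_exp (w : ℂ) : Complex.cosh w / Complex.sinh w
    = (Complex.exp w + (Complex.exp w)⁻¹) / (Complex.exp w - (Complex.exp w)⁻¹) := by
  rw [← Complex.exp_neg, ← Complex.two_cosh, ← Complex.two_sinh,
    mul_div_mul_left _ _ two_ne_zero]

theorem exp_add_pi_div_two (w : ℂ) : Complex.exp (w + Real.pi / 2 * I) = I * Complex.exp w := by
  rw [Complex.exp_add, Complex.exp_pi_div_two_mul_I, mul_comm]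

theorem exp_sub_pi_div_two (w : ℂ) : Complex.exp (w - Real.pi / 2 * I) = -I * Complex.exp w := by
  rw [Complex.exp_sub, Complex.exp_pi_div_two_mul_I, div_eq_mul_inv, inv_I, mul_comm]

/-- Because `μα = π/2`, both terms `μ coth (μu ± iπ/2)` equal `μ tanh (μu)` and cancel. What is left
involves only `coth (u ± iα)`, which are rational in `e^u`. -/
theorem cothDiff_sub_cothDiff {μ α : ℝ} (hα : 0 < α) (hα' : α < Real.pi / 2)
    (hμα : μ * α = Real.pi / 2) (u : ℝ) :
    cothDiff μ (u + α * I) - cothDiff μ (u - α * I)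
      = -(wallKernel α (u + Real.pi / 2 * I) + wallKernel α (u - Real.pi / 2 * I)) := by
  have hμα' : (μ : ℂ) * α = Real.pi / 2 := by
    have := congrArg (fun x : ℝ => (x : ℂ)) hμα
    push_cast at this
    exact this
  have e1 : (μ : ℂ) * (u + α * I) = μ * u + Real.pi / 2 * I := by rw [← hμα']; ring
  have e2 : (μ : ℂ) * (u - α * I) = μ * u - Real.pi / 2 * I := by rw [← hμα']; ring
  rw [cothDiff, cothDiff, e1, e2, coth_add_eq, coth_sub_eq, coth_eq_exp, coth_eq_exp,
    wallKernel, wallKernel, exp_add_pi_div_two, exp_sub_pi_div_two, Complex.exp_add, sub_eq_add_neg (u : ℂ),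
    Complex.exp_add, Complex.exp_neg, neg_mul (α : ℂ), Complex.exp_neg]
  have hx : Complex.exp u ≠ 0 := Complex.exp_ne_zero _
  have hA : Complex.exp (α * I) ≠ 0 := Complex.exp_ne_zero _
  have hne : ∀ σ : ℝ, |σ| = α → Complex.exp (u + σ * I) ≠ Complex.exp (-(u + σ * I)) := by
    intro σ hσ h
    have h1 : Complex.sinh (u + σ * I) = 0 := by
      have := Complex.two_sinh (u + σ * I)
      rw [h, sub_self] at this
      simpa using this
    refine sinh_ne_zero_of_abs_im_lt (by simp [hσ]; linarith [Real.pi_pos]) ?_ h1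
    intro h2
    have := congrArg Complex.im h2
    simp at this
    rw [this] at hσ
    simp at hσ
    linarith
  have h1 : Complex.exp u ^ 2 * Complex.exp (α * I) ^ 2 - 1 ≠ 0 := by
    intro h
    apply hne α (abs_of_pos hα)
    rw [Complex.exp_neg, Complex.exp_add]
    refine eq_inv_of_mul_eq_one_left ?_
    linear_combination h
  have h2 : Complex.exp u ^ 2 - Complex.exp (α * I) ^ 2 ≠ 0 := by
    intro h
    apply hne (-α) (by rw [abs_neg, abs_of_pos hα])
    rw [Complex.exp_neg, Complex.exp_add, ofReal_neg, neg_mul, Complex.exp_neg]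
    refine eq_inv_of_mul_eq_one_left ?_
    field_simp
    linear_combination h
  have := coth_identity hx hA h1 h2
  linear_combination this

/-- The shifts `± iα` are transferred from `1/cosh` to `cothDiff`, whose difference is minus a sum
of values of `wallKernel` at `u ± iπ/2`. There `1/cosh` is `± i / sinh`, and the Cauchy formula on
`|Im| ≤ π/2` reproduces `wallKernel α w`. -/
theorem logDerivE_sub_logDerivE {μ α : ℝ} (hμ : 1 < μ) (hα : 0 < α) (hα' : α < Real.pi / 2)
    (hμα : μ * α = Real.pi / 2) {w : ℂ} (hw : |w.im| < Real.pi / 2) :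
    logDerivE μ (w + α * I) - logDerivE μ (w - α * I) = wallKernel α w := by
  have hπ := Real.pi_pos
  have hπ' : (Real.pi : ℂ) ≠ 0 := by exact_mod_cast Real.pi_ne_zero
  have hαμ : |α| < Real.pi / μ := by
    rw [abs_of_pos hα, lt_div_iff₀ (by linarith)]
    linarith
  have hw0 : |0 - w.im| < Real.pi / 2 := by simpa using hw
  have hInt : ∀ σ : ℝ, |σ| = α → Integrable fun u : ℝ =>
      cothDiff μ (u + σ * I) * (Complex.cosh (u - w))⁻¹ := by
    intro σ hσ
    have hσ' : |σ| < Real.pi / μ := by rw [hσ]; exact (le_abs_self _).trans_lt hαμ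
    obtain ⟨C, hC0, hC⟩ := exists_norm_cothDiff_sub_le hμ hσ'
    have hcw : 0 < Real.cos |w.im| :=
      Real.cos_pos_of_mem_Ioo ⟨by linarith [abs_nonneg w.im], hw⟩
    have hcont : Continuous fun u : ℝ => (Complex.cosh (u - w))⁻¹ := by
      simpa using continuous_inv_cosh_line hw0
    refine ((integrable_exp_neg_abs.const_mul (Real.exp |w.re|)).const_mul
      (C * (2 / Real.cos |w.im|))).mono'
      ((continuous_cothDiff_line hμ hσ').mul hcont).aestronglyMeasurable
      (Eventually.of_forall fun u => ?_)
    rw [norm_mul, mul_assoc]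
    gcongr
    · exact (hC _ (by simp)).1
    · refine (norm_inv_cosh_sub_le (abs_nonneg _) hw (by simp)).trans ?_
      gcongr
      simpa using exp_neg_abs_sub_le (u := u) (x := w.re) le_rfl
  have h1 := hInt α (abs_of_pos hα)
  have h2 := hInt (-α) (by rw [abs_neg, abs_of_pos hα])
  obtain ⟨C, hC⟩ := exists_norm_wallKernel_le hα hα'
  have hW : ∀ v : ℂ, -(Real.pi / 2) ≤ v.im → v.im ≤ Real.pi / 2 → |v.im| ≤ Real.pi / 2 :=
    fun v h3 h4 => abs_le.2 ⟨h3, h4⟩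
  have hw' := abs_lt.1 hw
  have key := integral_line_sub_integral_line_div_sinh (K := wallKernel α) (w := w) (C := C)
    (a := -(Real.pi / 2)) (b := Real.pi / 2) hw'.1 hw'.2 (by linarith) (by linarith)
    (fun v h3 h4 => differentiableAt_wallKernel hα hα' ((hW v h3 h4).trans_lt (by linarith)))
    (fun v h3 h4 => hC v (hW v h3 h4))
  have hwint : ∀ σ : ℝ, |σ| = 1 → Integrable fun u : ℝ =>
      wallKernel α (u + σ * (Real.pi / 2) * I) * (Complex.cosh (u - w))⁻¹ := by
    intro σ hσ
    have hcw : 0 < Real.cos |w.im| :=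
      Real.cos_pos_of_mem_Ioo ⟨by linarith [abs_nonneg w.im], hw⟩
    have hcont : Continuous fun u : ℝ => (Complex.cosh (u - w))⁻¹ := by
      simpa using continuous_inv_cosh_line hw0
    have him : ∀ u : ℝ, |(u + σ * (Real.pi / 2) * I : ℂ).im| ≤ Real.pi / 2 := fun u => by
      simp [abs_mul, hσ, abs_of_pos (half_pos hπ)]
    have hcont2 : Continuous fun u : ℝ => wallKernel α (u + σ * (Real.pi / 2) * I) :=
      continuous_iff_continuousAt.2 fun u =>
        ContinuousAt.comp (f := fun u : ℝ => (u + σ * (Real.pi / 2) * I : ℂ))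
          (differentiableAt_wallKernel hα hα' ((him u).trans_lt (by linarith))).continuousAt
          (by fun_prop)
    have hC0 : 0 ≤ C := (norm_nonneg _).trans (hC _ (him 0))
    refine ((integrable_exp_neg_abs.const_mul (Real.exp |w.re|)).const_mul
      (C * (2 / Real.cos |w.im|))).mono' (hcont2.mul hcont).aestronglyMeasurable
      (Eventually.of_forall fun u => ?_)
    rw [norm_mul, mul_assoc C]
    gcongr
    · exact hC _ (him u)
    · refine (norm_inv_cosh_sub_le (abs_nonneg _) hw (by simp)).trans ?_
      gcongr
      simpa using exp_neg_abs_sub_le (u := u) (x := w.re) le_rfl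
  have h3 := hwint 1 (by simp)
  have h4 := hwint (-1) (by simp)
  have hA : logDerivE μ (w + α * I) = -(1 / (2 * Real.pi)) * ∫ u : ℝ,
      cothDiff μ (u + α * I) * (Complex.cosh (u - w))⁻¹ := by
    rw [logDerivE_eq (β := α) hμ hαμ (by simpa using hw), cothConv]
    simp only [add_sub_add_right_eq_sub]
  have hB : logDerivE μ (w - α * I) = -(1 / (2 * Real.pi)) * ∫ u : ℝ,
      cothDiff μ (u - α * I) * (Complex.cosh (u - w))⁻¹ := by
    rw [logDerivE_eq (β := -α) hμ (by rwa [abs_neg]) (by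
      have h : ((α : ℂ) * I).im = α := by simp
      have h' : -α - (w.im - α) = -w.im := by ring
      rwa [sub_im, h, h', abs_neg]), cothConv]
    simp only [ofReal_neg, neg_mul, ← sub_eq_add_neg, sub_sub_sub_cancel_right]
  have hD : (∫ u : ℝ, cothDiff μ (u + α * I) * (Complex.cosh (u - w))⁻¹)
      - (∫ u : ℝ, cothDiff μ (u - α * I) * (Complex.cosh (u - w))⁻¹)
      = -((∫ u : ℝ, wallKernel α (u + Real.pi / 2 * I) * (Complex.cosh (u - w))⁻¹)
        + ∫ u : ℝ, wallKernel α (u - Real.pi / 2 * I) * (Complex.cosh (u - w))⁻¹) := by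
    simp only [ofReal_neg, ofReal_one, neg_mul, one_mul, ← sub_eq_add_neg] at h2 h3 h4
    rw [← integral_sub h1 h2, ← integral_add h3 h4, ← integral_neg]
    congr 1 with u
    rw [← sub_mul, cothDiff_sub_cothDiff hα hα' hμα]
    ring
  have hE : ∀ u : ℝ, (Complex.cosh (u - w))⁻¹ = I * (Complex.sinh (u + Real.pi / 2 * I - w))⁻¹ := by
    intro u
    rw [← inv_cosh_sub]
    congr 2
    ring
  have hF : ∀ u : ℝ, (Complex.cosh (u - w))⁻¹ = -I * (Complex.sinh (u - Real.pi / 2 * I - w))⁻¹ := by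
    intro u
    rw [← inv_cosh_add]
    congr 2
    ring
  have hE' : ∫ u : ℝ, wallKernel α (u + Real.pi / 2 * I) * (Complex.cosh (u - w))⁻¹
      = I * ∫ u : ℝ, wallKernel α (u + (Real.pi / 2 : ℝ) * I)
        * (Complex.sinh (u + (Real.pi / 2 : ℝ) * I - w))⁻¹ := by
    rw [← integral_const_mul]
    congr 1 with u
    rw [hE]
    push_cast
    ring
  have hF' : ∫ u : ℝ, wallKernel α (u - Real.pi / 2 * I) * (Complex.cosh (u - w))⁻¹
      = -I * ∫ u : ℝ, wallKernel α (u + (-(Real.pi / 2) : ℝ) * I)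
        * (Complex.sinh (u + (-(Real.pi / 2) : ℝ) * I - w))⁻¹ := by
    rw [← integral_const_mul]
    congr 1 with u
    rw [hF]
    push_cast
    simp only [neg_mul, ← sub_eq_add_neg]
    ring
  rw [hE', hF'] at hD
  rw [hA, hB, ← mul_sub, hD]
  have : (1 / (2 * Real.pi) : ℂ) * (2 * Real.pi) = 1 := by field_simp
  linear_combination (1 / (2 * Real.pi) * I) * key - wallKernel α w * I_sq * (1 / (2 * Real.pi) * (2 * Real.pi)) + wallKernel α w * this

/-! ### The primitive of the logarithmic derivative and its asymptotics. -/

/-- The primitive along segments from the origin: differentiation under the integral produces `M (t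
w) + w t M' (t w)`, which is the `t`-derivative of `t M (t w)`. -/
theorem hasDerivAt_mul_integral_of_starShaped {M : ℂ → ℂ} {S : Set ℂ} (hS : IsOpen S)
    (hst : ∀ w ∈ S, ∀ t ∈ Icc (0 : ℝ) 1, (t : ℂ) * w ∈ S) (hM : DifferentiableOn ℂ M S)
    {w : ℂ} (hw : w ∈ S) :
    HasDerivAt (fun w => w * ∫ t in (0 : ℝ)..1, M (t * w)) (M w) w := by
  have hM' : ContinuousOn (deriv M) S := (hM.deriv hS).continuousOn
  obtain ⟨r, hr, hrS⟩ := Metric.nhds_basis_closedBall.mem_iff.1 (hS.mem_nhds hw)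
  have hK : IsCompact ((fun p : ℝ × ℂ => (p.1 : ℂ) * p.2) '' (Icc 0 1 ×ˢ Metric.closedBall w r)) :=
    (isCompact_Icc.prod (isCompact_closedBall w r)).image (by fun_prop)
  have hKS : ((fun p : ℝ × ℂ => (p.1 : ℂ) * p.2) '' (Icc 0 1 ×ˢ Metric.closedBall w r)) ⊆ S := by
    rintro _ ⟨⟨t, v⟩, ⟨ht, hv⟩, rfl⟩
    exact hst v (hrS hv) t ht
  obtain ⟨C, hC⟩ := hK.exists_bound_of_continuousOn (hM'.mono hKS)
  have hcont : ∀ v ∈ S, ∀ G : ℂ → ℂ, ContinuousOn G S →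
      ContinuousOn (fun t : ℝ => G (t * v)) (Icc 0 1) := fun v hv G hG =>
    hG.comp (by fun_prop) fun t ht => hst v hv t ht
  have hin : Ioc (0 : ℝ) 1 ⊆ Icc 0 1 := Ioc_subset_Icc_self
  have hu : uIoc (0 : ℝ) 1 = Ioc 0 1 := uIoc_of_le zero_le_one
  have hI : ∀ G : ℂ → ℂ, ContinuousOn G S → IntervalIntegrable (fun t : ℝ => G (t * w)) volume 0 1 :=
    fun G hG => (by simpa using hcont w hw G hG : ContinuousOn _ (uIcc (0 : ℝ) 1)).intervalIntegrable
  have hcd : ContinuousOn (fun t : ℝ => (t : ℂ) * deriv M (t * w)) (Icc 0 1) :=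
    (by fun_prop : ContinuousOn (fun t : ℝ => (t : ℂ)) (Icc 0 1)).mul (hcont w hw _ hM')
  have key := intervalIntegral.hasDerivAt_integral_of_dominated_loc_of_deriv_le (𝕜 := ℂ)
    (x₀ := w) (a := (0 : ℝ)) (b := 1) (μ := volume)
    (s := Metric.closedBall w r) (F := fun v t => M (t * v)) (F' := fun v t => t * deriv M (t * v))
    (bound := fun _ => C) (Metric.closedBall_mem_nhds w hr) ?_ ?_ ?_ ?_ ?_ ?_
  · have h1 := (hasDerivAt_id w).mul key.2
    refine h1.congr_deriv ?_
    have h2 : ∀ t ∈ uIcc (0 : ℝ) 1, HasDerivAt (fun t : ℝ => (t : ℂ) * M (t * w))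
        (M (t * w) + w * (t * deriv M (t * w))) t := by
      intro t ht
      rw [uIcc_of_le zero_le_one] at ht
      have h3 : HasDerivAt M (deriv M (t * w)) (t * w) :=
        (hM.differentiableAt (hS.mem_nhds (hst w hw t ht))).hasDerivAt
      have h4 : HasDerivAt (fun t : ℝ => (t : ℂ)) 1 t := (hasDerivAt_id t).ofReal_comp
      have h5 : HasDerivAt (fun t : ℝ => (t : ℂ) * w) w t := by simpa using h4.mul_const w
      refine (h4.mul (h3.comp t h5)).congr_deriv ?_
      simp only [Function.comp_apply]
      ring
    have h3 := intervalIntegral.integral_eq_sub_of_hasDerivAt h2 (IntervalIntegrable.add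
      (hI M hM.continuousOn) (IntervalIntegrable.const_mul
        (ContinuousOn.intervalIntegrable (by simpa using hcd)) w))
    rw [intervalIntegral.integral_add (hI M hM.continuousOn) (IntervalIntegrable.const_mul
        (ContinuousOn.intervalIntegrable (by simpa using hcd)) w),
        intervalIntegral.integral_const_mul] at h3
    simpa using h3
  · filter_upwards [Metric.closedBall_mem_nhds w hr] with v hv
    rw [hu]
    exact ((hcont v (hrS hv) M hM.continuousOn).mono hin).aestronglyMeasurable measurableSet_Ioc
  · exact hI M hM.continuousOn
  · rw [hu]
    exact (hcd.mono hin).aestronglyMeasurable measurableSet_Ioc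
  · refine Eventually.of_forall fun t ht v hv => ?_
    rw [hu] at ht
    rw [norm_mul, norm_real, Real.norm_of_nonneg ht.1.le]
    have h1 := hC _ ⟨(t, v), ⟨hin ht, hv⟩, rfl⟩
    calc _ ≤ 1 * ‖deriv M (t * v)‖ := by gcongr; exact ht.2
      _ ≤ C := by simpa using h1
  · exact intervalIntegrable_const
  · refine Eventually.of_forall fun t ht v hv => ?_
    rw [hu] at ht
    have h3 : HasDerivAt M (deriv M (t * v)) (t * v) :=
      (hM.differentiableAt (hS.mem_nhds (hst v (hrS hv) t (hin ht)))).hasDerivAt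
    have h5 : HasDerivAt (fun v : ℂ => (t : ℂ) * v) t v := by
      simpa using (hasDerivAt_id v).const_mul (t : ℂ)
    refine (h3.comp v h5).congr_deriv ?_
    ring

/-- The primitive of `logDerivE μ` that vanishes at the origin. -/
def logE (μ : ℝ) (w : ℂ) : ℂ := w * ∫ t in (0 : ℝ)..1, logDerivE μ (t * w)

theorem isOpen_strip (V : ℝ) : IsOpen {w : ℂ | |w.im| < V} :=
  isOpen_lt (by fun_prop) continuous_const

theorem convex_strip (V : ℝ) : Convex ℝ {w : ℂ | |w.im| < V} := by
  have : {w : ℂ | |w.im| < V} = Complex.imCLM ⁻¹' {x : ℝ | |x| < V} := by ext; simp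
  rw [this]
  have h2 : {x : ℝ | |x| < V} = Ioo (-V) V := by ext; simp [abs_lt]
  rw [h2]
  exact (convex_Ioo _ _).linear_preimage Complex.imCLM.toLinearMap

theorem hasDerivAt_logE {μ : ℝ} (hμ : 1 < μ) {w : ℂ}
    (hw : |w.im| < Real.pi / 2 + Real.pi / μ) : HasDerivAt (logE μ) (logDerivE μ w) w := by
  refine hasDerivAt_mul_integral_of_starShaped (isOpen_strip (Real.pi / 2 + Real.pi / μ)) ?_ ?_ hw
  · intro v hv t ht
    simp only [mem_ofPred_eq, mul_im, ofReal_re, ofReal_im, zero_mul, add_zero, abs_mul,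
      abs_of_nonneg ht.1] at hv ⊢
    nlinarith [ht.2, ht.1, abs_nonneg v.im]
  · exact fun v hv => (differentiableAt_logDerivE hμ hv).differentiableWithinAt

theorem logE_neg (μ : ℝ) (w : ℂ) : logE μ (-w) = logE μ w := by
  simp only [logE, mul_neg, logDerivE_neg, intervalIntegral.integral_neg]
  ring

theorem logE_zero (μ : ℝ) : logE μ 0 = 0 := by simp [logE]

theorem logE_conj (μ : ℝ) (w : ℂ) : logE μ (starRingEnd ℂ w) = starRingEnd ℂ (logE μ w) := by
  have h : ∀ t : ℝ, logDerivE μ (t * starRingEnd ℂ w) = starRingEnd ℂ (logDerivE μ (t * w)) :=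
    fun t => by rw [← logDerivE_conj]; simp
  simp only [logE, h]
  rw [map_mul]
  congr 1
  rw [intervalIntegral.integral_of_le zero_le_one, intervalIntegral.integral_of_le zero_le_one,
    integral_conj]

/-- After the linear term is added the derivative is `O(e^{-Re w/2})`, so the function converges
along the real axis, and the limit extends across the strip by the mean value inequality on vertical
segments. Conjugation symmetry makes the limit real. -/
theorem exists_norm_logE_add_sub_le {μ U : ℝ} (hμ : 1 < μ)
    (hU : |U| < Real.pi / 2 + Real.pi / μ) :
    ∃ C₀ C : ℝ, 0 ≤ C ∧ ∀ w : ℂ, |w.im| ≤ |U| →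
      ‖logE μ w + (μ - 1) / 2 * w - C₀‖ ≤ C * Real.exp (-(w.re / 2)) := by
  obtain ⟨C, hC0, hC⟩ := exists_norm_logDerivE_add_le hμ hU
  set N : ℂ → ℂ := fun w => logE μ w + (μ - 1) / 2 * w with hN
  set N' : ℂ → ℂ := fun w => logDerivE μ w + (μ - 1) / 2 with hN'
  have hNd : ∀ w : ℂ, |w.im| ≤ |U| → HasDerivAt N (N' w) w := fun w hw => by
    exact (HasDerivAt.fun_add (hasDerivAt_logE hμ (hw.trans_lt hU))
      ((hasDerivAt_id w).const_mul ((μ - 1) / 2 : ℂ))).congr_deriv (by simp [hN'])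
  have hre : ∀ x : ℝ, |((x : ℂ)).im| ≤ |U| := fun x => by simp
  have hcont : Continuous fun x : ℝ => N' x := by
    refine continuous_iff_continuousAt.2 fun x => ContinuousAt.add ?_ continuousAt_const
    exact ContinuousAt.comp (g := logDerivE μ) (f := fun x : ℝ => (x : ℂ)) (differentiableAt_logDerivE hμ
      ((hre x).trans_lt hU)).continuousAt (by fun_prop)
  have hexp : ∀ x, IntegrableOn (fun t : ℝ => C * Real.exp (-(t / 2))) (Ioi x) := fun x => by
    have h5 : ∀ t : ℝ, -(t / 2) = -1 / 2 * t := fun t => by ring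
    simp only [h5]
    exact (integrableOn_exp_mul_Ioi (a := -1 / 2) (by norm_num) x).const_mul C
  have hbd : ∀ x : ℝ, ‖N' x‖ ≤ C * Real.exp (-(x / 2)) := fun x => by
    simpa using hC x (hre x)
  have hInt : ∀ x, IntegrableOn (fun t : ℝ => N' t) (Ioi x) := fun x =>
    (hexp x).mono' hcont.aestronglyMeasurable (Eventually.of_forall hbd)
  have hconj : starRingEnd ℂ (∫ t in Ioi (0 : ℝ), N' t) = ∫ t in Ioi (0 : ℝ), N' t := by
    rw [← integral_conj]
    congr 1 with t
    simp only [hN', map_add, ← logDerivE_conj, conj_ofReal, map_div₀, map_sub, map_one, map_ofNat]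
  obtain ⟨C₀, hC₀⟩ := Complex.conj_eq_iff_real.1 hconj
  have hreal : ∀ x : ℝ, ‖N x - C₀‖ ≤ 2 * C * Real.exp (-(x / 2)) := by
    intro x
    have h1 : ∫ t in (0 : ℝ)..x, N' t = N x - N 0 :=
      intervalIntegral.integral_eq_sub_of_hasDerivAt (f := fun x : ℝ => N x)
        (fun t _ => (hNd t (hre t)).comp_ofReal) (hcont.intervalIntegrable _ _)
    have h2 := intervalIntegral.integral_interval_add_Ioi (a := 0) (b := x) (hInt 0) (hInt x)
    have h3 : N x - C₀ = -∫ t in Ioi x, N' t := by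
      rw [← hC₀, ← h2, h1]
      simp [hN, logE_zero]
    rw [h3, norm_neg]
    refine (norm_integral_le_of_norm_le (hexp x) (Eventually.of_forall hbd)).trans (le_of_eq ?_)
    rw [integral_const_mul]
    have h4 := integral_exp_mul_Ioi (a := -1 / 2) (by norm_num) x
    have h5 : ∀ t : ℝ, -1 / 2 * t = -(t / 2) := fun t => by ring
    simp only [h5] at h4
    rw [h4]
    ring
  -- The term `2 * C` is the tail `∫ C e^{-t/2}` along the real axis, and `C * |U|` the variation on
  -- the vertical segment from `w.re` to `w`.
  refine ⟨C₀, 2 * C + C * |U|, by positivity, fun w hw => ?_⟩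
  have hconv : Convex ℝ {v : ℂ | v.re = w.re ∧ |v.im| ≤ |U|} := by
    have h1 : {v : ℂ | v.re = w.re ∧ |v.im| ≤ |U|}
        = Complex.reCLM ⁻¹' {w.re} ∩ Complex.imCLM ⁻¹' Icc (-|U|) |U| := by
      ext v; simp [abs_le]
    rw [h1]
    exact (Convex.linear_preimage (convex_singleton _) Complex.reCLM.toLinearMap).inter
      (Convex.linear_preimage (convex_Icc _ _) Complex.imCLM.toLinearMap)
  have h1 := hconv.norm_image_sub_le_of_norm_hasDerivWithin_le (f := N) (f' := N')
    (C := C * Real.exp (-(w.re / 2))) (x := w.re) (y := w)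
    (fun v hv => (hNd v hv.2).hasDerivWithinAt) (fun v hv => by
      have := hC v hv.2
      rwa [hv.1] at this) ⟨by simp, by simp⟩ ⟨rfl, hw⟩
  have h2 : ‖w - w.re‖ ≤ |U| := by
    have : w - w.re = w.im * I := by apply Complex.ext <;> simp
    rw [this]; simpa using hw
  have h3 : N w - C₀ = (N w - N w.re) + (N w.re - C₀) := by ring
  calc ‖N w - C₀‖ ≤ ‖N w - N w.re‖ + ‖N w.re - C₀‖ := by rw [h3]; exact norm_add_le _ _
    _ ≤ C * Real.exp (-(w.re / 2)) * |U| + 2 * C * Real.exp (-(w.re / 2)) :=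
      add_le_add (h1.trans (by gcongr)) (hreal _)
    _ = _ := by ring

/-! ### The multiplicative functional equations of `E`. -/

/-- The exponential of `logE μ`, a nowhere vanishing even function on the strip
`|Im w| < π / 2 + π / μ`. -/
def beachE (μ : ℝ) (w : ℂ) : ℂ := Complex.exp (logE μ w)

theorem beachE_ne_zero (μ : ℝ) (w : ℂ) : beachE μ w ≠ 0 := Complex.exp_ne_zero _

theorem beachE_neg (μ : ℝ) (w : ℂ) : beachE μ (-w) = beachE μ w := by rw [beachE, logE_neg, beachE]

theorem beachE_conj (μ : ℝ) (w : ℂ) :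
    beachE μ (starRingEnd ℂ w) = starRingEnd ℂ (beachE μ w) := by
  rw [beachE, logE_conj, Complex.exp_conj, beachE]

theorem hasDerivAt_beachE {μ : ℝ} (hμ : 1 < μ) {w : ℂ}
    (hw : |w.im| < Real.pi / 2 + Real.pi / μ) :
    HasDerivAt (beachE μ) (beachE μ w * logDerivE μ w) w :=
  (hasDerivAt_logE hμ hw).cexp

theorem hasDerivAt_beachE_add {μ : ℝ} (hμ : 1 < μ) {w c : ℂ}
    (hw : |(w + c).im| < Real.pi / 2 + Real.pi / μ) :
    HasDerivAt (fun w => beachE μ (w + c)) (beachE μ (w + c) * logDerivE μ (w + c)) w :=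
  (hasDerivAt_beachE hμ hw).comp_add_const w c

theorem convex_leftStrip (V : ℝ) : Convex ℝ {w : ℂ | w.re < 0 ∧ |w.im| < V} := by
  have h : Convex ℝ {w : ℂ | w.re < 0} := convex_halfSpace_re_lt 0
  exact h.inter (convex_strip V)

theorem isOpen_leftStrip (V : ℝ) : IsOpen {w : ℂ | w.re < 0 ∧ |w.im| < V} := by
  have h : IsOpen {w : ℂ | w.re < 0} := isOpen_lt (by fun_prop) continuous_const
  exact h.inter (isOpen_strip V)

/-- The quotient of the two sides has zero logarithmic derivative by `logDerivE_add_logDerivE`,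
hence is constant, and it is real at `-1`. The half strip `Re w < 0` avoids the zeros of `sinh` and
suffices for continuing the symbol to the left. -/
theorem exists_beachE_mul_beachE {μ : ℝ} (hμ : 1 < μ) :
    ∃ c : ℝ, ∀ w : ℂ, w.re < 0 → |w.im| < Real.pi / μ →
      beachE μ (w + Real.pi / 2 * I) * beachE μ (w - Real.pi / 2 * I) * Complex.sinh (μ * w)
        = c * Complex.sinh w := by
  have hμ0 : 0 < μ := by linarith
  have hπ := Real.pi_pos
  set S : Set ℂ := {w : ℂ | w.re < 0 ∧ |w.im| < Real.pi / μ} with hS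
  set P : ℂ → ℂ := fun w => beachE μ (w + Real.pi / 2 * I) * beachE μ (w + -(Real.pi / 2 * I))
    * (Complex.sinh (μ * w) / Complex.sinh w) with hP
  have hs1 : ∀ w ∈ S, Complex.sinh w ≠ 0 := fun w hw =>
    sinh_ne_zero_of_abs_im_lt (hw.2.trans (div_lt_of_one_lt hμ hπ)) fun h => by
      have := hw.1; simp [h] at this
  have hs2 : ∀ w ∈ S, Complex.sinh (μ * w) ≠ 0 := fun w hw =>
    sinh_ne_zero_of_abs_im_lt (abs_im_ofReal_mul_lt hμ0 hw.2) fun h => by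
      have := hw.1
      rcases mul_eq_zero.1 h with h | h
      · have : μ = 0 := by exact_mod_cast h
        linarith
      · simp [h] at this
  have hPd : ∀ w ∈ S, HasDerivAt P 0 w := by
    intro w hw
    have hw2 := abs_lt.1 hw.2
    have h1 := hasDerivAt_beachE_add hμ (w := w) (c := Real.pi / 2 * I)
      (by simp [abs_lt]; constructor <;> linarith)
    have h2 := hasDerivAt_beachE_add hμ (w := w) (c := -(Real.pi / 2 * I))
      (by simp [abs_lt]; constructor <;> linarith)
    have h3 : HasDerivAt (fun w => Complex.sinh (μ * w)) (Complex.cosh (μ * w) * μ) w := by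
      simpa using ((hasDerivAt_id w).const_mul (μ : ℂ)).csinh
    have h4 := (h1.mul h2).mul (h3.div (Complex.hasDerivAt_sinh w) (hs1 w hw))
    refine h4.congr_deriv ?_
    have key := logDerivE_add_logDerivE hμ hw.2
    rw [sub_eq_add_neg, cothDiff] at key
    have e1 := hs1 w hw
    have e2 := hs2 w hw
    have key2 : (logDerivE μ (w + Real.pi / 2 * I) + logDerivE μ (w + -(Real.pi / 2 * I)))
        * (Complex.sinh (μ * w) * Complex.sinh w)
        = Complex.cosh w * Complex.sinh (μ * w) - μ * Complex.cosh (μ * w) * Complex.sinh w := by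
      rw [key]
      field_simp
      ring
    simp only [Pi.mul_apply, Pi.div_apply]
    generalize beachE μ (w + Real.pi / 2 * I) = X
    generalize beachE μ (w + -(Real.pi / 2 * I)) = Y
    generalize logDerivE μ (w + Real.pi / 2 * I) = X' at key2 ⊢
    generalize logDerivE μ (w + -(Real.pi / 2 * I)) = Y' at key2 ⊢
    generalize Complex.sinh (μ * w) = s at key2 ⊢
    generalize Complex.cosh (μ * w) = c at key2 ⊢
    field_simp
    linear_combination (X * Y) * key2
  have hconst : ∀ w ∈ S, P w = P (-1) := by
    intro w hw
    have h1 : (-1 : ℂ) ∈ S := ⟨by simp, by simpa using by positivity⟩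
    exact (isOpen_leftStrip _).is_const_of_deriv_eq_zero (convex_leftStrip _).isPreconnected
      (fun v hv => (hPd v hv).differentiableAt.differentiableWithinAt)
      (fun v hv => (hPd v hv).deriv) hw h1
  have hreal : starRingEnd ℂ (P (-1)) = P (-1) := by
    simp only [hP, map_mul, map_div₀, ← beachE_conj, ← Complex.sinh_conj, map_add, map_neg, map_one,
      conj_ofReal, conj_I, map_ofNat]
    ring_nf
  obtain ⟨c, hc⟩ := Complex.conj_eq_iff_real.1 hreal
  refine ⟨c, fun w h1 h2 => ?_⟩
  rw [← hc, ← hconst w ⟨h1, h2⟩, sub_eq_add_neg]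
  simp only [hP]
  have := hs1 w ⟨h1, h2⟩
  field_simp

/-- The quotient has zero logarithmic derivative by `logDerivE_sub_logDerivE`. Its constant value is
found at the origin, where the factors `E(± iα)` cancel by evenness. -/
theorem beachE_wall_of_abs_im_lt {μ α : ℝ} (hμ : 1 < μ) (hα : 0 < α) (hα' : α < Real.pi / 2)
    (hμα : μ * α = Real.pi / 2) {w : ℂ} (hw : |w.im| < Real.pi / 2) :
    beachE μ (w + α * I) * (Complex.exp w - I * Complex.exp (α * I))
      = -I * Complex.exp (α * I) * beachE μ (w - α * I)
        * (Complex.exp w + I * Complex.exp (-α * I)) := by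
  have hαμ : Real.pi / μ = 2 * α := by
    rw [div_eq_iff (by linarith)]; linarith
  have hπ := Real.pi_pos
  set S : Set ℂ := {w : ℂ | |w.im| < Real.pi / 2} with hS
  set P : ℂ → ℂ := fun w => (beachE μ (w + α * I) * (Complex.exp w - I * Complex.exp (α * I)))
    / (beachE μ (w + -(α * I)) * (Complex.exp w + I * Complex.exp (-α * I))) with hP
  have hn1 : ∀ w ∈ S, Complex.exp w + I * Complex.exp (-α * I) ≠ 0 := fun w hw =>
    exp_add_ne_zero hα hα' (lt_trans hw (by linarith))
  have hn2 : ∀ w ∈ S, Complex.exp w - I * Complex.exp (α * I) ≠ 0 := fun w hw =>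
    exp_sub_ne_zero hα hα' (lt_trans hw (by linarith))
  have hPd : ∀ w ∈ S, HasDerivAt P 0 w := by
    intro w hw
    have hw2 := abs_lt.1 (show |w.im| < Real.pi / 2 from hw)
    have h1 := hasDerivAt_beachE_add hμ (w := w) (c := α * I)
      (by simp [abs_lt]; constructor <;> linarith)
    have h2 := hasDerivAt_beachE_add hμ (w := w) (c := -(α * I))
      (by simp [abs_lt]; constructor <;> linarith)
    have h3 := (Complex.hasDerivAt_exp w).sub_const (I * Complex.exp (α * I))
    have h4 := (Complex.hasDerivAt_exp w).add_const (I * Complex.exp (-α * I))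
    have e1 := hn1 w hw
    have e2 := hn2 w hw
    have e3 := beachE_ne_zero μ (w + -(α * I))
    have h5 := (h1.mul h3).div (h2.mul h4) (mul_ne_zero e3 e1)
    refine h5.congr_deriv ?_
    have key := logDerivE_sub_logDerivE hμ hα hα' hμα hw
    rw [sub_eq_add_neg w, wallKernel] at key
    have key2 : (logDerivE μ (w + α * I) - logDerivE μ (w + -(α * I)))
        * ((Complex.exp w + I * Complex.exp (-α * I)) * (Complex.exp w - I * Complex.exp (α * I)))
        = Complex.exp w * (Complex.exp w - I * Complex.exp (α * I))
          - Complex.exp w * (Complex.exp w + I * Complex.exp (-α * I)) := by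
      rw [key]
      generalize Complex.exp w + I * Complex.exp (-α * I) = X at e1 ⊢
      generalize Complex.exp w - I * Complex.exp (α * I) = Y at e2 ⊢
      field_simp
    simp only [Pi.mul_apply]
    rw [div_eq_zero_iff]
    left
    linear_combination (beachE μ (w + α * I) * beachE μ (w + -(α * I))) * key2
  have h0S : (0 : ℂ) ∈ S := by simp [hS]; positivity
  have hconst : P w = P 0 :=
    (isOpen_strip _).is_const_of_deriv_eq_zero (convex_strip _).isPreconnected
      (fun v hv => (hPd v hv).differentiableAt.differentiableWithinAt)
      (fun v hv => (hPd v hv).deriv) hw h0S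
  have hval : P 0 = -I * Complex.exp (α * I) := by
    have e1 := hn1 0 h0S
    have e3 := beachE_ne_zero μ (α * I)
    simp only [hP, zero_add, Complex.exp_zero, beachE_neg] at e1 ⊢
    rw [mul_div_mul_left _ _ e3, div_eq_iff e1]
    have h : Complex.exp (α * I) * Complex.exp (-α * I) = 1 := by
      rw [← Complex.exp_add]; simp
    linear_combination I ^ 2 * h + I_sq
  rw [hval] at hconst
  simp only [hP] at hconst
  rw [div_eq_iff (mul_ne_zero (beachE_ne_zero _ _) (hn1 w hw))] at hconst
  rw [hconst, sub_eq_add_neg]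
  ring

/-- Analytic continuation of the previous identity. The larger strip is essential: the recentred
wall contour reaches the heights `± (U - α)`, which exceed `π/2` in modulus. -/
theorem beachE_wall {μ α : ℝ} (hμ : 1 < μ) (hα : 0 < α) (hα' : α < Real.pi / 2)
    (hμα : μ * α = Real.pi / 2) {w : ℂ} (hw : |w.im| < Real.pi / 2 + α) :
    beachE μ (w + α * I) * (Complex.exp w - I * Complex.exp (α * I))
      = -I * Complex.exp (α * I) * beachE μ (w - α * I)
        * (Complex.exp w + I * Complex.exp (-α * I)) := by
  have hαμ : Real.pi / μ = 2 * α := by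
    rw [div_eq_iff (by linarith)]; linarith
  have hπ := Real.pi_pos
  set S : Set ℂ := {w : ℂ | |w.im| < Real.pi / 2 + α} with hS
  have hd : ∀ v ∈ S, DifferentiableAt ℂ (fun w => beachE μ (w + α * I)) v ∧
      DifferentiableAt ℂ (fun w => beachE μ (w - α * I)) v := by
    intro v hv
    have hv2 := abs_lt.1 (show |v.im| < Real.pi / 2 + α from hv)
    constructor
    · exact (hasDerivAt_beachE_add hμ (w := v) (c := α * I)
        (by simp [abs_lt]; constructor <;> linarith)).differentiableAt
    · simp only [sub_eq_add_neg]
      exact (hasDerivAt_beachE_add hμ (w := v) (c := -(α * I))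
        (by simp [abs_lt]; constructor <;> linarith)).differentiableAt
  have hf : AnalyticOnNhd ℂ (fun w => beachE μ (w + α * I)
      * (Complex.exp w - I * Complex.exp (α * I))) S := by
    refine DifferentiableOn.analyticOnNhd (fun v hv => ?_) (isOpen_strip _)
    exact ((hd v hv).1.mul (by fun_prop)).differentiableWithinAt
  have hg : AnalyticOnNhd ℂ (fun w => -I * Complex.exp (α * I) * beachE μ (w - α * I)
        * (Complex.exp w + I * Complex.exp (-α * I))) S := by
    refine DifferentiableOn.analyticOnNhd (fun v hv => ?_) (isOpen_strip _)
    exact ((((hd v hv).2).const_mul _).mul (by fun_prop)).differentiableWithinAt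
  refine hf.eqOn_of_preconnected_of_eventuallyEq hg (convex_strip _).isPreconnected
    (z₀ := 0) (by simp [hS]; positivity) ?_ hw
  have h0 : {w : ℂ | |w.im| < Real.pi / 2} ∈ 𝓝 (0 : ℂ) :=
    (isOpen_strip _).mem_nhds (by simp; positivity)
  filter_upwards [h0] with v hv
  exact beachE_wall_of_abs_im_lt hμ hα hα' hμα hv

/-! ### Gamma-type integrals and the directions in which `e^{z e^w}` decays. -/

theorem tendsto_mul_sub_exp_atBot (m : ℝ) {c : ℝ} (hc : 0 < c) :
    Tendsto (fun u : ℝ => m * u - c * Real.exp u) atTop atBot := by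
  have h1 : Tendsto (fun u : ℝ => m * (u ^ 1 * Real.exp (-u)) - c) atTop (𝓝 (m * 0 - c)) :=
    ((Real.tendsto_pow_mul_exp_neg_atTop_nhds_zero 1).const_mul m).sub_const c
  have h2 := Real.tendsto_exp_atTop.atTop_mul_neg (by linarith : m * 0 - c < 0) h1
  refine h2.congr fun u => ?_
  rw [Real.exp_neg]
  field_simp

theorem tendsto_exp_mul_sub_exp (m : ℝ) {c : ℝ} (hc : 0 < c) :
    Tendsto (fun u : ℝ => Real.exp (m * u - c * Real.exp u)) atTop (𝓝 0) :=
  Real.tendsto_exp_atBot.comp (tendsto_mul_sub_exp_atBot m hc)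

theorem integrableOn_exp_mul_sub_exp (m : ℝ) {c : ℝ} (hc : 0 < c) (s : ℝ) :
    IntegrableOn (fun u : ℝ => Real.exp (m * u - c * Real.exp u)) (Ioi s) := by
  refine integrable_of_isBigO_exp_neg one_pos (by fun_prop) ?_
  refine IsLittleO.isBigO ?_
  refine (isLittleO_iff_tendsto fun x h => absurd h (Real.exp_pos _).ne').2 ?_
  refine (tendsto_exp_mul_sub_exp (m + 1) hc).congr fun u => ?_
  rw [← Real.exp_sub]
  ring_nf

theorem integrable_exp_mul_sub_exp {m c : ℝ} (hm : 0 < m) (hc : 0 < c) :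
    Integrable (fun u : ℝ => Real.exp (m * u - c * Real.exp u)) := by
  rw [← integrableOn_univ, ← Iic_union_Ioi (a := (0 : ℝ)), integrableOn_union]
  refine ⟨?_, integrableOn_exp_mul_sub_exp m hc 0⟩
  refine Integrable.mono' (integrableOn_exp_mul_Iic hm 0)
    (by fun_prop : Continuous _).aestronglyMeasurable (Eventually.of_forall fun u => ?_)
  rw [Real.norm_of_nonneg (Real.exp_pos _).le, Real.exp_le_exp]
  have := Real.exp_pos u
  nlinarith

/-- The scaling of the Gamma-type integral. -/
theorem integral_exp_mul_sub_exp {m c ρ : ℝ} (hρ : 0 < ρ) :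
    ∫ u : ℝ, Real.exp (m * u - c * ρ * Real.exp u)
      = ρ ^ (-m) * ∫ u : ℝ, Real.exp (m * u - c * Real.exp u) := by
  rw [← integral_add_right_eq_self (fun u : ℝ => Real.exp (m * u - c * Real.exp u)) (Real.log ρ),
    ← integral_const_mul]
  congr 1 with u
  rw [Real.exp_add, Real.exp_log hρ, Real.rpow_def_of_pos hρ, ← Real.exp_add]
  ring_nf

theorem setIntegral_Ioi_exp_mul_sub_exp {m c s ρ : ℝ} (hs : ρ * Real.exp s = 2) :
    ∫ u in Ioi s, Real.exp (m * u - c * ρ * Real.exp u)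
      = Real.exp (m * s) * ∫ u in Ioi (0 : ℝ), Real.exp (m * u - 2 * c * Real.exp u) := by
  have h := (measurePreserving_add_right volume s).setIntegral_preimage_emb
    (measurableEmbedding_addRight s) (fun u : ℝ => Real.exp (m * u - c * ρ * Real.exp u)) (Ioi s)
  rw [← h, ← integral_const_mul]
  have h2 : (fun x => x + s) ⁻¹' Ioi s = Ioi (0 : ℝ) := by ext x; simp
  rw [h2]
  congr 1 with u
  rw [← Real.exp_add, ← hs, Real.exp_add]
  ring_nf

theorem norm_exp_mul_exp (z : ℂ) (u y : ℝ) :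
    ‖Complex.exp (z * Complex.exp (u + y * I))‖
      = Real.exp (Real.exp u * (z * Complex.exp (y * I)).re) := by
  rw [Complex.norm_exp, Complex.exp_add, ← ofReal_exp, mul_left_comm, re_ofReal_mul]

theorem norm_exp_mul_exp_le {z : ℂ} {u y d : ℝ} (h : (z * Complex.exp (y * I)).re ≤ -d) :
    ‖Complex.exp (z * Complex.exp (u + y * I))‖ ≤ Real.exp (-(d * Real.exp u)) := by
  rw [norm_exp_mul_exp, Real.exp_le_exp]
  have := Real.exp_pos u
  nlinarith

/-- The set of `z` for which `e^{z ζ}` decays along the rays `arg ζ = ± U`. -/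
def decaySet (U : ℝ) : Set ℂ :=
  {z | (z * Complex.exp (U * I)).re < 0 ∧ (z * Complex.exp ((-U : ℝ) * I)).re < 0}

theorem isOpen_decaySet (U : ℝ) : IsOpen (decaySet U) := by
  have h1 : IsOpen {z : ℂ | (z * Complex.exp (U * I)).re < 0} :=
    isOpen_lt (by fun_prop) continuous_const
  have h2 : IsOpen {z : ℂ | (z * Complex.exp ((-U : ℝ) * I)).re < 0} :=
    isOpen_lt (by fun_prop) continuous_const
  exact h1.inter h2

theorem zero_notMem_decaySet (U : ℝ) : (0 : ℂ) ∉ decaySet U := by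
  simp [decaySet]

theorem re_mul_exp_polar (ρ θ y : ℝ) :
    ((ρ * Complex.exp (θ * I)) * Complex.exp (y * I)).re = ρ * Real.cos (θ + y) := by
  rw [mul_assoc, ← Complex.exp_add, re_ofReal_mul, ← add_mul, ← ofReal_add, exp_ofReal_mul_I_re]

theorem cos_le_neg_of_mem {η x : ℝ} (hη : 0 ≤ η) (h1 : Real.pi / 2 + η ≤ x)
    (h2 : x ≤ 3 * Real.pi / 2 - η) : Real.cos x ≤ -Real.sin η := by
  have h3 : Real.cos x = -Real.cos (x - Real.pi) := by rw [Real.cos_sub_pi]; ring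
  have h4 : Real.sin η = Real.cos (Real.pi / 2 - η) := (Real.cos_pi_div_two_sub η).symm
  rw [h3, neg_le_neg_iff, h4, ← Real.cos_abs (x - Real.pi)]
  refine Real.cos_le_cos_of_nonneg_of_le_pi (abs_nonneg _) (by linarith [Real.pi_pos])
    (abs_le.2 ⟨by linarith, by linarith⟩)

/-- The angle `θ + y` has to stay inside `(π/2, 3π/2)`. For all `θ` in `[-α, 0]` and all directions
from `U` through `π` to `2π - U` this is the condition `U > π/2 + α`. The second estimate allows the
lower ray to be turned from `-U` to `2α - U` when `z` lies on the wall; it also needs `α < π/2`,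
whence the minimum of two margins. -/
theorem exists_decay {α U : ℝ} (hα : 0 < α) (hU : Real.pi / 2 + α < U)
    (hU' : U < Real.pi) : ∃ c, 0 < c ∧
      (∀ θ ∈ Icc (-α) 0, ∀ y ∈ Icc U (2 * Real.pi - U), Real.cos (θ + y) ≤ -c) ∧
      (∀ y ∈ Icc (-U) (2 * α - U), Real.cos (-α + y) ≤ -c) := by
  have hη : 0 < min (U - Real.pi / 2 - α) (Real.pi / 2 - α) := lt_min (by linarith) (by linarith)
  have h1 := min_le_left (U - Real.pi / 2 - α) (Real.pi / 2 - α)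
  have h2 := min_le_right (U - Real.pi / 2 - α) (Real.pi / 2 - α)
  refine ⟨Real.sin (min (U - Real.pi / 2 - α) (Real.pi / 2 - α)),
    Real.sin_pos_of_pos_of_lt_pi hη (by linarith), fun θ hθ y hy => ?_, fun y hy => ?_⟩
  · exact cos_le_neg_of_mem hη.le (by linarith [hθ.1, hy.1]) (by linarith [hθ.2, hy.2])
  · rw [← Real.cos_add_two_pi]
    exact cos_le_neg_of_mem hη.le (by linarith [hy.1]) (by linarith [hy.2])

theorem exists_polar_of_mem_puncturedSector {α : ℝ} {z : ℂ} (hz : z ∈ puncturedSector α) :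
    0 < ‖z‖ ∧ ∃ θ ∈ Icc (-α) 0, z = ‖z‖ * Complex.exp (θ * I) := by
  obtain ⟨⟨ρ, θ, hρ, h1, h2, rfl⟩, h0⟩ := hz
  refine ⟨norm_pos_iff.2 h0, θ, ⟨h1, h2⟩, ?_⟩
  simp [Complex.norm_exp, abs_of_nonneg hρ]

theorem re_mul_exp_le_of_mem {α U c : ℝ}
    (hc : ∀ θ ∈ Icc (-α) 0, ∀ y ∈ Icc U (2 * Real.pi - U), Real.cos (θ + y) ≤ -c)
    {z : ℂ} (hz : z ∈ puncturedSector α) {y : ℝ} (hy : y ∈ Icc U (2 * Real.pi - U)) :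
    (z * Complex.exp (y * I)).re ≤ -(c * ‖z‖) := by
  obtain ⟨h0, θ, hθ, h1⟩ := exists_polar_of_mem_puncturedSector hz
  rw [h1, re_mul_exp_polar, ← h1]
  nlinarith [hc θ hθ y hy]

theorem re_mul_exp_le_of_mem' {α U c : ℝ}
    (hc : ∀ θ ∈ Icc (-α) 0, ∀ y ∈ Icc U (2 * Real.pi - U), Real.cos (θ + y) ≤ -c)
    {z : ℂ} (hz : z ∈ puncturedSector α) {y : ℝ} (hy : y ∈ Icc (U - 2 * Real.pi) (-U)) :
    (z * Complex.exp (y * I)).re ≤ -(c * ‖z‖) := by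
  obtain ⟨h0, θ, hθ, h1⟩ := exists_polar_of_mem_puncturedSector hz
  rw [h1, re_mul_exp_polar, ← h1, ← Real.cos_add_two_pi, add_assoc]
  nlinarith [hc θ hθ (y + 2 * Real.pi) ⟨by linarith [hy.1], by linarith [hy.2]⟩]

theorem puncturedSector_subset_decaySet {α U : ℝ} (hα : 0 < α)
    (hU : Real.pi / 2 + α < U) (hU' : U < Real.pi) : puncturedSector α ⊆ decaySet U := by
  obtain ⟨c, hc0, hc, -⟩ := exists_decay hα hU hU'
  intro z hz
  have h0 := (exists_polar_of_mem_puncturedSector hz).1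
  have h1 : 0 < c * ‖z‖ := by positivity
  exact ⟨(re_mul_exp_le_of_mem hc hz ⟨le_rfl, by linarith⟩).trans_lt (by linarith),
    (re_mul_exp_le_of_mem' hc hz ⟨by linarith, le_rfl⟩).trans_lt (by linarith)⟩

/-! ### Calculus of the hook contour. -/

theorem hook_congr {H K : ℂ → ℂ} {s a b : ℝ} (hab : a ≤ b)
    (ha : ∀ u : ℝ, s < u → H (u + a * I) = K (u + a * I))
    (hb : ∀ u : ℝ, s < u → H (u + b * I) = K (u + b * I))
    (hs : ∀ y ∈ Icc a b, H (s + y * I) = K (s + y * I)) : hook H s a b = hook K s a b := by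
  rw [hook, hook, setIntegral_congr_fun measurableSet_Ioi fun u hu => hb u hu,
    setIntegral_congr_fun measurableSet_Ioi fun u hu => ha u hu,
    intervalIntegral.integral_congr fun y hy => hs y (by rwa [uIcc_of_le hab] at hy)]

theorem hook_const_mul (c : ℂ) (H : ℂ → ℂ) (s a b : ℝ) :
    hook (fun w => c * H w) s a b = c * hook H s a b := by
  simp only [hook, integral_const_mul, intervalIntegral.integral_const_mul]
  ring

/-- The integrals in `hook H s a b` converge. -/
structure HookIntegrable (H : ℂ → ℂ) (s a b : ℝ) : Prop where
  lower : IntegrableOn (fun u : ℝ => H (u + a * I)) (Ioi s)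
  upper : IntegrableOn (fun u : ℝ => H (u + b * I)) (Ioi s)
  arc : IntervalIntegrable (fun y : ℝ => H (s + y * I)) volume a b

theorem hook_fun_add {H K : ℂ → ℂ} {s a b : ℝ} (hH : HookIntegrable H s a b)
    (hK : HookIntegrable K s a b) :
    hook (fun w => H w + K w) s a b = hook H s a b + hook K s a b := by
  simp only [hook]
  rw [integral_add hH.lower hK.lower, integral_add hH.upper hK.upper,
    intervalIntegral.integral_add hH.arc hK.arc]
  ring

/-- Conjugation maps the contour to itself with reversed orientation. For `σ = 1` the integral is
therefore purely imaginary and for `σ = -1` it is real; all three boundary conditions are obtained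
from this. -/
theorem hook_conj {H : ℂ → ℂ} {σ : ℝ} {b : ℝ}
    (hH : ∀ w : ℂ, |w.im| ≤ b → H (starRingEnd ℂ w) = σ * starRingEnd ℂ (H w)) (hb : 0 ≤ b) (s : ℝ) :
    starRingEnd ℂ (hook H s (-b) b) * σ = -hook H s (-b) b := by
  have hb' : |b| ≤ b := (abs_of_nonneg hb).le
  have e1 : ∀ u y : ℝ, ((u : ℂ) + ((-y : ℝ) : ℂ) * I) = starRingEnd ℂ (u + y * I) := fun u y => by
    simp
  have h1 : ∫ u in Ioi s, H (u + ((-b : ℝ) : ℂ) * I)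
      = σ * starRingEnd ℂ (∫ u in Ioi s, H (u + b * I)) := by
    rw [← integral_conj, ← integral_const_mul]
    refine integral_congr_ae (Eventually.of_forall fun u => ?_)
    simp only [e1]
    exact hH _ (by simpa using hb')
  have h2 : ∫ u in Ioi s, H (u + b * I)
      = σ * starRingEnd ℂ (∫ u in Ioi s, H (u + ((-b : ℝ) : ℂ) * I)) := by
    rw [← integral_conj, ← integral_const_mul]
    refine integral_congr_ae (Eventually.of_forall fun u => ?_)
    have := hH (u + ((-b : ℝ) : ℂ) * I) (by simpa using hb')
    simp only [← this]
    congr 1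
    simp
  have h3 : ∫ y in (-b)..b, H (s + y * I)
      = σ * starRingEnd ℂ (∫ y in (-b)..b, H (s + y * I)) := by
    have h4 : ∫ y in (-b)..b, H (s + y * I) = ∫ y in (-b)..b, H (s + ((-y : ℝ) : ℂ) * I) := by
      rw [intervalIntegral.integral_comp_neg (fun y : ℝ => H (s + y * I)), neg_neg]
    rw [intervalIntegral.integral_of_le (by linarith), ← integral_conj, ← integral_const_mul,
      ← intervalIntegral.integral_of_le (by linarith), ← intervalIntegral.integral_of_le (by linarith),
      h4]
    refine intervalIntegral.integral_congr fun y hy => ?_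
    rw [uIcc_of_le (by linarith)] at hy
    simp only [e1]
    exact hH _ (by simpa [abs_le] using hy)
  simp only [hook, map_sub, map_add, map_mul, conj_I]
  linear_combination h2 - h1 + I * h3

theorem hook_translate (H : ℂ → ℂ) (s a b α : ℝ) :
    hook (fun w => H (w + α * I)) s a b = hook H s (a + α) (b + α) := by
  have e : ∀ x y : ℝ, (x : ℂ) + y * I + α * I = x + ((y + α : ℝ) : ℂ) * I := fun x y => by
    push_cast; ring
  simp only [hook, e]
  rw [intervalIntegral.integral_comp_add_right (fun y : ℝ => H (s + y * I))]

theorem hook_eq_hook {H : ℂ → ℂ} {s R a b : ℝ} (hab : a ≤ b) (hsR : s ≤ R)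
    (hd : ∀ w : ℂ, s ≤ w.re → w.re ≤ R → a ≤ w.im → w.im ≤ b → DifferentiableAt ℂ H w)
    (ha : IntegrableOn (fun u : ℝ => H (u + a * I)) (Ioi R))
    (hb : IntegrableOn (fun u : ℝ => H (u + b * I)) (Ioi R)) :
    hook H s a b = hook H R a b := by
  have h := rectangle_integral_eq_zero hsR hab hd
  have hcont : ∀ y ∈ Icc a b, ContinuousOn (fun u : ℝ => H (u + y * I)) (Icc s R) := by
    intro y hy u hu
    exact (ContinuousAt.comp (f := fun u : ℝ => (u + y * I : ℂ))
      (hd _ (by simpa using hu.1) (by simpa using hu.2) (by simpa using hy.1)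
        (by simpa using hy.2)).continuousAt (by fun_prop)).continuousWithinAt
  have hadd : ∀ y ∈ Icc a b, IntegrableOn (fun u : ℝ => H (u + y * I)) (Ioi R) →
      (∫ u in s..R, H (u + y * I)) + ∫ u in Ioi R, H (u + y * I)
        = ∫ u in Ioi s, H (u + y * I) := by
    intro y hy hi
    refine intervalIntegral.integral_interval_add_Ioi ?_ hi
    rw [← Ioc_union_Ioi_eq_Ioi hsR]
    exact ((hcont y hy).integrableOn_Icc.mono_set Ioc_subset_Icc_self).union hi
  rw [hook, hook, ← hadd a (left_mem_Icc.2 hab) ha, ← hadd b (right_mem_Icc.2 hab) hb]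
  linear_combination -h

/-- A contour that can be closed to the left is a circle. -/
theorem hook_eq_circleIntegral {q : ℂ → ℂ} {s U : ℝ} {B : ℝ → ℝ} (hU' : U < Real.pi)
    (hd : ∀ w : ℂ, s ≤ w.re → U ≤ w.im → w.im ≤ 2 * Real.pi - U →
      DifferentiableAt ℂ q (Complex.exp w))
    (hb : ∀ x : ℝ, s ≤ x → ∀ y ∈ Icc U (2 * Real.pi - U),
      ‖q (Complex.exp (x + y * I)) * Complex.exp (x + y * I)‖ ≤ B x)
    (hB : IntegrableOn B (Ioi s)) (hB0 : Tendsto B atTop (𝓝 0))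
    (hc : Continuous fun y : ℝ => q (Complex.exp (s + y * I))) :
    hook (fun w => q (Complex.exp w) * Complex.exp w) s (-U) U
      = ∮ ζ in C(0, Real.exp s), q ζ := by
  have hcont : Continuous fun y : ℝ => q (Complex.exp (s + y * I)) * Complex.exp (s + y * I) :=
    hc.mul (by fun_prop)
  have h1 := hook_add (H := fun w => q (Complex.exp w) * Complex.exp w) (s := s) (a := -U)
    (b := U) (c := 2 * Real.pi - U) (hcont.intervalIntegrable _ _) (hcont.intervalIntegrable _ _)
  have h2 : hook (fun w => q (Complex.exp w) * Complex.exp w) s U (2 * Real.pi - U) = 0 :=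
    hook_eq_zero (by linarith) (fun w h1 h2 h3 => ((hd w h1 h2 h3).comp w
      Complex.differentiable_exp.differentiableAt).mul Complex.differentiable_exp.differentiableAt)
      hb hB hB0
  rw [h2, add_zero] at h1
  rw [h1, hook]
  -- The extended contour has its rays at heights `-U` and `2π - U`, on which `e^w` takes the same
  -- values; they cancel and only a full circle remains.
  have hper : ∀ x y : ℝ, Complex.exp (x + ((y + 2 * Real.pi : ℝ) : ℂ) * I)
      = Complex.exp (x + y * I) := by
    intro x y
    rw [← Complex.exp_periodic (x + y * I)]
    congr 1
    push_cast
    ring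
  have e : 2 * Real.pi - U = -U + 2 * Real.pi := by ring
  rw [e]
  simp only [hper]
  rw [add_comm, add_sub_assoc, sub_self, add_zero]
  have hperf : Function.Periodic
      (fun y : ℝ => q (Complex.exp (s + y * I)) * Complex.exp (s + y * I)) (2 * Real.pi) := by
    intro y
    simp only [hper]
  rw [hperf.intervalIntegral_add_eq (-U) 0, zero_add, circleIntegral,
    ← intervalIntegral.integral_const_mul]
  refine intervalIntegral.integral_congr fun y _ => ?_
  have hm : Complex.exp (s + y * I) = circleMap 0 (Real.exp s) y := by
    rw [circleMap, Complex.exp_add, zero_add, ofReal_exp]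
  simp only [deriv_circleMap, hm, smul_eq_mul]
  ring

theorem integrableOn_ray {Q : ℂ → ℂ} {s y m C d : ℝ} {z : ℂ} (hd : 0 < d)
    (hz : (z * Complex.exp (y * I)).re ≤ -d)
    (hc : ContinuousOn (fun u : ℝ => Q (u + y * I)) (Ioi s))
    (hQ : ∀ u : ℝ, s < u → ‖Q (u + y * I)‖ ≤ C * Real.exp (m * u)) :
    IntegrableOn (fun u : ℝ => Q (u + y * I) * Complex.exp (z * Complex.exp (u + y * I))) (Ioi s) := by
  refine Integrable.mono' ((integrableOn_exp_mul_sub_exp m hd s).const_mul C) ?_ ?_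
  · exact (hc.mul (by fun_prop)).aestronglyMeasurable measurableSet_Ioi
  · refine (ae_restrict_mem measurableSet_Ioi).mono fun u hu => ?_
    rw [norm_mul, sub_eq_add_neg, Real.exp_add, ← mul_assoc]
    have := hQ u hu
    exact mul_le_mul this (norm_exp_mul_exp_le hz) (norm_nonneg _) ((norm_nonneg _).trans this)

theorem hasDerivAt_ray {Q : ℂ → ℂ} {s y m C : ℝ} {z : ℂ}
    (hz : (z * Complex.exp (y * I)).re < 0)
    (hc : ContinuousOn (fun u : ℝ => Q (u + y * I)) (Ioi s))
    (hQ : ∀ u : ℝ, s < u → ‖Q (u + y * I)‖ ≤ C * Real.exp (m * u)) :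
    HasDerivAt (fun z => ∫ u in Ioi s, Q (u + y * I) * Complex.exp (z * Complex.exp (u + y * I)))
      (∫ u in Ioi s, Q (u + y * I) * Complex.exp (u + y * I)
        * Complex.exp (z * Complex.exp (u + y * I))) z := by
  obtain ⟨d', hd1, hd2⟩ := exists_between hz
  have hd : 0 < -d' := by linarith
  set S : Set ℂ := {v | (v * Complex.exp (y * I)).re < d'} with hS
  have hSo : IsOpen S := isOpen_lt (by fun_prop) continuous_const
  have hSb : ∀ v ∈ S, (v * Complex.exp (y * I)).re ≤ -(-d') := fun v hv => by
    rw [neg_neg]; exact le_of_lt hv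
  refine (hasDerivAt_integral_of_dominated_loc_of_deriv_le (𝕜 := ℂ) (x₀ := z) (s := S)
    (μ := volume.restrict (Ioi s))
    (F := fun v u => Q (u + y * I) * Complex.exp (v * Complex.exp (u + y * I)))
    (F' := fun v u => Q (u + y * I) * Complex.exp (u + y * I)
        * Complex.exp (v * Complex.exp (u + y * I)))
    (bound := fun u => C * Real.exp ((m + 1) * u - -d' * Real.exp u)) (hSo.mem_nhds hd1)
    ?_ ?_ ?_ ?_ ?_ ?_).2
  · exact Eventually.of_forall fun v =>
      (hc.mul (by fun_prop)).aestronglyMeasurable measurableSet_Ioi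
  · exact integrableOn_ray hd (hSb z hd1) hc hQ
  · exact ((hc.mul (by fun_prop)).mul (by fun_prop)).aestronglyMeasurable measurableSet_Ioi
  · refine (ae_restrict_mem measurableSet_Ioi).mono fun u hu v hv => ?_
    have h1 := hQ u hu
    have h2 := norm_exp_mul_exp_le (u := u) (hSb v hv)
    have h3 : ‖Complex.exp (u + y * I)‖ = Real.exp u := by simp [Complex.norm_exp]
    rw [norm_mul, norm_mul, h3]
    calc _ ≤ C * Real.exp (m * u) * Real.exp u * Real.exp (-(-d' * Real.exp u)) := by
          gcongr
          exact mul_nonneg ((norm_nonneg _).trans h1) (Real.exp_pos _).le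
      _ = _ := by
        rw [mul_assoc C, ← Real.exp_add, mul_assoc, ← Real.exp_add]
        ring_nf
  · exact (integrableOn_exp_mul_sub_exp (m + 1) hd s).const_mul C
  · refine Eventually.of_forall fun u v _ => ?_
    have h1 := (((hasDerivAt_id v).mul_const (Complex.exp (u + y * I))).cexp).const_mul
      (Q (u + y * I))
    refine h1.congr_deriv ?_
    simp only [id]
    ring

theorem hasDerivAt_arc {Q : ℂ → ℂ} {s a b : ℝ} (hab : a ≤ b) (z : ℂ)
    (hc : ContinuousOn (fun y : ℝ => Q (s + y * I)) (Icc a b)) :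
    HasDerivAt (fun z => ∫ y in a..b, Q (s + y * I) * Complex.exp (z * Complex.exp (s + y * I)))
      (∫ y in a..b, Q (s + y * I) * Complex.exp (s + y * I)
        * Complex.exp (z * Complex.exp (s + y * I))) z := by
  obtain ⟨C, hC⟩ := isCompact_Icc.exists_bound_of_continuousOn hc
  have hu : uIoc a b = Ioc a b := uIoc_of_le hab
  have hc' : ContinuousOn (fun y : ℝ => Q (s + y * I)) (Ioc a b) := hc.mono Ioc_subset_Icc_self
  refine (intervalIntegral.hasDerivAt_integral_of_dominated_loc_of_deriv_le (𝕜 := ℂ) (x₀ := z)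
    (μ := volume) (a := a) (b := b) (s := Metric.ball z 1)
    (F := fun v (y : ℝ) => Q (s + y * I) * Complex.exp (v * Complex.exp (s + y * I)))
    (F' := fun v (y : ℝ) => Q (s + y * I) * Complex.exp (s + y * I)
        * Complex.exp (v * Complex.exp (s + y * I)))
    (bound := fun _ => C * Real.exp s * Real.exp ((‖z‖ + 1) * Real.exp s))
    (Metric.ball_mem_nhds z one_pos) ?_ ?_ ?_ ?_ ?_ ?_).2
  · rw [hu]
    exact Eventually.of_forall fun v =>
      (hc'.mul (by fun_prop)).aestronglyMeasurable measurableSet_Ioc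
  · refine ContinuousOn.intervalIntegrable ?_
    rw [uIcc_of_le hab]
    exact hc.mul (by fun_prop)
  · rw [hu]
    exact ((hc'.mul (by fun_prop)).mul (by fun_prop)).aestronglyMeasurable measurableSet_Ioc
  · refine Eventually.of_forall fun y hy v hv => ?_
    rw [hu] at hy
    have h1 := hC y (Ioc_subset_Icc_self hy)
    have h3 : ‖Complex.exp (s + y * I)‖ = Real.exp s := by simp [Complex.norm_exp]
    have h4 : ‖Complex.exp (v * Complex.exp (s + y * I))‖ ≤ Real.exp ((‖z‖ + 1) * Real.exp s) := by
      refine (Complex.norm_exp_le_exp_norm _).trans ?_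
      rw [norm_mul, h3]
      gcongr
      have h5 := norm_sub_norm_le v z
      rw [Metric.mem_ball, dist_eq_norm] at hv
      linarith
    rw [norm_mul, norm_mul, h3]
    have : 0 ≤ C := (norm_nonneg _).trans h1
    gcongr
  · exact intervalIntegrable_const
  · refine Eventually.of_forall fun y _ v _ => ?_
    have h1 := (((hasDerivAt_id v).mul_const (Complex.exp (s + y * I))).cexp).const_mul
      (Q (s + y * I))
    refine h1.congr_deriv ?_
    simp only [id]
    ring

theorem hasDerivAt_hook {Q : ℂ → ℂ} {s U m C : ℝ} (hU : 0 ≤ U) {z : ℂ} (hz : z ∈ decaySet U)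
    (hcu : ContinuousOn (fun u : ℝ => Q (u + U * I)) (Ioi s))
    (hcl : ContinuousOn (fun u : ℝ => Q (u + (-U : ℝ) * I)) (Ioi s))
    (hca : ContinuousOn (fun y : ℝ => Q (s + y * I)) (Icc (-U) U))
    (hQu : ∀ u : ℝ, s < u → ‖Q (u + U * I)‖ ≤ C * Real.exp (m * u))
    (hQl : ∀ u : ℝ, s < u → ‖Q (u + (-U : ℝ) * I)‖ ≤ C * Real.exp (m * u)) :
    HasDerivAt (fun z => hook (fun w => Q w * Complex.exp (z * Complex.exp w)) s (-U) U)
      (hook (fun w => Q w * Complex.exp w * Complex.exp (z * Complex.exp w)) s (-U) U) z :=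
  ((hasDerivAt_ray hz.1 hcu hQu).fun_add
    ((hasDerivAt_arc (by linarith) z hca).const_mul I)).fun_sub (hasDerivAt_ray hz.2 hcl hQl)

/-! ### The symbol of the contour integral and its symmetries. -/

/-- The admissible parameters of the contour representation: `μ = π / (2α)`, and `U` is the
half-opening of the contour. -/
structure BeachParams (α μ U : ℝ) : Prop where
  pos : 0 < α
  lt : α < Real.pi / 2
  mul_eq : μ * α = Real.pi / 2
  lt_U : Real.pi / 2 + α < U
  U_lt : U < Real.pi / 2 + 2 * α
  U_lt_pi : U < Real.pi

/-- The lower bound on `U` gives decay of `e^{z e^w}` on both rays, the bound `π/2 + 2α = π/2 + π/μ`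
keeps the contour where `E` is holomorphic, and `U < π` leaves room to close contours through the
direction `π`. They are compatible exactly because `α < π/2`. -/
theorem exists_beachParams {α : ℝ} (hα : 0 < α) (hα' : α < Real.pi / 2) :
    ∃ U, BeachParams α (mu α) U := by
  obtain ⟨U, h1, h2⟩ := exists_between
    (lt_min (by linarith) (by linarith) :
      Real.pi / 2 + α < min (Real.pi / 2 + 2 * α) Real.pi)
  refine ⟨U, hα, hα', ?_, h1, h2.trans_le (min_le_left _ _), h2.trans_le (min_le_right _ _)⟩
  rw [mu]
  field_simp

namespace BeachParams

variable {α μ U : ℝ}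

theorem one_lt (h : BeachParams α μ U) : 1 < μ := by
  have h1 := h.mul_eq
  have h2 := h.pos
  have h3 := h.lt
  by_contra hμ
  nlinarith

theorem pi_div_eq (h : BeachParams α μ U) : Real.pi / μ = 2 * α := by
  rw [div_eq_iff (by linarith [h.one_lt])]
  linarith [h.mul_eq]

theorem U_pos (h : BeachParams α μ U) : 0 < U := by
  linarith [h.lt_U, Real.pi_pos, h.pos]

theorem abs_U_lt (h : BeachParams α μ U) : |U| < Real.pi / 2 + Real.pi / μ := by
  rw [abs_of_pos h.U_pos, h.pi_div_eq]
  exact h.U_lt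

end BeachParams

theorem exp_add_I_eq_zero {w : ℂ} (h : Complex.exp w + I = 0) :
    w.re = 0 ∧ ∃ n : ℤ, w.im = -(Real.pi / 2) + n * (2 * Real.pi) := by
  have h1 : Complex.exp w = Complex.exp ((-(Real.pi / 2) : ℝ) * I) := by
    rw [eq_neg_of_add_eq_zero_left h]
    push_cast
    rw [neg_mul, Complex.exp_neg, Complex.exp_pi_div_two_mul_I, inv_I]
  refine ⟨?_, exp_eq_exp_mul_I h1⟩
  have := congrArg norm h1
  rw [Complex.norm_exp, Complex.norm_exp_ofReal_mul_I] at this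
  exact Real.exp_eq_one_iff _ |>.1 this

theorem exp_add_I_ne_zero_of_re {w : ℂ} (h : w.re ≠ 0) : Complex.exp w + I ≠ 0 :=
  fun h0 => h (exp_add_I_eq_zero h0).1

theorem exp_add_I_ne_zero_of_im {w : ℂ} (h1 : -(5 * Real.pi / 2) < w.im)
    (h2 : w.im < 3 * Real.pi / 2) (h3 : w.im ≠ -(Real.pi / 2)) : Complex.exp w + I ≠ 0 := by
  intro h0
  obtain ⟨-, n, hn⟩ := exp_add_I_eq_zero h0
  have hπ := Real.pi_pos
  rcases lt_trichotomy n 0 with h | h | h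
  · have : (n : ℝ) ≤ -1 := by exact_mod_cast Int.le_sub_one_of_lt h
    nlinarith
  · rw [h] at hn
    simp at hn
    exact h3 hn
  · have : (1 : ℝ) ≤ n := by exact_mod_cast h
    nlinarith

/-- The conjugation symmetric numerator of the symbol. -/
def beachB (μ : ℝ) (w : ℂ) : ℂ := Complex.exp (-((μ - 1) / 2) * w) * beachE μ w

/-- The symbol of the contour representation. -/
def beachT (μ : ℝ) (w : ℂ) : ℂ := beachB μ w / (Complex.exp w + I)

theorem beachB_conj (μ : ℝ) (w : ℂ) :
    beachB μ (starRingEnd ℂ w) = starRingEnd ℂ (beachB μ w) := by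
  rw [beachB, beachB, beachE_conj, map_mul, ← Complex.exp_conj]
  simp [map_ofNat]

theorem differentiableAt_beachB {μ : ℝ} (hμ : 1 < μ) {w : ℂ}
    (hw : |w.im| < Real.pi / 2 + Real.pi / μ) : DifferentiableAt ℂ (beachB μ) w :=
  DifferentiableAt.mul (by fun_prop) (hasDerivAt_beachE hμ hw).differentiableAt

theorem differentiableAt_beachT {μ : ℝ} (hμ : 1 < μ) {w : ℂ}
    (hw : |w.im| < Real.pi / 2 + Real.pi / μ) (h0 : Complex.exp w + I ≠ 0) :
    DifferentiableAt ℂ (beachT μ) w :=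
  (differentiableAt_beachB hμ hw).div (by fun_prop) h0

/-- The symmetry of the symbol about the line `Im w = α`. -/
theorem beachT_wall {α μ U : ℝ} (h : BeachParams α μ U) {w : ℂ}
    (hw : |w.im| < Real.pi / 2 + α) :
    beachT μ (starRingEnd ℂ w + α * I) = -starRingEnd ℂ (beachT μ (w + α * I)) := by
  have hw' : |(starRingEnd ℂ w).im| < Real.pi / 2 + α := by simpa using hw
  have key := beachE_wall h.one_lt h.pos h.lt h.mul_eq hw'
  have n1 := exp_add_ne_zero h.pos h.lt hw'
  have n2 := exp_sub_ne_zero h.pos h.lt hw'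
  have hconj : starRingEnd ℂ (beachT μ (w + α * I))
      = beachB μ (starRingEnd ℂ w - α * I) / (Complex.exp (starRingEnd ℂ w - α * I) - I) := by
    rw [beachT, map_div₀, ← beachB_conj, map_add, map_add, ← Complex.exp_conj, map_add]
    simp [sub_eq_add_neg]
  rw [hconj, beachT]
  generalize starRingEnd ℂ w = v at *
  have hA : Complex.exp (α * I) ≠ 0 := Complex.exp_ne_zero _
  have hA' : Complex.exp (-α * I) = (Complex.exp (α * I))⁻¹ := by rw [neg_mul, Complex.exp_neg]
  -- Since `μα = π/2`, the squared phase of `e^{-(μ-1)w/2}` at `w = iα` is the constant `-i e^{iα}`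
  -- of `beachE_wall`. This dictates the exponent in `beachB`.
  have hP : Complex.exp (-((μ - 1) / 2) * (α * I)) ^ 2 = -I * Complex.exp (α * I) := by
    rw [← Complex.exp_nat_mul, ← exp_sub_pi_div_two]
    congr 1
    have : (μ : ℂ) * α = Real.pi / 2 := by
      have := congrArg (fun x : ℝ => (x : ℂ)) h.mul_eq
      push_cast at this
      exact this
    push_cast
    linear_combination (-I) * this
  have hP0 : Complex.exp (-((μ - 1) / 2) * (α * I)) ≠ 0 := Complex.exp_ne_zero _
  have e1 : Complex.exp (v + α * I) + I
      = Complex.exp (α * I) * (Complex.exp v + I * Complex.exp (-α * I)) := by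
    rw [Complex.exp_add, hA']
    field_simp
  have e2 : Complex.exp (v - α * I) - I
      = (Complex.exp (α * I))⁻¹ * (Complex.exp v - I * Complex.exp (α * I)) := by
    rw [Complex.exp_sub]
    field_simp
  have e3 : Complex.exp (-((μ - 1) / 2) * (v + α * I))
      = Complex.exp (-((μ - 1) / 2) * v) * Complex.exp (-((μ - 1) / 2) * (α * I)) := by
    rw [mul_add, Complex.exp_add]
  have e4 : Complex.exp (-((μ - 1) / 2) * (v - α * I))
      = Complex.exp (-((μ - 1) / 2) * v) * (Complex.exp (-((μ - 1) / 2) * (α * I)))⁻¹ := by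
    rw [mul_sub, Complex.exp_sub, div_eq_mul_inv]
  rw [beachB, beachB, e1, e2, e3, e4]
  generalize Complex.exp (-((μ - 1) / 2) * (α * I)) = P at *
  generalize Complex.exp v + I * Complex.exp (-α * I) = X at *
  generalize Complex.exp v - I * Complex.exp (α * I) = Y at *
  generalize Complex.exp (α * I) = A at *
  generalize beachE μ (v + α * I) = E₁ at *
  generalize beachE μ (v - α * I) = E₂ at *
  generalize Complex.exp (-((μ - 1) / 2) * v) = Z at *
  rw [← neg_div, div_eq_div_iff (mul_ne_zero hA n1) (mul_ne_zero (inv_ne_zero hA) n2)]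
  field_simp
  linear_combination (Z * P ^ 2) * key - Z * I * A * X * E₂ * hP + Z * A ^ 2 * X * E₂ * I_sq

/-! ### The symbol at `± ∞` and its continuation to the left. -/

theorem norm_exp_sub_one_le_mul (x : ℂ) : ‖Complex.exp x - 1‖ ≤ ‖x‖ * Real.exp ‖x‖ := by
  simpa using Complex.norm_exp_sub_sum_le_norm_mul_exp x 1

/-- The function `e^{(μ-1)w/2} E(w)`, which has a limit as `Re w → ∞`. -/
def beachA (μ : ℝ) (w : ℂ) : ℂ := Complex.exp (logE μ w + (μ - 1) / 2 * w)

theorem beachA_ne_zero (μ : ℝ) (w : ℂ) : beachA μ w ≠ 0 := Complex.exp_ne_zero _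

/-- Evenness of `E` turns the limit of `beachA` at `+∞` into a limit of `beachB` at `-∞`. Together
with `beachB_mul_exp` this yields the behaviour of the symbol at both ends. -/
theorem beachB_eq_beachA_neg (μ : ℝ) (w : ℂ) : beachB μ w = beachA μ (-w) := by
  rw [beachB, beachA, logE_neg, beachE, ← Complex.exp_add]
  ring_nf

theorem beachB_mul_exp (μ : ℝ) (w : ℂ) :
    beachB μ w * Complex.exp (μ * w) = beachA μ w * Complex.exp w := by
  rw [beachB, beachA, beachE, ← Complex.exp_add, ← Complex.exp_add, ← Complex.exp_add]
  ring_nf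

/-- The half strip to the right of the origin. -/
def rightStrip (U : ℝ) : Set ℂ := {w | 0 ≤ w.re ∧ |w.im| ≤ U}

theorem exists_beachA_sub_isBigO {α μ U : ℝ} (h : BeachParams α μ U) :
    ∃ C₀ : ℝ, (fun w => beachA μ w - Real.exp C₀) =O[𝓟 (rightStrip U)]
        (fun w => Real.exp (-(w.re / 2))) ∧
      (fun w => (beachA μ w)⁻¹ - Real.exp (-C₀)) =O[𝓟 (rightStrip U)]
        (fun w => Real.exp (-(w.re / 2))) := by
  obtain ⟨C₀, C, hC, hb⟩ := exists_norm_logE_add_sub_le h.one_lt h.abs_U_lt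
  have key : ∀ σ : ℝ, |σ| = 1 → (fun w => Complex.exp (σ * (logE μ w + (μ - 1) / 2 * w))
      - Real.exp (σ * C₀)) =O[𝓟 (rightStrip U)] (fun w => Real.exp (-(w.re / 2))) := by
    intro σ hσ
    rw [isBigO_principal]
    refine ⟨Real.exp (σ * C₀) * (C * Real.exp C), fun w hw => ?_⟩
    have h1 := hb w (by rw [abs_of_pos h.U_pos]; exact hw.2)
    have h2 : Real.exp (-(w.re / 2)) ≤ 1 := Real.exp_le_one_iff.2 (by linarith [hw.1])
    have h3 : ‖(σ : ℂ) * (logE μ w + (μ - 1) / 2 * w - C₀)‖ ≤ C * Real.exp (-(w.re / 2)) := by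
      rw [norm_mul, norm_real, Real.norm_eq_abs, hσ, one_mul]; exact h1
    have h4 : ‖(σ : ℂ) * (logE μ w + (μ - 1) / 2 * w - C₀)‖ ≤ C :=
      h3.trans (mul_le_of_le_one_right hC h2)
    have h5 : Complex.exp (σ * (logE μ w + (μ - 1) / 2 * w)) - Real.exp (σ * C₀)
        = Real.exp (σ * C₀) * (Complex.exp (σ * (logE μ w + (μ - 1) / 2 * w - C₀)) - 1) := by
      rw [mul_sub, ofReal_exp, ← Complex.exp_add, mul_one]
      congr 2
      push_cast
      ring
    rw [h5, norm_mul, norm_real, Real.norm_of_nonneg (Real.exp_pos _).le,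
      Real.norm_of_nonneg (Real.exp_pos _).le, mul_assoc]
    gcongr
    calc _ ≤ _ := norm_exp_sub_one_le_mul _
      _ ≤ C * Real.exp (-(w.re / 2)) * Real.exp C := by gcongr
      _ = _ := by ring
  refine ⟨C₀, ?_, ?_⟩
  · simpa [beachA] using key 1 (by simp)
  · have := key (-1) (by simp)
    simp only [ofReal_neg, ofReal_one, neg_mul, one_mul, Complex.exp_neg (_ + _)] at this
    exact this

theorem isBigO_mul_sub_mul {S : Set ℂ} {f g : ℂ → ℂ} {l m : ℂ} {r : ℂ → ℝ}
    (hr : ∀ w ∈ S, ‖r w‖ ≤ 1) (hf : (fun w => f w - l) =O[𝓟 S] r)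
    (hg : (fun w => g w - m) =O[𝓟 S] r) : (fun w => f w * g w - l * m) =O[𝓟 S] r := by
  have h1 : r =O[𝓟 S] fun _ => (1 : ℝ) := by
    rw [isBigO_principal]
    exact ⟨1, fun w hw => by simpa using hr w hw⟩
  have h2 : (fun w => (f w - l) * (g w - m)) =O[𝓟 S] r := by
    simpa using hf.mul (hg.trans h1)
  have h3 : (fun w => (f w - l) * m) =O[𝓟 S] r := by
    simpa [mul_comm] using hf.const_mul_left m
  refine ((h2.add h3).add (hg.const_mul_left l)).congr_left fun w => ?_
  ring

theorem norm_exp_add_I_ge (w : ℂ) :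
    Real.exp w.re - 1 ≤ ‖Complex.exp w + I‖ ∧ 1 - Real.exp w.re ≤ ‖Complex.exp w + I‖ := by
  have h1 := norm_sub_norm_le (Complex.exp w) (-I)
  have h2 := norm_sub_norm_le (-I) (Complex.exp w)
  rw [norm_sub_rev] at h2
  simp only [sub_neg_eq_add, norm_neg, norm_I, Complex.norm_exp] at h1 h2
  exact ⟨h1, h2⟩

theorem two_mul_exp_neg_one_le : 2 * Real.exp (-1) ≤ 1 := by
  have h := Real.add_one_le_exp 1
  rw [Real.exp_neg]
  rw [mul_inv_le_iff₀ (Real.exp_pos 1)]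
  linarith

theorem half_exp_le_norm_exp_add_I {w : ℂ} (hw : 1 ≤ w.re) :
    Real.exp w.re / 2 ≤ ‖Complex.exp w + I‖ := by
  have h1 := Real.add_one_le_exp w.re
  have h2 := (norm_exp_add_I_ge w).1
  linarith

theorem half_le_norm_exp_add_I {w : ℂ} (hw : w.re ≤ -1) : 1 / 2 ≤ ‖Complex.exp w + I‖ := by
  have h1 : Real.exp w.re ≤ Real.exp (-1) := Real.exp_le_exp.2 hw
  have h2 := (norm_exp_add_I_ge w).2
  linarith [two_mul_exp_neg_one_le]

theorem exists_beachT_mul_exp_sub_isBigO {α μ U : ℝ} (h : BeachParams α μ U) :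
    ∃ κ : ℂ, (fun w => beachT μ w * Complex.exp (μ * w) - κ) =O[𝓟 {w | 1 ≤ w.re ∧ |w.im| ≤ U}]
      fun w => Real.exp (-(w.re / 2)) := by
  obtain ⟨C₀, h1, -⟩ := exists_beachA_sub_isBigO h
  refine ⟨Real.exp C₀ * 1, ?_⟩
  have h2 : (fun w => beachA μ w - Real.exp C₀) =O[𝓟 {w | 1 ≤ w.re ∧ |w.im| ≤ U}]
      fun w => Real.exp (-(w.re / 2)) :=
    h1.mono (principal_mono.2 fun w hw => ⟨by linarith [hw.1], hw.2⟩)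
  have h3 : (fun w : ℂ => Complex.exp w / (Complex.exp w + I) - 1)
      =O[𝓟 {w | 1 ≤ w.re ∧ |w.im| ≤ U}] fun w => Real.exp (-(w.re / 2)) := by
    rw [isBigO_principal]
    refine ⟨2, fun w hw => ?_⟩
    have h4 := half_exp_le_norm_exp_add_I hw.1
    have h5 : Complex.exp w + I ≠ 0 := exp_add_I_ne_zero_of_re (by linarith [hw.1])
    have h6 : Complex.exp w / (Complex.exp w + I) - 1 = -I / (Complex.exp w + I) := by
      field_simp
      ring
    rw [h6, norm_div, norm_neg, norm_I, Real.norm_of_nonneg (Real.exp_pos _).le]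
    calc _ ≤ 1 / (Real.exp w.re / 2) := by gcongr
      _ = 2 * Real.exp (-w.re) := by rw [Real.exp_neg]; field_simp
      _ ≤ _ := by gcongr; linarith [hw.1]
  refine (isBigO_mul_sub_mul (fun w hw => ?_) h2 h3).congr_left fun w => ?_
  · rw [Real.norm_of_nonneg (Real.exp_pos _).le]
    exact Real.exp_le_one_iff.2 (by linarith [hw.1])
  · rw [beachT, div_mul_eq_mul_div, beachB_mul_exp, mul_div_assoc]

theorem inv_exp_add_I_isBigO (S : Set ℂ) (hS : ∀ w ∈ S, w.re ≤ -1) :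
    (fun w : ℂ => (Complex.exp w + I)⁻¹ - -I) =O[𝓟 S] fun w => Real.exp (w.re / 2) := by
  rw [isBigO_principal]
  refine ⟨2, fun w hw => ?_⟩
  have h4 := half_le_norm_exp_add_I (hS w hw)
  have h5 : Complex.exp w + I ≠ 0 := exp_add_I_ne_zero_of_re (by linarith [hS w hw])
  have h6 : (Complex.exp w + I)⁻¹ - -I = I * Complex.exp w / (Complex.exp w + I) := by
    field_simp
    linear_combination I_sq
  rw [h6, norm_div, norm_mul, norm_I, one_mul, Complex.norm_exp,
    Real.norm_of_nonneg (Real.exp_pos _).le]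
  calc _ ≤ Real.exp w.re / (1 / 2) := by gcongr
    _ = 2 * Real.exp w.re := by ring
    _ ≤ _ := by gcongr; linarith [hS w hw]

theorem norm_exp_half_le_one {S : Set ℂ} (hS : ∀ w ∈ S, w.re ≤ -1) :
    ∀ w ∈ S, ‖Real.exp (w.re / 2)‖ ≤ 1 := fun w hw => by
  rw [Real.norm_of_nonneg (Real.exp_pos _).le]
  exact Real.exp_le_one_iff.2 (by linarith [hS w hw])

/-- The continuation of the symbol to `Re w < 0`, across `Im w = ± U`. -/
def beachText (μ c σ : ℝ) (w : ℂ) : ℂ :=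
  c * (beachA μ (-(w - σ * (Real.pi * I))))⁻¹ * (1 - Complex.exp (2 * (w - σ * (Real.pi / 2 * I))))
    * (1 - Complex.exp (2 * μ * (w - σ * (Real.pi / 2 * I))))⁻¹ * (Complex.exp w + I)⁻¹

theorem sinh_eq_exp_mul (v : ℂ) :
    Complex.sinh v = -(Complex.exp (-v) * (1 - Complex.exp (2 * v)) / 2) := by
  have h : Complex.exp (-v) * Complex.exp (2 * v) = Complex.exp v := by
    rw [← Complex.exp_add]; ring_nf
  linear_combination Complex.two_sinh v / 2 - h / 2

theorem one_sub_exp_ne_zero {v : ℂ} (hv : v.re < 0) : 1 - Complex.exp v ≠ 0 := by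
  intro h
  have h1 : Complex.exp v = 1 := (sub_eq_zero.1 h).symm
  have h2 := congrArg norm h1
  rw [Complex.norm_exp, norm_one, Real.exp_eq_one_iff] at h2
  linarith

/-- Put `v = w - σ iπ/2` and `w' = w - σ iπ`. The identity `E(w) E(w') sinh (μv) = c sinh v`
replaces `E(w)` by `1 / E(w')`, and `w'` stays in the strip of holomorphy as `w` moves on to `Im w =
σπ`. On the ray `Im w = σU` the identity applies because `U - π/2 < π/μ`. -/
theorem beachText_eq {α μ U c σ : ℝ} (h : BeachParams α μ U) (hσ : σ = 1 ∨ σ = -1)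
    (hc : ∀ w : ℂ, w.re < 0 → |w.im| < Real.pi / μ →
      beachE μ (w + Real.pi / 2 * I) * beachE μ (w - Real.pi / 2 * I) * Complex.sinh (μ * w)
        = c * Complex.sinh w) {w : ℂ} (hw : w.re < 0) (hw' : w.im = σ * U) :
    beachText μ c σ w = beachT μ w := by
  set v : ℂ := w - σ * (Real.pi / 2 * I) with hv
  set w' : ℂ := w - σ * (Real.pi * I) with hw''
  have hvre : v.re < 0 := by simpa [hv] using hw
  have hvim : |v.im| < Real.pi / μ := by
    have : v.im = σ * (U - Real.pi / 2) := by simp [hv, hw']; ring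
    rw [this, abs_mul, h.pi_div_eq]
    have h1 : |σ| = 1 := by rcases hσ with rfl | rfl <;> simp
    rw [h1, one_mul, abs_of_pos (by linarith [h.lt_U, h.pos])]
    linarith [h.U_lt]
  have key : beachE μ w * beachE μ w' * Complex.sinh (μ * v) = c * Complex.sinh v := by
    rw [← hc v hvre hvim]
    rcases hσ with rfl | rfl
    · have e1 : v + Real.pi / 2 * I = w := by rw [hv]; push_cast; ring
      have e2 : v - Real.pi / 2 * I = w' := by rw [hv, hw'']; push_cast; ring
      rw [e1, e2]
    · have e1 : v + Real.pi / 2 * I = w' := by rw [hv, hw'']; push_cast; ring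
      have e2 : v - Real.pi / 2 * I = w := by rw [hv]; push_cast; ring
      rw [e1, e2]; ring
  have hμ := h.one_lt
  have n1 : 1 - Complex.exp (2 * μ * v) ≠ 0 := one_sub_exp_ne_zero (by
    have : (2 * μ * v : ℂ) = ((2 * μ : ℝ) : ℂ) * v := by push_cast; ring
    rw [this, re_ofReal_mul]; nlinarith)
  have n2 := beachA_ne_zero μ (-w')
  rw [sinh_eq_exp_mul, sinh_eq_exp_mul v, ← mul_assoc 2] at key
  have hA : beachA μ (-w') = Complex.exp (-((μ - 1) / 2) * w') * beachE μ w' := by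
    rw [← beachB_eq_beachA_neg, beachB]
  have hexp : Complex.exp (-((μ - 1) / 2) * w) * Complex.exp (-((μ - 1) / 2) * w')
      * Complex.exp (-v) = Complex.exp (-(μ * v)) := by
    rw [← Complex.exp_add, ← Complex.exp_add]
    congr 1
    rw [hv, hw'']
    ring
  rw [beachText, ← hv, ← hw'', beachT, div_eq_mul_inv (beachB μ w), beachB]
  congr 1
  rw [mul_inv_eq_iff_eq_mul₀ n1, mul_right_comm, ← div_eq_mul_inv, div_eq_iff n2]
  rw [hA]
  have n3 : Complex.exp (-v) ≠ 0 := Complex.exp_ne_zero _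
  refine mul_left_cancel₀ n3 ?_
  linear_combination 2 * key - beachE μ w * beachE μ w' * (1 - Complex.exp (2 * μ * v)) * hexp

theorem differentiableAt_beachText {α μ U : ℝ} (h : BeachParams α μ U) (c : ℝ) {σ : ℝ}
    {w : ℂ} (hw : w.re < 0) (hw' : |(w - σ * (Real.pi * I)).im| ≤ U) :
    DifferentiableAt ℂ (beachText μ c σ) w := by
  have hμ := h.one_lt
  have n1 : 1 - Complex.exp (2 * μ * (w - σ * (Real.pi / 2 * I))) ≠ 0 := one_sub_exp_ne_zero (by
    have : (2 * μ * (w - σ * (Real.pi / 2 * I)) : ℂ)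
      = ((2 * μ : ℝ) : ℂ) * (w - σ * (Real.pi / 2 * I)) := by push_cast; ring
    rw [this, re_ofReal_mul]
    have : (w - σ * (Real.pi / 2 * I)).re = w.re := by simp
    rw [this]; nlinarith)
  have n2 : Complex.exp w + I ≠ 0 := exp_add_I_ne_zero_of_re hw.ne
  have hA : DifferentiableAt ℂ (fun w => beachA μ (-(w - σ * (Real.pi * I)))) w := by
    have hd : DifferentiableAt ℂ (beachB μ) (w - σ * (Real.pi * I)) :=
      differentiableAt_beachB hμ (hw'.trans_lt ((le_abs_self U).trans_lt h.abs_U_lt))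
    simp only [← beachB_eq_beachA_neg]
    exact DifferentiableAt.comp (g := beachB μ) (f := fun w => w - σ * (Real.pi * I)) w hd
      (by fun_prop)
  unfold beachText
  refine DifferentiableAt.mul (DifferentiableAt.mul (DifferentiableAt.mul
    (DifferentiableAt.mul (by fun_prop) (hA.inv (beachA_ne_zero _ _))) (by fun_prop)) ?_) ?_
  · exact DifferentiableAt.inv (by fun_prop) n1
  · exact DifferentiableAt.inv (by fun_prop) n2

theorem exists_beachT_sub_isBigO {α μ U : ℝ} (h : BeachParams α μ U) :
    ∃ c C₁ : ℝ,
      (fun w => beachT μ w - C₁ * -I) =O[𝓟 {w | w.re ≤ -1 ∧ |w.im| ≤ U}]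
        (fun w => Real.exp (w.re / 2)) ∧
      ∀ σ : ℝ, (σ = 1 ∨ σ = -1) →
        (∀ w : ℂ, w.re < 0 → w.im = σ * U → beachText μ c σ w = beachT μ w) ∧
        (fun w => beachText μ c σ w - C₁ * -I)
          =O[𝓟 {w | w.re ≤ -1 ∧ |(w - σ * (Real.pi * I)).im| ≤ Real.pi - U}]
          (fun w => Real.exp (w.re / 2)) := by
  obtain ⟨c, hc⟩ := exists_beachE_mul_beachE h.one_lt
  obtain ⟨C₀, h1, h2⟩ := exists_beachA_sub_isBigO h
  have hμ := h.one_lt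
  set S : Set ℂ := {w | w.re ≤ -1 ∧ |w.im| ≤ U} with hS
  have hSre : ∀ w ∈ S, w.re ≤ -1 := fun w hw => hw.1
  have hT : (fun w => beachT μ w - Real.exp C₀ * -I) =O[𝓟 S] fun w => Real.exp (w.re / 2) := by
    have h3 := h1.comp_tendsto (k := fun w : ℂ => -w) (l' := 𝓟 S)
      (tendsto_principal_principal.2 fun w hw => ⟨by simp; linarith [hw.1], by simpa using hw.2⟩)
    have h4 : (fun w => beachA μ (-w) - Real.exp C₀) =O[𝓟 S] fun w => Real.exp (w.re / 2) := by
      refine h3.congr (fun w => rfl) fun w => ?_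
      simp [neg_div]
    refine (isBigO_mul_sub_mul (norm_exp_half_le_one hSre) h4
      (inv_exp_add_I_isBigO S hSre)).congr_left fun w => ?_
    rw [beachT, beachB_eq_beachA_neg, div_eq_mul_inv]
  have hText : ∀ σ : ℝ, (fun w => beachText μ c σ w - c * Real.exp (-C₀) * 1 * 1 * -I)
      =O[𝓟 {w | w.re ≤ -1 ∧ |(w - σ * (Real.pi * I)).im| ≤ Real.pi - U}]
        (fun w => Real.exp (w.re / 2)) := by
    intro σ
    set S' : Set ℂ := {w | w.re ≤ -1 ∧ |(w - σ * (Real.pi * I)).im| ≤ Real.pi - U} with hS'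
    have hre : ∀ w ∈ S', w.re ≤ -1 := fun w hw => hw.1
    have hr := norm_exp_half_le_one hre
    have h3 := h2.comp_tendsto (k := fun w : ℂ => -(w - σ * (Real.pi * I))) (l' := 𝓟 S')
      (tendsto_principal_principal.2 fun w hw => ⟨by simp; linarith [hw.1], by
        rw [neg_im, abs_neg]
        exact hw.2.trans (by linarith [h.lt_U, h.pos])⟩)
    have h4 : (fun w => (beachA μ (-(w - σ * (Real.pi * I))))⁻¹ - Real.exp (-C₀))
        =O[𝓟 S'] fun w => Real.exp (w.re / 2) := by
      refine h3.congr (fun w => rfl) fun w => ?_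
      simp [neg_div]
    have h4' : (fun w => c * (beachA μ (-(w - σ * (Real.pi * I))))⁻¹ - c * Real.exp (-C₀))
        =O[𝓟 S'] fun w => Real.exp (w.re / 2) := by
      refine (h4.const_mul_left (c : ℂ)).congr_left fun w => ?_
      ring
    have h5 : (fun w : ℂ => (1 - Complex.exp (2 * (w - σ * (Real.pi / 2 * I)))) - 1)
        =O[𝓟 S'] fun w => Real.exp (w.re / 2) := by
      rw [isBigO_principal]
      refine ⟨1, fun w hw => ?_⟩
      rw [sub_sub_cancel_left, norm_neg, Complex.norm_exp, one_mul,
        Real.norm_of_nonneg (Real.exp_pos _).le, Real.exp_le_exp]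
      simp
      linarith [hre w hw]
    have h6 : (fun w : ℂ => (1 - Complex.exp (2 * μ * (w - σ * (Real.pi / 2 * I))))⁻¹ - 1)
        =O[𝓟 S'] fun w => Real.exp (w.re / 2) := by
      rw [isBigO_principal]
      refine ⟨2, fun w hw => ?_⟩
      have hw1 := hre w hw
      set v : ℂ := 2 * μ * (w - σ * (Real.pi / 2 * I)) with hv
      have hvre : v.re = 2 * μ * w.re := by simp [hv]
      have hv1 : v.re ≤ -1 := by rw [hvre]; nlinarith
      have hv2 : v.re ≤ w.re / 2 := by rw [hvre]; nlinarith
      have n1 : 1 - Complex.exp v ≠ 0 := one_sub_exp_ne_zero (by linarith)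
      have e1 : (1 - Complex.exp v)⁻¹ - 1 = Complex.exp v / (1 - Complex.exp v) := by
        field_simp
        ring
      have e2 : 1 / 2 ≤ ‖1 - Complex.exp v‖ := by
        have := norm_sub_norm_le 1 (Complex.exp v)
        rw [norm_one, Complex.norm_exp] at this
        have h3 := Real.exp_le_exp.2 hv1
        linarith [two_mul_exp_neg_one_le]
      rw [e1, norm_div, Complex.norm_exp, Real.norm_of_nonneg (Real.exp_pos _).le]
      calc _ ≤ Real.exp v.re / (1 / 2) := by gcongr
        _ = 2 * Real.exp v.re := by ring
        _ ≤ _ := by gcongr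
    exact isBigO_mul_sub_mul hr (isBigO_mul_sub_mul hr (isBigO_mul_sub_mul hr h4' h5) h6)
      (inv_exp_add_I_isBigO S' hre)
  refine ⟨c, Real.exp C₀, hT, fun σ hσ => ?_⟩
  have heq : ∀ w : ℂ, w.re < 0 → w.im = σ * U → beachText μ c σ w = beachT μ w :=
    fun w h3 h4 => beachText_eq h hσ hc h3 h4
  refine ⟨heq, ?_⟩
  -- The symbol and its continuation agree on the ray `Im w = σU`, which lies in both regions, so
  -- their limits at `-∞` coincide.
  have hL : (c * Real.exp (-C₀) * 1 * 1 * -I : ℂ) = Real.exp C₀ * -I := by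
    have hσ1 : |σ| = 1 := by rcases hσ with rfl | rfl <;> simp
    have hlin : Tendsto (fun x : ℝ => (x : ℂ) + (σ * U : ℝ) * I) atBot (𝓟 S) := by
      rw [tendsto_principal]
      filter_upwards [eventually_le_atBot (-1)] with x hx
      exact ⟨by simpa using hx, by
        simp only [add_im, ofReal_im, mul_im, ofReal_re, I_im, I_re, mul_one, mul_zero, add_zero,
          zero_add, abs_mul, hσ1, one_mul, abs_of_pos h.U_pos]; exact le_rfl⟩
    have hlin' : Tendsto (fun x : ℝ => (x : ℂ) + (σ * U : ℝ) * I) atBot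
        (𝓟 {w | w.re ≤ -1 ∧ |(w - σ * (Real.pi * I)).im| ≤ Real.pi - U}) := by
      rw [tendsto_principal]
      filter_upwards [eventually_le_atBot (-1)] with x hx
      refine ⟨by simpa using hx, ?_⟩
      have : ((x : ℂ) + (σ * U : ℝ) * I - σ * (Real.pi * I)).im = -(σ * (Real.pi - U)) := by
        simp; ring
      rw [this, abs_neg, abs_mul, hσ1, one_mul, abs_of_pos (by linarith [h.U_lt_pi])]
    have hz : Tendsto (fun x : ℝ => Real.exp (((x : ℂ) + (σ * U : ℝ) * I).re / 2)) atBot (𝓝 0) := by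
      simp only [add_re, ofReal_re, mul_re, I_re, mul_zero, ofReal_im, I_im, mul_one, sub_self,
        add_zero]
      exact Real.tendsto_exp_atBot.comp (tendsto_id.atBot_div_const (by norm_num))
    have t1 := tendsto_sub_nhds_zero_iff.1 ((hT.comp_tendsto hlin).trans_tendsto hz)
    have t2 := tendsto_sub_nhds_zero_iff.1 (((hText σ).comp_tendsto hlin').trans_tendsto hz)
    refine tendsto_nhds_unique t2 (t1.congr' ?_)
    filter_upwards [eventually_lt_atBot 0] with x hx
    exact (heq _ (by simpa using hx) (by simp)).symm
  exact hL ▸ hText σ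

/-- At `x ± iπ` the factors built from `beachA`, from `e^{2v}` and from `e^w + i` take the same
value. Only `(1 - e^{2μv})⁻¹` differs, and by `O(e^{2μx})`; this is the origin of the exponent `2μ`
in the Dirichlet remainder. -/
theorem exists_beachText_jump {α μ U : ℝ} (h : BeachParams α μ U) (c : ℝ) :
    ∃ C, 0 ≤ C ∧ ∀ x : ℝ, x ≤ -1 →
      ‖beachText μ c 1 (x + Real.pi * I) - beachText μ c (-1) (x - Real.pi * I)‖
        ≤ C * Real.exp (2 * μ * x) := by
  obtain ⟨C₀, -, h2⟩ := exists_beachA_sub_isBigO h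
  obtain ⟨K, hK⟩ := isBigO_principal.1 h2
  have hμ := h.one_lt
  set D : ℝ := |K| + Real.exp (-C₀) with hD
  have hA : ∀ x : ℝ, x ≤ -1 → ‖(beachA μ (-(x : ℂ)))⁻¹‖ ≤ D := by
    intro x hx
    have h3 := hK (-(x : ℂ)) ⟨by simp; linarith, by simpa using h.U_pos.le⟩
    rw [Real.norm_of_nonneg (Real.exp_pos _).le] at h3
    have h4 : Real.exp (-((-(x : ℂ)).re / 2)) ≤ 1 :=
      Real.exp_le_one_iff.2 (by simp; linarith)
    have h5 : K * Real.exp (-((-(x : ℂ)).re / 2)) ≤ |K| := by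
      calc _ ≤ |K| * Real.exp (-((-(x : ℂ)).re / 2)) := by gcongr; exact le_abs_self K
        _ ≤ |K| * 1 := by gcongr
        _ = |K| := mul_one _
    have h6 := norm_le_norm_sub_add (beachA μ (-(x : ℂ)))⁻¹ (Real.exp (-C₀) : ℂ)
    rw [norm_real, Real.norm_of_nonneg (Real.exp_pos _).le] at h6
    linarith
  have hD0 : 0 ≤ D := by positivity
  refine ⟨|c| * D * 2 * 8 * 2, by positivity, fun x hx => ?_⟩
  have e1 : Complex.exp ((x : ℂ) + Real.pi * I) = -Complex.exp x := by
    rw [Complex.exp_add, Complex.exp_pi_mul_I]; ring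
  have e2 : Complex.exp ((x : ℂ) - Real.pi * I) = -Complex.exp x := by
    rw [Complex.exp_sub, Complex.exp_pi_mul_I]; ring
  have e3 : Complex.exp (2 * ((x : ℂ) + Real.pi / 2 * I)) = -Complex.exp (2 * x) := by
    rw [mul_add, Complex.exp_add, show (2 * (Real.pi / 2 * I) : ℂ) = Real.pi * I by ring,
      Complex.exp_pi_mul_I]
    ring
  have e4 : Complex.exp (2 * ((x : ℂ) - Real.pi / 2 * I)) = -Complex.exp (2 * x) := by
    rw [mul_sub, Complex.exp_sub, show (2 * (Real.pi / 2 * I) : ℂ) = Real.pi * I by ring,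
      Complex.exp_pi_mul_I]
    ring
  have hinv : ∀ t : ℝ, 1 / 2 ≤ ‖1 - Complex.exp (2 * μ * (x + t * I))‖ ∧
      ‖Complex.exp (2 * μ * (x + t * I))‖ = Real.exp (2 * μ * x) := by
    intro t
    have h3 : ‖Complex.exp (2 * μ * (x + t * I))‖ = Real.exp (2 * μ * x) := by
      rw [Complex.norm_exp]; simp
    have h4 := norm_sub_norm_le 1 (Complex.exp (2 * μ * (x + t * I)))
    rw [norm_one, h3] at h4
    have h5 : Real.exp (2 * μ * x) ≤ Real.exp (-1) := Real.exp_le_exp.2 (by nlinarith)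
    exact ⟨by linarith [two_mul_exp_neg_one_le], h3⟩
  obtain ⟨p1, p2⟩ := hinv (Real.pi / 2)
  obtain ⟨m1, m2⟩ := hinv (-(Real.pi / 2))
  have q1 : (x : ℂ) + ((Real.pi / 2 : ℝ) : ℂ) * I = x + Real.pi / 2 * I := by push_cast; ring
  have q2 : (x : ℂ) + ((-(Real.pi / 2) : ℝ) : ℂ) * I = x - Real.pi / 2 * I := by push_cast; ring
  rw [q1] at p1 p2
  rw [q2] at m1 m2
  have r1 : (x : ℂ) + Real.pi * I - ((1 : ℝ) : ℂ) * (Real.pi * I) = x := by push_cast; ring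
  have r2 : (x : ℂ) - Real.pi * I - ((-1 : ℝ) : ℂ) * (Real.pi * I) = x := by push_cast; ring
  have r3 : (x : ℂ) + Real.pi * I - ((1 : ℝ) : ℂ) * (Real.pi / 2 * I) = x + Real.pi / 2 * I := by
    push_cast; ring
  have r4 : (x : ℂ) - Real.pi * I - ((-1 : ℝ) : ℂ) * (Real.pi / 2 * I) = x - Real.pi / 2 * I := by
    push_cast; ring
  have hI := half_le_norm_exp_add_I (w := x + Real.pi * I) (by simpa using hx)
  rw [e1] at hI
  have hx2 : ‖1 - -Complex.exp (2 * x)‖ ≤ 2 := by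
    refine (norm_sub_le _ _).trans ?_
    rw [norm_one, norm_neg, Complex.norm_exp]
    have : Real.exp ((2 * (x : ℂ)).re) ≤ 1 := Real.exp_le_one_iff.2 (by simp; linarith)
    linarith
  have hAx := hA x hx
  rw [beachText, beachText, r1, r2, r3, r4, e1, e2, e3, e4]
  generalize Complex.exp (2 * μ * (x + Real.pi / 2 * I)) = P at *
  generalize Complex.exp (2 * μ * (x - Real.pi / 2 * I)) = M at *
  have n1 : 1 - P ≠ 0 := norm_pos_iff.1 (by linarith)
  have n2 : 1 - M ≠ 0 := norm_pos_iff.1 (by linarith)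
  have key : (1 - P)⁻¹ - (1 - M)⁻¹ = (P - M) / ((1 - P) * (1 - M)) := by
    field_simp
    ring
  have hk : ‖(1 - P)⁻¹ - (1 - M)⁻¹‖ ≤ 8 * Real.exp (2 * μ * x) := by
    rw [key, norm_div, norm_mul, div_le_iff₀ (by positivity)]
    have h3 : ‖P - M‖ ≤ 2 * Real.exp (2 * μ * x) := (norm_sub_le _ _).trans (by linarith)
    have h4 : 1 / 2 * (1 / 2) ≤ ‖1 - P‖ * ‖1 - M‖ := by gcongr
    have h5 := Real.exp_pos (2 * μ * x)
    nlinarith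
  have hI' : ‖(-Complex.exp (x : ℂ) + I)⁻¹‖ ≤ 2 := by
    rw [norm_inv]
    exact inv_le_of_inv_le₀ (by norm_num) (by linarith)
  calc _ = ‖(c : ℂ)‖ * ‖(beachA μ (-(x : ℂ)))⁻¹‖ * ‖1 - -Complex.exp (2 * x)‖
        * ‖(1 - P)⁻¹ - (1 - M)⁻¹‖ * ‖(-Complex.exp (x : ℂ) + I)⁻¹‖ := by
        rw [← norm_mul, ← norm_mul, ← norm_mul, ← norm_mul]
        congr 1
        ring
    _ ≤ |c| * D * 2 * (8 * Real.exp (2 * μ * x)) * 2 := by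
        rw [norm_real, Real.norm_eq_abs]
        gcongr
    _ = _ := by ring

/-! ### Pushing the contour to `-∞`. -/

/-- A segment `Re w = s` may be pushed to `-∞`. -/
theorem I_mul_integral_eq_Iic_sub_Iic {H : ℂ → ℂ} {s a b : ℝ} (hab : a ≤ b) {B : ℝ → ℝ}
    (hd : ∀ w : ℂ, w.re ≤ s → a ≤ w.im → w.im ≤ b → DifferentiableAt ℂ H w)
    (hb : ∀ x : ℝ, x ≤ s → ∀ y ∈ Icc a b, ‖H (x + y * I)‖ ≤ B x)
    (hB : IntegrableOn B (Iic s)) (hB0 : Tendsto B atBot (𝓝 0)) :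
    I * ∫ y in a..b, H (s + y * I)
      = (∫ u in Iic s, H (u + b * I)) - ∫ u in Iic s, H (u + a * I) := by
  have e : ∀ u y : ℝ, -((u : ℂ) + y * I) = ((-u : ℝ) : ℂ) + ((-y : ℝ) : ℂ) * I := fun u y => by
    push_cast; ring
  have h := hook_eq_zero (H := fun w => H (-w)) (s := -s) (a := -b) (b := -a) (B := fun x => B (-x))
    (by linarith)
    (fun w h1 h2 h3 => (hd (-w) (by simp; linarith) (by simp; linarith) (by simp; linarith)).comp w
      differentiableAt_id.neg)
    (fun x hx y hy => by
      rw [e]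
      exact hb (-x) (by linarith) (-y) ⟨by linarith [hy.2], by linarith [hy.1]⟩)
    (by
      rw [← integrableOn_Ici_iff_integrableOn_Ioi]
      have := hB.comp_neg
      simpa using this)
    (hB0.comp tendsto_neg_atTop_atBot)
  simp only [hook, e, neg_neg] at h
  rw [integral_comp_neg_Ioi (-s) (fun u : ℝ => H (u + a * I)),
    integral_comp_neg_Ioi (-s) (fun u : ℝ => H (u + b * I)),
    intervalIntegral.integral_comp_neg (fun y : ℝ => H (s + y * I)), neg_neg, neg_neg, neg_neg] at h
  linear_combination h

theorem integrableOn_exp_div_two (s : ℝ) : IntegrableOn (fun u : ℝ => Real.exp (u / 2)) (Iic s) := by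
  simpa [div_eq_inv_mul] using integrableOn_exp_mul_Iic (a := 2⁻¹) (by norm_num) s

theorem tendsto_exp_div_two : Tendsto (fun u : ℝ => Real.exp (u / 2)) atBot (𝓝 0) :=
  Real.tendsto_exp_atBot.comp (tendsto_id.atBot_div_const (by norm_num))

/-- The limit `L` must be subtracted to make the rays towards `-∞` convergent; on the segment it
contributes its length times `iL`. -/
theorem I_mul_integral_sub_eq {H : ℂ → ℂ} {s a b C : ℝ} {L : ℂ} (hab : a ≤ b)
    (hd : ∀ w : ℂ, w.re ≤ s → a ≤ w.im → w.im ≤ b → DifferentiableAt ℂ H w)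
    (hb : ∀ w : ℂ, w.re ≤ s → a ≤ w.im → w.im ≤ b → ‖H w - L‖ ≤ C * Real.exp (w.re / 2)) :
    (I * (∫ y in a..b, H (s + y * I)) - (b - a) * I * L
      = (∫ u in Iic s, (H (u + b * I) - L)) - ∫ u in Iic s, (H (u + a * I) - L)) ∧
    ∀ y ∈ Icc a b, IntegrableOn (fun u : ℝ => H (u + y * I) - L) (Iic s) := by
  have hb' : ∀ x : ℝ, x ≤ s → ∀ y ∈ Icc a b, ‖H (x + y * I) - L‖ ≤ C * Real.exp (x / 2) :=
    fun x hx y hy => by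
      simpa using hb (x + y * I) (by simpa using hx) (by simpa using hy.1) (by simpa using hy.2)
  have hBi := (integrableOn_exp_div_two s).const_mul C
  have hray : ∀ x : ℝ, x ≤ s → ∀ y ∈ Icc a b, DifferentiableAt ℂ H (x + y * I) := fun x hx y hy =>
    hd _ (by simpa using hx) (by simpa using hy.1) (by simpa using hy.2)
  constructor
  · rw [← I_mul_integral_eq_Iic_sub_Iic (H := fun w => H w - L) hab
      (fun w h1 h2 h3 => (hd w h1 h2 h3).sub_const L) hb' hBi
      (by simpa using tendsto_exp_div_two.const_mul C), intervalIntegral.integral_sub]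
    · simp
      ring
    · refine ContinuousOn.intervalIntegrable fun y hy => ?_
      rw [uIcc_of_le hab] at hy
      exact (ContinuousAt.comp (f := fun y : ℝ => (s + y * I : ℂ))
        (hray s le_rfl y hy).continuousAt (by fun_prop)).continuousWithinAt
    · exact intervalIntegrable_const
  · intro y hy
    refine Integrable.mono' hBi ?_ ((ae_restrict_mem measurableSet_Iic).mono fun u hu => ?_)
    · refine ContinuousOn.aestronglyMeasurable (fun u hu => ?_) measurableSet_Iic
      exact ((ContinuousAt.comp (f := fun u : ℝ => (u + y * I : ℂ))
        (hray u hu y hy).continuousAt (by fun_prop)).sub continuousAt_const).continuousWithinAt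
    · exact hb' u hu y hy

/-- The segment of the contour at `Re w = s`, pushed to `-∞` on three sheets of the continuation,
leaves only the jump across `Im w = ± π`. -/
theorem I_mul_integral_eq_jump {H Hp Hm : ℂ → ℂ} {s U C : ℝ} {L : ℂ} (hU : 0 ≤ U)
    (hU' : U ≤ Real.pi)
    (hd : ∀ w : ℂ, w.re ≤ s → -U ≤ w.im → w.im ≤ U → DifferentiableAt ℂ H w)
    (hdp : ∀ w : ℂ, w.re ≤ s → U ≤ w.im → w.im ≤ Real.pi → DifferentiableAt ℂ Hp w)
    (hdm : ∀ w : ℂ, w.re ≤ s → -Real.pi ≤ w.im → w.im ≤ -U → DifferentiableAt ℂ Hm w)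
    (hb : ∀ w : ℂ, w.re ≤ s → -U ≤ w.im → w.im ≤ U → ‖H w - L‖ ≤ C * Real.exp (w.re / 2))
    (hbp : ∀ w : ℂ, w.re ≤ s → U ≤ w.im → w.im ≤ Real.pi →
      ‖Hp w - L‖ ≤ C * Real.exp (w.re / 2))
    (hbm : ∀ w : ℂ, w.re ≤ s → -Real.pi ≤ w.im → w.im ≤ -U →
      ‖Hm w - L‖ ≤ C * Real.exp (w.re / 2))
    (hgp : ∀ u : ℝ, u ≤ s → Hp (u + U * I) = H (u + U * I))
    (hgm : ∀ u : ℝ, u ≤ s → Hm (u + (-U : ℝ) * I) = H (u + (-U : ℝ) * I)) :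
    I * (∫ y in (-U)..U, H (s + y * I)) = 2 * Real.pi * I * L
      + (∫ u in Iic s, (Hp (u + Real.pi * I) - Hm (u + (-Real.pi : ℝ) * I)))
      - I * (∫ y in U..Real.pi, Hp (s + y * I))
      - I * ∫ y in (-Real.pi)..(-U), Hm (s + y * I) := by
  obtain ⟨h1, i1⟩ := I_mul_integral_sub_eq (by linarith) hd hb
  obtain ⟨h2, i2⟩ := I_mul_integral_sub_eq hU' hdp hbp
  obtain ⟨h3, i3⟩ := I_mul_integral_sub_eq (by linarith) hdm hbm
  -- On the rays `Im w = ± U` the sheets agree, so these rays cancel in the sum of the three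
  -- identities. The constants add up to `(2U + 2(π - U)) i L = 2πi L`.
  rw [setIntegral_congr_fun (g := fun u : ℝ => H (u + U * I) - L) (f := fun u : ℝ => Hp (u + U * I) - L)
    measurableSet_Iic fun u hu => by simp only [hgp u hu]] at h2
  rw [setIntegral_congr_fun (g := fun u : ℝ => H (u + (-U : ℝ) * I) - L)
    (f := fun u : ℝ => Hm (u + (-U : ℝ) * I) - L)
    measurableSet_Iic fun u hu => by simp only [hgm u hu]] at h3
  have h4 : (∫ u in Iic s, (Hp (u + Real.pi * I) - L))
      - (∫ u in Iic s, (Hm (u + (-Real.pi : ℝ) * I) - L))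
      = ∫ u in Iic s, (Hp (u + Real.pi * I) - Hm (u + (-Real.pi : ℝ) * I)) := by
    rw [← integral_sub (i2 _ ⟨hU', le_rfl⟩) (i3 _ ⟨le_rfl, by linarith⟩)]
    refine integral_congr_ae (Eventually.of_forall fun u => ?_)
    simp
  rw [← h4]
  push_cast at h1 h2 h3 ⊢
  linear_combination h1 + h2 + h3

theorem exists_exp_neg_mul_le_rpow {m b : ℝ} (hm : 0 < m) (hb : 0 < b) :
    ∃ K, 0 ≤ K ∧ ∀ ρ : ℝ, 0 < ρ → Real.exp (-(b * ρ)) ≤ K * ρ ^ (-m) := by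
  refine ⟨Real.exp (-(m * Real.log (b / m))), (Real.exp_pos _).le, fun ρ hρ => ?_⟩
  rw [Real.rpow_def_of_pos hρ, ← Real.exp_add, Real.exp_le_exp]
  have h1 := Real.log_le_sub_one_of_pos (show 0 < b / m * ρ by positivity)
  rw [Real.log_mul (by positivity) hρ.ne'] at h1
  have h2 : m * (Real.log (b / m) + Real.log ρ) ≤ m * (b / m * ρ - 1) := by gcongr
  have h3 : m * (b / m * ρ - 1) = b * ρ - m := by field_simp
  linarith

/-- The contour at `Re w = -1` is, up to the residue constant at `-∞`, of size `‖z‖ ^ (-m)`. -/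
theorem exists_hook_sub_le {Q Qp Qm : ℂ → ℂ} {α U C m : ℝ} {L : ℂ} (hα : 0 < α)
    (hU : Real.pi / 2 + α < U) (hU' : U < Real.pi) (hm : 0 < m)
    (hd : ∀ w : ℂ, w.re ≤ -1 → -U ≤ w.im → w.im ≤ U → DifferentiableAt ℂ Q w)
    (hdp : ∀ w : ℂ, w.re ≤ -1 → U ≤ w.im → w.im ≤ Real.pi → DifferentiableAt ℂ Qp w)
    (hdm : ∀ w : ℂ, w.re ≤ -1 → -Real.pi ≤ w.im → w.im ≤ -U → DifferentiableAt ℂ Qm w)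
    (hb : ∀ w : ℂ, w.re ≤ -1 → -U ≤ w.im → w.im ≤ U → ‖Q w - L‖ ≤ C * Real.exp (w.re / 2))
    (hbp : ∀ w : ℂ, w.re ≤ -1 → U ≤ w.im → w.im ≤ Real.pi →
      ‖Qp w - L‖ ≤ C * Real.exp (w.re / 2))
    (hbm : ∀ w : ℂ, w.re ≤ -1 → -Real.pi ≤ w.im → w.im ≤ -U →
      ‖Qm w - L‖ ≤ C * Real.exp (w.re / 2))
    (hgp : ∀ u : ℝ, u ≤ -1 → Qp (u + U * I) = Q (u + U * I))
    (hgm : ∀ u : ℝ, u ≤ -1 → Qm (u + (-U : ℝ) * I) = Q (u + (-U : ℝ) * I))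
    (hou : ∀ u : ℝ, -1 ≤ u → ‖Q (u + U * I)‖ ≤ C * Real.exp (m * u))
    (hol : ∀ u : ℝ, -1 ≤ u → ‖Q (u + (-U : ℝ) * I)‖ ≤ C * Real.exp (m * u))
    (hj : ∀ u : ℝ, u ≤ -1 → ‖Qp (u + Real.pi * I) - Qm (u + (-Real.pi : ℝ) * I)‖
      ≤ C * Real.exp (m * u)) :
    ∃ K, ∀ z ∈ puncturedSector α,
      ‖hook (fun w => Q w * Complex.exp (z * Complex.exp w)) (-1) (-U) U - 2 * Real.pi * I * L‖
        ≤ K * ‖z‖ ^ (-m) := by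
  obtain ⟨c, hc0, hc, -⟩ := exists_decay hα hU hU'
  have hπ := Real.pi_pos
  have hU0 : 0 ≤ U := by linarith
  have hC : 0 ≤ C := by
    have := (norm_nonneg _).trans (hou 0 (by norm_num))
    simpa using this
  obtain ⟨K₁, hK₁, hexp⟩ := exists_exp_neg_mul_le_rpow hm
    (show 0 < c * Real.exp (-1) by positivity)
  set G : ℝ := ∫ u : ℝ, Real.exp (m * u - c * Real.exp u) with hG
  refine ⟨C * G + C * G + C * G + (‖L‖ + C) * K₁ * |Real.pi - U|
    + (‖L‖ + C) * K₁ * |-U - -Real.pi|, fun z hz => ?_⟩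
  have hz0 := (exists_polar_of_mem_puncturedSector hz).1
  have hcz : 0 < c * ‖z‖ := by positivity
  -- integrals along rays on which `e^{z ζ}` decays
  have hray : ∀ (S : Set ℝ) (F : ℝ → ℂ) (y : ℝ), MeasurableSet S →
      (z * Complex.exp (y * I)).re ≤ -(c * ‖z‖) → (∀ u ∈ S, ‖F u‖ ≤ C * Real.exp (m * u)) →
      ‖∫ u in S, F u * Complex.exp (z * Complex.exp (u + y * I))‖ ≤ C * G * ‖z‖ ^ (-m) := by
    intro S F y hS hy hF
    have hi : Integrable fun u : ℝ => C * Real.exp (m * u - c * ‖z‖ * Real.exp u) :=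
      (integrable_exp_mul_sub_exp hm hcz).const_mul C
    calc _ ≤ ∫ u in S, C * Real.exp (m * u - c * ‖z‖ * Real.exp u) := by
          refine norm_integral_le_of_norm_le hi.integrableOn
            ((ae_restrict_mem hS).mono fun u hu => ?_)
          rw [norm_mul, sub_eq_add_neg, Real.exp_add, ← mul_assoc]
          exact mul_le_mul (hF u hu) (norm_exp_mul_exp_le hy) (norm_nonneg _) (by positivity)
      _ ≤ ∫ u, C * Real.exp (m * u - c * ‖z‖ * Real.exp u) :=
          setIntegral_le_integral hi (Eventually.of_forall fun u => by positivity)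
      _ = _ := by
          rw [integral_const_mul, integral_exp_mul_sub_exp hz0]
          ring
  have harc : ∀ (F : ℂ → ℂ) (a b : ℝ), a ≤ b →
      (∀ y ∈ Icc a b, (z * Complex.exp (y * I)).re ≤ -(c * ‖z‖)) →
      (∀ y ∈ Icc a b, ‖F ((-1 : ℝ) + y * I) - L‖ ≤ C * Real.exp ((-1) / 2)) →
      ‖∫ y in a..b, F ((-1 : ℝ) + y * I) * Complex.exp (z * Complex.exp ((-1 : ℝ) + y * I))‖
        ≤ (‖L‖ + C) * K₁ * |b - a| * ‖z‖ ^ (-m) := by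
    intro F a b hab hy hF
    have : ∀ y ∈ uIoc a b,
        ‖F ((-1 : ℝ) + y * I) * Complex.exp (z * Complex.exp ((-1 : ℝ) + y * I))‖
          ≤ (‖L‖ + C) * (K₁ * ‖z‖ ^ (-m)) := by
      intro y hy'
      rw [uIoc_of_le hab] at hy'
      have hy'' := Ioc_subset_Icc_self hy'
      have h1 : ‖F ((-1 : ℝ) + y * I)‖ ≤ ‖L‖ + C := by
        have h2 := norm_le_norm_sub_add (F ((-1 : ℝ) + y * I)) L
        have h3 : C * Real.exp ((-1) / 2) ≤ C :=
          mul_le_of_le_one_right hC (Real.exp_le_one_iff.2 (by norm_num))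
        linarith [hF y hy'']
      rw [norm_mul]
      refine mul_le_mul h1 ?_ (norm_nonneg _) (by positivity)
      refine (norm_exp_mul_exp_le (hy y hy'')).trans ?_
      have := hexp ‖z‖ hz0
      rwa [mul_right_comm] at this
    refine (intervalIntegral.norm_integral_le_of_norm_le_const this).trans (le_of_eq ?_)
    ring
  -- the exponential factor tends to `1` at `-∞`
  have hlim : ∀ (F : ℂ → ℂ) (w : ℂ), w.re ≤ -1 → ‖F w - L‖ ≤ C * Real.exp (w.re / 2) →
      ‖F w * Complex.exp (z * Complex.exp w) - L‖
        ≤ ((‖L‖ + C) * (‖z‖ * Real.exp ‖z‖) + C) * Real.exp (w.re / 2) := by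
    intro F w hw hF
    have h1 : Real.exp (w.re / 2) ≤ 1 := Real.exp_le_one_iff.2 (by linarith)
    have h2 : ‖F w‖ ≤ ‖L‖ + C := by
      have h2 := norm_le_norm_sub_add (F w) L
      have h3 : C * Real.exp (w.re / 2) ≤ C := mul_le_of_le_one_right hC h1
      linarith
    have h3 : ‖Complex.exp (z * Complex.exp w) - 1‖ ≤ ‖z‖ * Real.exp ‖z‖ * Real.exp (w.re / 2) := by
      refine (norm_exp_sub_one_le_mul _).trans ?_
      rw [norm_mul, Complex.norm_exp w]
      have h4 : Real.exp w.re ≤ Real.exp (w.re / 2) := Real.exp_le_exp.2 (by linarith)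
      have h5 : ‖z‖ * Real.exp w.re ≤ ‖z‖ := mul_le_of_le_one_right hz0.le (h4.trans h1)
      calc _ ≤ ‖z‖ * Real.exp (w.re / 2) * Real.exp ‖z‖ := by gcongr
        _ = _ := by ring
    have h4 : F w * Complex.exp (z * Complex.exp w) - L
        = F w * (Complex.exp (z * Complex.exp w) - 1) + (F w - L) := by ring
    rw [h4]
    refine (norm_add_le _ _).trans ?_
    rw [norm_mul, add_mul]
    refine add_le_add ?_ hF
    calc _ ≤ (‖L‖ + C) * (‖z‖ * Real.exp ‖z‖ * Real.exp (w.re / 2)) := by gcongr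
      _ = _ := by ring
  have hdiff : ∀ w : ℂ, DifferentiableAt ℂ (fun w => Complex.exp (z * Complex.exp w)) w :=
    fun w => by fun_prop
  have key := I_mul_integral_eq_jump (H := fun w => Q w * Complex.exp (z * Complex.exp w))
    (Hp := fun w => Qp w * Complex.exp (z * Complex.exp w))
    (Hm := fun w => Qm w * Complex.exp (z * Complex.exp w)) (s := -1) (U := U) (L := L)
    (C := (‖L‖ + C) * (‖z‖ * Real.exp ‖z‖) + C) hU0 hU'.le
    (fun w h1 h2 h3 => (hd w h1 h2 h3).mul (hdiff w))
    (fun w h1 h2 h3 => (hdp w h1 h2 h3).mul (hdiff w))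
    (fun w h1 h2 h3 => (hdm w h1 h2 h3).mul (hdiff w))
    (fun w h1 h2 h3 => hlim Q w h1 (hb w h1 h2 h3))
    (fun w h1 h2 h3 => hlim Qp w h1 (hbp w h1 h2 h3))
    (fun w h1 h2 h3 => hlim Qm w h1 (hbm w h1 h2 h3))
    (fun u hu => by simp only [hgp u hu]) (fun u hu => by simp only [hgm u hu])
  -- The exponential `e^{z e^w}` agrees on both sides of the cut `Im w = ± π`, so it factors out of
  -- the jump.
  have hπe : ∀ u : ℝ, Complex.exp (u + (-Real.pi : ℝ) * I) = Complex.exp (u + Real.pi * I) := by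
    intro u
    rw [← Complex.exp_periodic (u + (-Real.pi : ℝ) * I)]
    congr 1
    push_cast
    ring
  have hjump : (∫ u in Iic (-1 : ℝ), (Qp (u + Real.pi * I) * Complex.exp (z * Complex.exp (u + Real.pi * I))
        - Qm (u + (-Real.pi : ℝ) * I) * Complex.exp (z * Complex.exp (u + (-Real.pi : ℝ) * I))))
      = ∫ u in Iic (-1 : ℝ), (Qp (u + Real.pi * I) - Qm (u + (-Real.pi : ℝ) * I))
          * Complex.exp (z * Complex.exp (u + Real.pi * I)) := by
    refine integral_congr_ae (Eventually.of_forall fun u => ?_)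
    simp only [hπe]
    ring
  rw [hjump] at key
  have yU : U ∈ Icc U (2 * Real.pi - U) := ⟨le_rfl, by linarith⟩
  have b1 := hray (Ioi (-1)) (fun u => Q (u + U * I)) U measurableSet_Ioi
    (re_mul_exp_le_of_mem hc hz ⟨le_rfl, by linarith⟩) (fun u hu => hou u (le_of_lt hu))
  have b2 := hray (Ioi (-1)) (fun u => Q (u + (-U : ℝ) * I)) (-U) measurableSet_Ioi
    (re_mul_exp_le_of_mem' hc hz ⟨by linarith, le_rfl⟩) (fun u hu => hol u (le_of_lt hu))
  have b3 := hray (Iic (-1)) (fun u => Qp (u + Real.pi * I) - Qm (u + (-Real.pi : ℝ) * I)) Real.pi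
    measurableSet_Iic (re_mul_exp_le_of_mem hc hz ⟨hU'.le, by linarith⟩) (fun u hu => hj u hu)
  have b4 := harc Qp U Real.pi hU'.le
    (fun y hy => re_mul_exp_le_of_mem hc hz ⟨hy.1, by linarith [hy.2]⟩)
    (fun y hy => by
      have := hbp ((-1 : ℝ) + y * I) (by simp) (by simpa using hy.1) (by simpa using hy.2)
      simpa using this)
  have b5 := harc Qm (-Real.pi) (-U) (by linarith)
    (fun y hy => re_mul_exp_le_of_mem' hc hz ⟨by linarith [hy.1], hy.2⟩)
    (fun y hy => by
      have := hbm ((-1 : ℝ) + y * I) (by simp) (by simpa using hy.1) (by simpa using hy.2)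
      simpa using this)
  rw [hook, key]
  generalize (∫ u in Ioi (-1 : ℝ), Q (u + U * I) * Complex.exp (z * Complex.exp (u + U * I))) = x₁ at *
  generalize (∫ u in Ioi (-1 : ℝ), Q (u + (-U : ℝ) * I)
    * Complex.exp (z * Complex.exp (u + (-U : ℝ) * I))) = x₂ at *
  generalize (∫ u in Iic (-1 : ℝ), (Qp (u + Real.pi * I) - Qm (u + (-Real.pi : ℝ) * I))
          * Complex.exp (z * Complex.exp (u + Real.pi * I))) = x₃ at *
  generalize (∫ y in U..Real.pi, Qp ((-1 : ℝ) + y * I)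
    * Complex.exp (z * Complex.exp ((-1 : ℝ) + y * I))) = x₄ at *
  generalize (∫ y in (-Real.pi)..(-U), Qm ((-1 : ℝ) + y * I)
    * Complex.exp (z * Complex.exp ((-1 : ℝ) + y * I))) = x₅ at *
  have e : x₁ + (2 * Real.pi * I * L + x₃ - I * x₄ - I * x₅) - x₂ - 2 * Real.pi * I * L
      = x₁ - x₂ + x₃ - I * x₄ - I * x₅ := by ring
  rw [e]
  have n1 := norm_sub_le (x₁ - x₂ + x₃ - I * x₄) (I * x₅)
  have n2 := norm_sub_le (x₁ - x₂ + x₃) (I * x₄)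
  have n3 := norm_add_le (x₁ - x₂) x₃
  have n4 := norm_sub_le x₁ x₂
  rw [norm_mul, norm_I, one_mul] at n1 n2
  linarith

theorem hookIntegrable_mul_exp {Q : ℂ → ℂ} {s U m C : ℝ} (hU : 0 ≤ U) {z : ℂ} (hz : z ∈ decaySet U)
    (hcu : ∀ u : ℝ, s < u → ContinuousAt Q (u + U * I))
    (hcl : ∀ u : ℝ, s < u → ContinuousAt Q (u + (-U : ℝ) * I))
    (hca : ∀ y ∈ Icc (-U) U, ContinuousAt Q (s + y * I))
    (hQu : ∀ u : ℝ, s < u → ‖Q (u + U * I)‖ ≤ C * Real.exp (m * u))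
    (hQl : ∀ u : ℝ, s < u → ‖Q (u + (-U : ℝ) * I)‖ ≤ C * Real.exp (m * u)) :
    HookIntegrable (fun w => Q w * Complex.exp (z * Complex.exp w)) s (-U) U where
  lower := integrableOn_ray (neg_pos.2 hz.2) (by rw [neg_neg]) (fun u hu =>
    (ContinuousAt.comp (f := fun u : ℝ => (u + (-U : ℝ) * I : ℂ)) (hcl u hu)
      (by fun_prop)).continuousWithinAt) hQl
  upper := integrableOn_ray (neg_pos.2 hz.1) (by rw [neg_neg]) (fun u hu =>
    (ContinuousAt.comp (f := fun u : ℝ => (u + U * I : ℂ)) (hcu u hu)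
      (by fun_prop)).continuousWithinAt) hQu
  arc := by
    refine ContinuousOn.intervalIntegrable fun y hy => ?_
    rw [uIcc_of_le (by linarith)] at hy
    exact ((ContinuousAt.comp (f := fun y : ℝ => (s + y * I : ℂ)) (hca y hy)
      (by fun_prop)).mul (by fun_prop)).continuousWithinAt

/-! ### The residue at the pole. -/

/-- The pole of the symbol. -/
def beachPole : ℂ := (-(Real.pi / 2) : ℝ) * I

theorem exp_beachPole : Complex.exp beachPole = -I := by
  rw [beachPole]
  push_cast
  rw [neg_mul, Complex.exp_neg, Complex.exp_pi_div_two_mul_I, inv_I]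

theorem beachPole_re : beachPole.re = 0 := by simp [beachPole]

theorem beachPole_im : beachPole.im = -(Real.pi / 2) := by simp [beachPole]

theorem exp_add_I_ne_zero_of_ne {U : ℝ} (hU : U < Real.pi) {w : ℂ} (hw : |w.im| ≤ U)
    (h : w ≠ beachPole) : Complex.exp w + I ≠ 0 := by
  intro h0
  have hw' := abs_le.1 hw
  have h1 : w.im = -(Real.pi / 2) := by
    by_contra h2
    exact exp_add_I_ne_zero_of_im (by linarith [Real.pi_pos]) (by linarith [Real.pi_pos]) h2 h0
  exact h (Complex.ext (by rw [(exp_add_I_eq_zero h0).1, beachPole_re]) (by rw [h1, beachPole_im]))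

/-- Adding `i` does not change the real part, and in these directions `|Re ζ| ≥ |ζ| sin (U - π/2)`.
-/
theorem norm_exp_div_exp_add_I_le {U x y : ℝ} (hU : Real.pi / 2 < U) (hU' : U < Real.pi)
    (hy : y ∈ Icc U (2 * Real.pi - U)) :
    Complex.exp (x + y * I) + I ≠ 0 ∧
    ‖Complex.exp (x + y * I) / (Complex.exp (x + y * I) + I)‖
      ≤ (Real.sin (U - Real.pi / 2))⁻¹ := by
  have hs : 0 < Real.sin (U - Real.pi / 2) :=
    Real.sin_pos_of_pos_of_lt_pi (by linarith) (by linarith)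
  have h1 := cos_le_neg_of_mem (η := U - Real.pi / 2) (x := y) (by linarith) (by linarith [hy.1])
    (by linarith [hy.2])
  have h2 : (Complex.exp (x + y * I) + I).re = Real.exp x * Real.cos y := by
    rw [add_re, Complex.exp_re]
    simp
  have h3 : Real.exp x * Real.sin (U - Real.pi / 2) ≤ ‖Complex.exp (x + y * I) + I‖ := by
    refine le_trans ?_ (abs_re_le_norm _)
    rw [h2, abs_mul, abs_of_pos (Real.exp_pos x)]
    gcongr
    exact le_abs.2 (Or.inr (by linarith))
  have h4 : 0 < Real.exp x * Real.sin (U - Real.pi / 2) := by positivity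
  refine ⟨norm_pos_iff.1 (h4.trans_le h3), ?_⟩
  rw [norm_div, Complex.norm_exp (x + y * I)]
  have h5 : ((x : ℂ) + y * I).re = x := by simp
  rw [h5, div_le_iff₀ (h4.trans_le h3), inv_mul_eq_div, le_div_iff₀ hs]
  exact h3

theorem circleIntegral_exp_div_add_I_of_gt (z : ℂ) {R : ℝ} (hR : 1 < R) :
    ∮ ζ in C(0, R), Complex.exp (z * ζ) / (ζ + I) = 2 * Real.pi * I * Complex.exp (-(I * z)) := by
  have h : DiffContOnCl ℂ (fun ζ : ℂ => Complex.exp (z * ζ)) (Metric.ball 0 R) :=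
    (by fun_prop : Differentiable ℂ fun ζ : ℂ => Complex.exp (z * ζ)).diffContOnCl
  have h2 := h.circleIntegral_sub_inv_smul (w := -I) (by simpa using hR)
  simp only [sub_neg_eq_add, smul_eq_mul] at h2
  rw [show (-(I * z)) = z * -I by ring, ← h2]
  congr 1 with ζ
  rw [div_eq_inv_mul]

theorem circleIntegral_exp_div_add_I_of_lt (z : ℂ) {R : ℝ} (hR0 : 0 ≤ R) (hR : R < 1) :
    ∮ ζ in C(0, R), Complex.exp (z * ζ) / (ζ + I) = 0 := by
  have hne : ∀ ζ ∈ Metric.closedBall (0 : ℂ) R, ζ + I ≠ 0 := by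
    intro ζ hζ h0
    rw [mem_closedBall_zero_iff, eq_neg_of_add_eq_zero_left h0, norm_neg, norm_I] at hζ
    linarith
  refine Complex.circleIntegral_eq_zero_of_differentiable_on_off_countable hR0 countable_empty ?_ ?_
  · exact ContinuousOn.div (by fun_prop) (by fun_prop) hne
  · intro ζ hζ
    exact DifferentiableAt.div (by fun_prop) (by fun_prop) (hne ζ (Metric.ball_subset_closedBall hζ.1))

/-- The model symbol depends on `e^w` only, so its contour closes to a circle; the radius decides
whether the pole `ζ = -i` is enclosed. -/
theorem hook_exp_div_exp_add_I {α U : ℝ} (hα : 0 < α)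
    (hU : Real.pi / 2 + α < U) (hU' : U < Real.pi) {z : ℂ} (hz : z ∈ puncturedSector α)
    {s : ℝ} (hs : s ≠ 0) :
    hook (fun w => Complex.exp w / (Complex.exp w + I) * Complex.exp (z * Complex.exp w)) s (-U) U
      = ∮ ζ in C(0, Real.exp s), Complex.exp (z * ζ) / (ζ + I) := by
  obtain ⟨c, hc0, hc, -⟩ := exists_decay hα hU hU'
  have hz0 := (exists_polar_of_mem_puncturedSector hz).1
  have hcz : 0 < c * ‖z‖ := by positivity
  rw [← hook_eq_circleIntegral (q := fun ζ => Complex.exp (z * ζ) / (ζ + I)) (s := s) (U := U)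
    (B := fun x => (Real.sin (U - Real.pi / 2))⁻¹ * Real.exp (0 * x - c * ‖z‖ * Real.exp x)) hU']
  · congr 1 with w
    ring
  · intro w h1 h2 h3
    have h4 := (norm_exp_div_exp_add_I_le (x := w.re) (y := w.im) (by linarith) hU' ⟨h2, h3⟩).1
    rw [re_add_im] at h4
    exact DifferentiableAt.div (by fun_prop) (by fun_prop) h4
  · intro x _ y hy
    have h4 := (norm_exp_div_exp_add_I_le (x := x) (y := y) (by linarith) hU' hy).2
    have h5 := norm_exp_mul_exp_le (u := x) (re_mul_exp_le_of_mem hc hz hy)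
    rw [div_mul_eq_mul_div, mul_comm, mul_div_right_comm, norm_mul, zero_mul, zero_sub]
    gcongr
    exact inv_nonneg.2 (Real.sin_nonneg_of_nonneg_of_le_pi (by linarith) (by linarith))
  · exact (integrableOn_exp_mul_sub_exp 0 hcz s).const_mul _
  · simpa using (tendsto_exp_mul_sub_exp 0 hcz).const_mul (Real.sin (U - Real.pi / 2))⁻¹
  · refine Continuous.div (by fun_prop) (by fun_prop) fun y => ?_
    exact exp_add_I_ne_zero_of_re (by simpa using hs)

/-- The residue of the contour integral at the pole of the symbol. -/
theorem hook_one_sub_hook_neg_one {A : ℂ → ℂ} {α U V m C : ℝ} (hα : 0 < α)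
    (hU : Real.pi / 2 + α < U) (hU' : U < Real.pi) (hUV : U < V)
    (hA : ∀ w : ℂ, |w.im| < V → DifferentiableAt ℂ A w)
    (hAu : ∀ u : ℝ, -1 ≤ u → ‖A (u + U * I) / (Complex.exp (u + U * I) + I)‖ ≤ C * Real.exp (m * u))
    (hAl : ∀ u : ℝ, -1 ≤ u → ‖A (u + (-U : ℝ) * I) / (Complex.exp (u + (-U : ℝ) * I) + I)‖
      ≤ C * Real.exp (m * u))
    {z : ℂ} (hz : z ∈ puncturedSector α) :
    hook (fun w => A w / (Complex.exp w + I) * Complex.exp (z * Complex.exp w)) 1 (-U) U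
      - hook (fun w => A w / (Complex.exp w + I) * Complex.exp (z * Complex.exp w)) (-1) (-U) U
      = -(2 * Real.pi * A beachPole * Complex.exp (-(I * z))) := by
  have hπ := Real.pi_pos
  have hU0 : 0 < U := by linarith
  have hzd := puncturedSector_subset_decaySet hα hU hU' hz
  -- At the pole `e^w = -i`, so `a e^w` takes the value of `A` there and `F` vanishes. The part `a
  -- e^w` is the model symbol, integrated over circles of radius `e` and `1/e` on the two sides of
  -- the pole; the part `F` contributes nothing to the difference.
  set a : ℂ := I * A beachPole with ha
  set F : ℂ → ℂ := fun w => A w - a * Complex.exp w with hF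
  have hF0 : F beachPole = 0 := by
    simp only [hF, ha, exp_beachPole]
    linear_combination A beachPole * I_sq
  -- A quotient of divided differences at the pole, equal to `F / (e^w + i)` elsewhere and
  -- holomorphic through it.
  set G : ℂ → ℂ := fun w => dslope F beachPole w / dslope Complex.exp beachPole w with hG
  have hstrip : IsOpen {w : ℂ | |w.im| < V} := isOpen_lt (by fun_prop) continuous_const
  have hmem : {w : ℂ | |w.im| < V} ∈ 𝓝 beachPole := hstrip.mem_nhds (by
    show |beachPole.im| < V
    rw [beachPole_im, abs_neg, abs_of_pos (by linarith)]
    linarith)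
  have hFd : DifferentiableOn ℂ F {w : ℂ | |w.im| < V} := fun w hw =>
    ((hA w hw).sub (by fun_prop)).differentiableWithinAt
  have hFs := (Complex.differentiableOn_dslope hmem).2 hFd
  have hEs := (Complex.differentiableOn_dslope (f := Complex.exp) hmem).2
    Complex.differentiable_exp.differentiableOn
  have hne : ∀ w : ℂ, |w.im| ≤ U → dslope Complex.exp beachPole w ≠ 0 := by
    intro w hw
    rcases eq_or_ne w beachPole with rfl | h
    · rw [dslope_same, Complex.deriv_exp]
      exact Complex.exp_ne_zero _
    · rw [dslope_of_ne _ h, slope_def_field, exp_beachPole, sub_neg_eq_add]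
      exact div_ne_zero (exp_add_I_ne_zero_of_ne hU' hw h) (sub_ne_zero.2 h)
  have hGd : ∀ w : ℂ, |w.im| ≤ U → DifferentiableAt ℂ G w := by
    intro w hw
    have hw' : {w : ℂ | |w.im| < V} ∈ 𝓝 w := hstrip.mem_nhds (lt_of_le_of_lt hw hUV)
    exact (hFs.differentiableAt hw').div (hEs.differentiableAt hw') (hne w hw)
  have hGeq : ∀ w : ℂ, w ≠ beachPole → G w = F w / (Complex.exp w + I) := by
    intro w h
    simp only [hG]
    rw [dslope_of_ne _ h, dslope_of_ne _ h, slope_def_field, slope_def_field, exp_beachPole, hF0,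
      sub_neg_eq_add, sub_zero, div_div_div_cancel_right₀ (sub_ne_zero.2 h)]
  have nu : ∀ u : ℝ, (u + U * I : ℂ) ≠ beachPole := fun u h => by
    have := congrArg im h
    rw [beachPole_im] at this
    simp at this
    linarith
  have nl : ∀ u : ℝ, (u + (-U : ℝ) * I : ℂ) ≠ beachPole := fun u h => by
    have := congrArg im h
    rw [beachPole_im] at this
    simp at this
    linarith
  have ns : ∀ s y : ℝ, s ≠ 0 → (s + y * I : ℂ) ≠ beachPole := fun s y hs h => hs (by
    have := congrArg re h
    rw [beachPole_re] at this
    simpa using this)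
  have iu : ∀ u : ℝ, |(u + U * I : ℂ).im| ≤ U := fun u => by simp [abs_of_pos hU0]
  have il : ∀ u : ℝ, |(u + (-U : ℝ) * I : ℂ).im| ≤ U := fun u => by simp [abs_of_pos hU0]
  have is : ∀ s : ℝ, ∀ y ∈ Icc (-U) U, |(s + y * I : ℂ).im| ≤ U := fun s y hy => by
    simpa [abs_le] using hy
  -- the numerator is split into its value at the pole and a part vanishing there
  have hN : ∀ (M : ℂ → ℂ) (C' m' s : ℝ), s ≠ 0 → -1 ≤ s →
      (∀ w : ℂ, |w.im| ≤ U → ContinuousAt M w) →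
      (∀ u : ℝ, -1 ≤ u → ‖M (u + U * I) / (Complex.exp (u + U * I) + I)‖ ≤ C' * Real.exp (m' * u)) →
      (∀ u : ℝ, -1 ≤ u → ‖M (u + (-U : ℝ) * I) / (Complex.exp (u + (-U : ℝ) * I) + I)‖
        ≤ C' * Real.exp (m' * u)) →
      HookIntegrable (fun w => M w / (Complex.exp w + I) * Complex.exp (z * Complex.exp w))
        s (-U) U := by
    intro M C' m' s hs hs1 hM hMu hMl
    have hcont : ∀ w : ℂ, |w.im| ≤ U → w ≠ beachPole →
        ContinuousAt (fun w => M w / (Complex.exp w + I)) w := fun w h1 h2 =>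
      (hM w h1).div (by fun_prop) (exp_add_I_ne_zero_of_ne hU' h1 h2)
    exact hookIntegrable_mul_exp hU0.le hzd (fun u _ => hcont _ (iu u) (nu u))
      (fun u _ => hcont _ (il u) (nl u)) (fun y hy => hcont _ (is s y hy) (ns s y hs))
      (fun u hu => hMu u (hs1.trans hu.le)) (fun u hu => hMl u (hs1.trans hu.le))
  have hEu : ∀ u : ℝ, -1 ≤ u → ‖a * Complex.exp (u + U * I) / (Complex.exp (u + U * I) + I)‖
      ≤ ‖a‖ * (Real.sin (U - Real.pi / 2))⁻¹ * Real.exp (0 * u) := by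
    intro u _
    rw [zero_mul, Real.exp_zero, mul_one, mul_div_assoc, norm_mul]
    gcongr
    exact (norm_exp_div_exp_add_I_le (by linarith) hU' ⟨le_rfl, by linarith⟩).2
  have hEl : ∀ u : ℝ, -1 ≤ u → ‖a * Complex.exp (u + (-U : ℝ) * I)
      / (Complex.exp (u + (-U : ℝ) * I) + I)‖
      ≤ ‖a‖ * (Real.sin (U - Real.pi / 2))⁻¹ * Real.exp (0 * u) := by
    intro u _
    have e : Complex.exp (u + (-U : ℝ) * I) = Complex.exp (u + (2 * Real.pi - U : ℝ) * I) := by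
      rw [← Complex.exp_periodic (u + (-U : ℝ) * I)]
      congr 1
      push_cast
      ring
    rw [zero_mul, Real.exp_zero, mul_one, mul_div_assoc, norm_mul, e]
    gcongr
    exact (norm_exp_div_exp_add_I_le (by linarith) hU' ⟨by linarith, le_rfl⟩).2
  have hsplit : ∀ s : ℝ, s ≠ 0 → -1 ≤ s →
      hook (fun w => A w / (Complex.exp w + I) * Complex.exp (z * Complex.exp w)) s (-U) U
      = a * (∮ ζ in C(0, Real.exp s), Complex.exp (z * ζ) / (ζ + I))
        + hook (fun w => G w * Complex.exp (z * Complex.exp w)) s (-U) U := by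
    intro s hs hs1
    have i1 := hN A C m s hs hs1 (fun w hw => (hA w (hw.trans_lt hUV)).continuousAt) hAu hAl
    have i2 := hN (fun w => a * Complex.exp w) _ 0 s hs hs1 (fun w _ => by fun_prop) hEu hEl
    have i3 : HookIntegrable (fun w => F w / (Complex.exp w + I)
        * Complex.exp (z * Complex.exp w)) s (-U) U := by
      have e : (fun w => F w / (Complex.exp w + I) * Complex.exp (z * Complex.exp w))
          = fun w => A w / (Complex.exp w + I) * Complex.exp (z * Complex.exp w)
            - a * Complex.exp w / (Complex.exp w + I) * Complex.exp (z * Complex.exp w) := by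
        ext w
        simp only [hF]
        ring
      rw [e]
      exact ⟨i1.lower.sub i2.lower, i1.upper.sub i2.upper, i1.arc.sub i2.arc⟩
    have h1 := hook_fun_add i2 i3
    have h2 : hook (fun w => G w * Complex.exp (z * Complex.exp w)) s (-U) U
        = hook (fun w => F w / (Complex.exp w + I) * Complex.exp (z * Complex.exp w)) s (-U) U :=
      hook_congr (by linarith) (fun u _ => by rw [hGeq _ (nl u)]) (fun u _ => by rw [hGeq _ (nu u)])
        (fun y _ => by rw [hGeq _ (ns s y hs)])
    rw [h2, ← hook_exp_div_exp_add_I hα hU hU' hz hs, ← hook_const_mul]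
    have h3 : (fun w => a * (Complex.exp w / (Complex.exp w + I) * Complex.exp (z * Complex.exp w)))
        = fun w => a * Complex.exp w / (Complex.exp w + I) * Complex.exp (z * Complex.exp w) := by
      ext w
      ring
    rw [h3, ← h1]
    congr 1 with w
    simp only [hF]
    ring
  have hGG : hook (fun w => G w * Complex.exp (z * Complex.exp w)) (-1) (-U) U
      = hook (fun w => G w * Complex.exp (z * Complex.exp w)) 1 (-U) U := by
    have i1 := hN A C m 1 one_ne_zero (by norm_num)
      (fun w hw => (hA w (hw.trans_lt hUV)).continuousAt) hAu hAl
    have i2 := hN (fun w => a * Complex.exp w) _ 0 1 one_ne_zero (by norm_num)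
      (fun w _ => by fun_prop) hEu hEl
    refine hook_eq_hook (by linarith) (by norm_num)
      (fun w _ _ h3 h4 => (hGd w (abs_le.2 ⟨h3, h4⟩)).mul (by fun_prop)) ?_ ?_
    · refine (i1.lower.sub i2.lower).congr_fun (fun u _ => ?_) measurableSet_Ioi
      simp only [hGeq _ (nl u), hF, Pi.sub_apply]
      ring
    · refine (i1.upper.sub i2.upper).congr_fun (fun u _ => ?_) measurableSet_Ioi
      simp only [hGeq _ (nu u), hF, Pi.sub_apply]
      ring
  rw [hsplit 1 one_ne_zero (by norm_num), hsplit (-1) (by norm_num) le_rfl, hGG,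
    circleIntegral_exp_div_add_I_of_gt z (Real.one_lt_exp_iff.2 one_pos),
    circleIntegral_exp_div_add_I_of_lt z (Real.exp_pos _).le (Real.exp_lt_one_iff.2 (by norm_num)), ha]
  linear_combination 2 * Real.pi * A beachPole * Complex.exp (-(I * z)) * I_sq

/-! ### The contour integral for large `z`. -/

theorem norm_exp_ofReal_mul (p : ℝ) (w : ℂ) : ‖Complex.exp (p * w)‖ = Real.exp (p * w.re) := by
  rw [Complex.norm_exp, re_ofReal_mul]

theorem exists_beachT_le {α μ U : ℝ} (h : BeachParams α μ U) :
    ∃ C, 0 ≤ C ∧ ∀ w : ℂ, 1 ≤ w.re → |w.im| ≤ U → ‖beachT μ w‖ ≤ C * Real.exp (-(μ * w.re)) := by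
  obtain ⟨κ, hκ⟩ := exists_beachT_mul_exp_sub_isBigO h
  obtain ⟨K, hK⟩ := isBigO_principal.1 hκ
  refine ⟨‖κ‖ + |K|, by positivity, fun w hw hw' => ?_⟩
  have h1 := hK w ⟨hw, hw'⟩
  have h2 : K * ‖Real.exp (-(w.re / 2))‖ ≤ |K| := by
    rw [Real.norm_of_nonneg (Real.exp_pos _).le]
    calc _ ≤ |K| * Real.exp (-(w.re / 2)) := by gcongr; exact le_abs_self K
      _ ≤ |K| * 1 := by
        gcongr
        exact Real.exp_le_one_iff.2 (by linarith)
      _ = |K| := mul_one _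
  have h3 := norm_le_norm_sub_add (beachT μ w * Complex.exp (μ * w)) κ
  rw [norm_mul, norm_exp_ofReal_mul] at h3
  rw [Real.exp_neg, ← div_eq_mul_inv, le_div_iff₀ (Real.exp_pos _)]
  linarith

theorem BeachParams.exp_add_I_ne_zero {α μ U : ℝ} (h : BeachParams α μ U) {σ : ℝ} (hσ : |σ| = 1)
    (u : ℝ) : Complex.exp (u + (σ * U : ℝ) * I) + I ≠ 0 := by
  have h1 := h.lt_U
  have h2 := h.U_lt_pi
  have h3 := h.pos
  have hπ := Real.pi_pos
  have e : ((u : ℂ) + (σ * U : ℝ) * I).im = σ * U := by simp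
  rcases (abs_eq zero_le_one).1 hσ with rfl | rfl
  · exact exp_add_I_ne_zero_of_im (by rw [e]; linarith) (by rw [e]; linarith)
      (by rw [e]; intro h; linarith)
  · exact exp_add_I_ne_zero_of_im (by rw [e]; linarith) (by rw [e]; linarith)
      (by rw [e]; intro h; linarith)

theorem BeachParams.differentiableAt_beachT_ray {α μ U : ℝ} (h : BeachParams α μ U) {σ : ℝ}
    (hσ : |σ| = 1) (u : ℝ) : DifferentiableAt ℂ (beachT μ) (u + (σ * U : ℝ) * I) := by
  refine differentiableAt_beachT h.one_lt ?_ (h.exp_add_I_ne_zero hσ u)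
  have e : ((u : ℂ) + (σ * U : ℝ) * I).im = σ * U := by simp
  rw [e, abs_mul, hσ, one_mul]
  exact h.abs_U_lt

theorem BeachParams.differentiableAt_beachT_of_re {α μ U : ℝ} (h : BeachParams α μ U) {w : ℂ}
    (hw : w.re ≠ 0) (hw' : |w.im| ≤ U) : DifferentiableAt ℂ (beachT μ) w :=
  differentiableAt_beachT h.one_lt ((hw'.trans (le_abs_self U)).trans_lt h.abs_U_lt)
    (exp_add_I_ne_zero_of_re hw)

theorem exists_beachT_ray_le {α μ U : ℝ} (h : BeachParams α μ U) :
    ∃ C, 0 ≤ C ∧ ∀ σ : ℝ, |σ| = 1 → ∀ u : ℝ, -1 ≤ u → ‖beachT μ (u + (σ * U : ℝ) * I)‖ ≤ C := by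
  obtain ⟨C, hC, hb⟩ := exists_beachT_le h
  have hcpt : ∀ σ : ℝ, |σ| = 1 → ∃ K, ∀ u ∈ Icc (-1 : ℝ) 1,
      ‖beachT μ (u + (σ * U : ℝ) * I)‖ ≤ K := fun σ hσ => by
    refine isCompact_Icc.exists_bound_of_continuousOn fun u _ => ?_
    exact (ContinuousAt.comp (f := fun u : ℝ => (u + (σ * U : ℝ) * I : ℂ))
      (h.differentiableAt_beachT_ray hσ u).continuousAt (by fun_prop)).continuousWithinAt
  obtain ⟨K₁, h1⟩ := hcpt 1 (by simp)
  obtain ⟨K₂, h2⟩ := hcpt (-1) (by simp)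
  have hK₁ : 0 ≤ K₁ := (norm_nonneg _).trans (h1 0 (by simp))
  have hK₂ : 0 ≤ K₂ := (norm_nonneg _).trans (h2 0 (by simp))
  refine ⟨C + K₁ + K₂, by positivity, fun σ hσ u hu => ?_⟩
  rcases le_total u 1 with h3 | h3
  · rcases (abs_eq zero_le_one).1 hσ with rfl | rfl
    · linarith [h1 u ⟨hu, h3⟩]
    · linarith [h2 u ⟨hu, h3⟩]
  · have h4 := hb (u + (σ * U : ℝ) * I) (by simpa using h3)
      (by simp [abs_mul, hσ, abs_of_pos h.U_pos])
    have h5 : C * Real.exp (-(μ * ((u : ℂ) + (σ * U : ℝ) * I).re)) ≤ C := by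
      refine mul_le_of_le_one_right hC (Real.exp_le_one_iff.2 ?_)
      simp
      have := h.one_lt
      nlinarith
    linarith

/-- The exponents that occur are `l + k` with `l = 0` or `l ≥ 1`: either the limit at `-∞` survives
unchanged, or `e^{p w}` forces it to zero at least at the rate of the given error. -/
theorem norm_mul_exp_sub_le {C p : ℝ} {t l w : ℂ} (hC : 0 ≤ C)
    (hp : p = 0 ∨ 1 ≤ p) (hw : w.re ≤ 0) (ht : ‖t - l‖ ≤ C * Real.exp (w.re / 2)) :
    ‖t * Complex.exp (p * w) - (if p = 0 then l else 0)‖ ≤ (‖l‖ + C) * Real.exp (w.re / 2) := by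
  rcases hp with rfl | hp
  · simp only [ofReal_zero, zero_mul, Complex.exp_zero, mul_one, if_true, add_mul]
    have : 0 ≤ ‖l‖ * Real.exp (w.re / 2) := by positivity
    linarith
  · rw [if_neg (by linarith), sub_zero, norm_mul, norm_exp_ofReal_mul]
    have h1 : Real.exp (w.re / 2) ≤ 1 := Real.exp_le_one_iff.2 (by linarith)
    have h2 : ‖t‖ ≤ ‖l‖ + C := by
      have h2 := norm_le_norm_sub_add t l
      have h3 : C * Real.exp (w.re / 2) ≤ C := mul_le_of_le_one_right hC h1
      linarith
    gcongr
    nlinarith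

/-- The contour integral whose real part solves the sloping beach problem, and its derivatives. -/
def beachF (μ U l : ℝ) (k : ℕ) (z : ℂ) : ℂ :=
  hook (fun w => beachT μ w * Complex.exp ((l + k : ℝ) * w) * Complex.exp (z * Complex.exp w))
    1 (-U) U

/-- Moving the segment from `Re w = 1` to `Re w = -1` releases the wave, and `exists_hook_sub_le`
treats the rest. The two problems differ only in the size of the jump, supplied through `hj`; the
bound offered to `hj` as a premise comes from the asymptotics of the continuation. -/
theorem exists_beachF_sub_le {α μ U l ν : ℝ} (h : BeachParams α μ U) (hl : l = 0 ∨ 1 ≤ l)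
    (hν : 0 < ν) (hlν : l ≤ ν)
    (hj : ∀ c : ℝ, (∀ σ : ℝ, (σ = 1 ∨ σ = -1) → ∃ C, ∀ u : ℝ, u ≤ -1 →
      ‖beachText μ c σ (u + (σ * Real.pi : ℝ) * I)‖ ≤ C) → ∃ C : ℝ, ∀ u : ℝ, u ≤ -1 →
      ‖beachText μ c 1 (u + Real.pi * I) * Complex.exp (l * (u + Real.pi * I))
        - beachText μ c (-1) (u + (-Real.pi : ℝ) * I) * Complex.exp (l * (u + (-Real.pi : ℝ) * I))‖
        ≤ C * Real.exp (ν * u)) :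
    ∃ C₁ : ℝ, ∀ k : ℕ, ∃ K : ℝ, ∀ z ∈ puncturedSector α,
      ‖beachF μ U l k z + 2 * Real.pi * (beachB μ beachPole * Complex.exp ((l + k : ℝ) * beachPole))
          * Complex.exp (-(I * z)) - 2 * Real.pi * I * (if l + k = 0 then C₁ * -I else 0)‖
        ≤ K * ‖z‖ ^ (-(ν + k)) := by
  obtain ⟨c, C₁, hT, hText⟩ := exists_beachT_sub_isBigO h
  have hTb : ∀ σ : ℝ, (σ = 1 ∨ σ = -1) → ∃ C, ∀ u : ℝ, u ≤ -1 →
      ‖beachText μ c σ (u + (σ * Real.pi : ℝ) * I)‖ ≤ C := fun σ hσ => by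
    obtain ⟨K, hK⟩ := isBigO_principal.1 (hText σ hσ).2
    refine ⟨|K| + ‖(C₁ * -I : ℂ)‖, fun u hu => ?_⟩
    have h1 := hK (u + (σ * Real.pi : ℝ) * I) ⟨by simpa using hu, by
      simpa using h.U_lt_pi.le⟩
    have h2 := norm_le_norm_sub_add (beachText μ c σ (u + (σ * Real.pi : ℝ) * I)) (C₁ * -I)
    have h3 : K * ‖Real.exp (((u : ℂ) + (σ * Real.pi : ℝ) * I).re / 2)‖ ≤ |K| := by
      rw [Real.norm_of_nonneg (Real.exp_pos _).le]
      calc _ ≤ |K| * Real.exp (((u : ℂ) + (σ * Real.pi : ℝ) * I).re / 2) := by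
            gcongr; exact le_abs_self K
        _ ≤ |K| * 1 := by
          gcongr
          exact Real.exp_le_one_iff.2 (by simp; linarith)
        _ = |K| := mul_one _
    linarith
  obtain ⟨Cj, hj⟩ := hj c hTb
  obtain ⟨Cr, hCr, hray⟩ := exists_beachT_ray_le h
  obtain ⟨Ka, hKa⟩ := isBigO_principal.1 hT
  obtain ⟨gp, hp⟩ := hText 1 (Or.inl rfl)
  obtain ⟨gm, hm⟩ := hText (-1) (Or.inr rfl)
  obtain ⟨Kp, hKp⟩ := isBigO_principal.1 hp
  obtain ⟨Km, hKm⟩ := isBigO_principal.1 hm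
  have hπ := Real.pi_pos
  have hU0 := h.U_pos
  have hU1 := h.lt_U
  have hU2 := h.U_lt_pi
  have hα := h.pos
  have hμ := h.one_lt
  refine ⟨C₁, fun k => ?_⟩
  set p : ℝ := l + k with hpdef
  have hk0 : (0 : ℝ) ≤ k := Nat.cast_nonneg k
  have hl0 : 0 ≤ l := by rcases hl with h | h <;> linarith
  have hp01 : p = 0 ∨ 1 ≤ p := by
    rcases Nat.eq_zero_or_pos k with hk | hk
    · subst hk
      simpa [hpdef] using hl
    · have : (1 : ℝ) ≤ k := by exact_mod_cast hk
      exact Or.inr (by rw [hpdef]; linarith)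
  set M : ℝ := |Ka| + |Kp| + |Km| with hM
  have hM0 : 0 ≤ M := by positivity
  set L₀ : ℂ := C₁ * -I with hL₀
  -- The three summands control the symbol near `-∞`, the symbol on the rays `Re w ≥ -1`, and the
  -- jump. The factor `e^{ν - l}` arises since `(l + k) u ≤ (ν - l) + (ν + k) u` for `u ≥ -1`.
  set C : ℝ := (‖L₀‖ + M) + Cr * Real.exp (ν - l) + |Cj| with hC
  have hC1 : ‖L₀‖ + M ≤ C := by
    rw [hC]
    have : 0 ≤ Cr * Real.exp (ν - l) := by positivity
    linarith [abs_nonneg Cj]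
  have hC2 : Cr * Real.exp (ν - l) ≤ C := by
    rw [hC]
    linarith [abs_nonneg Cj, norm_nonneg L₀]
  have hC3 : Cj ≤ C := by
    rw [hC]
    have : 0 ≤ Cr * Real.exp (ν - l) := by positivity
    linarith [le_abs_self Cj, norm_nonneg L₀]
  -- the asymptotics at `-∞` on the three sheets
  have hasym : ∀ (F : ℂ → ℂ) (K : ℝ) (w : ℂ), |K| ≤ M → w.re ≤ -1 →
      ‖F w - L₀‖ ≤ K * ‖Real.exp (w.re / 2)‖ →
      ‖F w * Complex.exp (p * w) - (if p = 0 then L₀ else 0)‖ ≤ C * Real.exp (w.re / 2) := by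
    intro F K w hK hw hF
    rw [Real.norm_of_nonneg (Real.exp_pos _).le] at hF
    have h1 : ‖F w - L₀‖ ≤ M * Real.exp (w.re / 2) :=
      hF.trans (by gcongr; exact (le_abs_self K).trans hK)
    exact (norm_mul_exp_sub_le hM0 hp01 (by linarith) h1).trans (by gcongr)
  have hrayQ : ∀ σ : ℝ, |σ| = 1 → ∀ u : ℝ, -1 ≤ u →
      ‖beachT μ (u + (σ * U : ℝ) * I) * Complex.exp (p * (u + (σ * U : ℝ) * I))‖
        ≤ C * Real.exp ((ν + k) * u) := by
    intro σ hσ u hu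
    rw [norm_mul, norm_exp_ofReal_mul]
    have e : ((u : ℂ) + (σ * U : ℝ) * I).re = u := by simp
    rw [e]
    calc _ ≤ Cr * Real.exp (p * u) := by gcongr; exact hray σ hσ u hu
      _ ≤ Cr * (Real.exp (ν - l) * Real.exp ((ν + k) * u)) := by
          rw [← Real.exp_add]
          gcongr
          rw [hpdef]
          nlinarith
      _ = Cr * Real.exp (ν - l) * Real.exp ((ν + k) * u) := by ring
      _ ≤ _ := by gcongr
  have hdexp : ∀ w : ℂ, DifferentiableAt ℂ (fun w => Complex.exp (p * w)) w := fun w => by fun_prop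
  have e1 : ∀ u : ℝ, (u : ℂ) + U * I = u + (1 * U : ℝ) * I := fun u => by simp
  have e2 : ∀ u : ℝ, (u : ℂ) + (-U : ℝ) * I = u + (-1 * U : ℝ) * I := fun u => by simp
  have him : ∀ (σ : ℝ) (w : ℂ), (w - σ * (Real.pi * I)).im = w.im - σ * Real.pi := fun σ w => by
    simp
  obtain ⟨K, hK⟩ := exists_hook_sub_le (Q := fun w => beachT μ w * Complex.exp (p * w))
    (Qp := fun w => beachText μ c 1 w * Complex.exp (p * w))
    (Qm := fun w => beachText μ c (-1) w * Complex.exp (p * w)) (C := C) (m := ν + k)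
    (L := if p = 0 then L₀ else 0) hα hU1 hU2 (by linarith)
    (fun w h1 h2 h3 =>
      (h.differentiableAt_beachT_of_re (by linarith) (abs_le.2 ⟨h2, h3⟩)).mul (hdexp w))
    (fun w h1 h2 h3 => (differentiableAt_beachText h c (by linarith)
      (by rw [him]; exact abs_le.2 ⟨by linarith, by linarith⟩)).mul (hdexp w))
    (fun w h1 h2 h3 => (differentiableAt_beachText h c (by linarith)
      (by rw [him]; exact abs_le.2 ⟨by linarith, by linarith⟩)).mul (hdexp w))
    (fun w h1 h2 h3 => hasym _ Ka w (by rw [hM]; linarith [abs_nonneg Kp, abs_nonneg Km]) h1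
      (hKa w ⟨h1, abs_le.2 ⟨h2, h3⟩⟩))
    (fun w h1 h2 h3 => hasym _ Kp w (by rw [hM]; linarith [abs_nonneg Ka, abs_nonneg Km]) h1
      (hKp w ⟨h1, by rw [him]; exact abs_le.2 ⟨by linarith, by linarith⟩⟩))
    (fun w h1 h2 h3 => hasym _ Km w (by rw [hM]; linarith [abs_nonneg Ka, abs_nonneg Kp]) h1
      (hKm w ⟨h1, by rw [him]; exact abs_le.2 ⟨by linarith, by linarith⟩⟩))
    (fun u hu => by rw [gp _ (by simp; linarith) (by simp)])
    (fun u hu => by rw [gm _ (by simp; linarith) (by simp)])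
    (fun u hu => by rw [e1]; exact hrayQ 1 (by simp) u hu)
    (fun u hu => by rw [e2]; exact hrayQ (-1) (by simp) u hu)
    (fun u hu => by
      -- For natural `k` the factor `e^{k w}` has no jump between `Im w = π` and `Im w = -π`, so the
      -- `k`-th derivative gains exactly `e^{k u}`.
      have hper : Complex.exp (k * (u + (-Real.pi : ℝ) * I)) = Complex.exp (k * (u + Real.pi * I)) := by
        rw [Complex.exp_nat_mul, Complex.exp_nat_mul]
        congr 1
        rw [← Complex.exp_periodic (u + (-Real.pi : ℝ) * I)]
        congr 1
        push_cast
        ring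
      have hadd : ∀ w : ℂ, Complex.exp (p * w) = Complex.exp (l * w) * Complex.exp (k * w) := by
        intro w
        rw [← Complex.exp_add, hpdef]
        push_cast
        ring_nf
      rw [hadd, hadd, hper, ← mul_assoc, ← mul_assoc, ← sub_mul, norm_mul]
      have e3 : ‖Complex.exp (k * (u + Real.pi * I))‖ = Real.exp (k * u) := by
        have := norm_exp_ofReal_mul k (u + Real.pi * I)
        simpa using this
      rw [e3, add_mul ν, Real.exp_add, ← mul_assoc]
      gcongr
      exact (hj u hu).trans (by gcongr))
  refine ⟨K, fun z hz => ?_⟩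
  have hres := hook_one_sub_hook_neg_one (A := fun w => beachB μ w * Complex.exp (p * w))
    (V := Real.pi / 2 + Real.pi / μ) (m := ν + k) (C := C) hα hU1 hU2
    ((le_abs_self U).trans_lt h.abs_U_lt)
    (fun w hw => (differentiableAt_beachB hμ hw).mul (hdexp w))
    (fun u hu => by rw [mul_div_right_comm, e1]; exact hrayQ 1 (by simp) u hu)
    (fun u hu => by rw [mul_div_right_comm, e2]; exact hrayQ (-1) (by simp) u hu) hz
  simp only [mul_div_right_comm] at hres
  change beachF μ U l k z - hook (fun w => beachT μ w * Complex.exp (p * w)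
    * Complex.exp (z * Complex.exp w)) (-1) (-U) U = _ at hres
  have e : beachF μ U l k z + 2 * Real.pi * (beachB μ beachPole * Complex.exp (p * beachPole))
        * Complex.exp (-(I * z))
      = hook (fun w => beachT μ w * Complex.exp (p * w)
        * Complex.exp (z * Complex.exp w)) (-1) (-U) U := by
    linear_combination hres
  rw [e]
  exact hK z hz

/-- No cancellation is used: the factor `e^{μw}` alone makes each side of the cut `O(e^{μu})`. -/
theorem exists_jump_neumann {μ c : ℝ}
    (hb : ∀ σ : ℝ, (σ = 1 ∨ σ = -1) → ∃ C, ∀ u : ℝ, u ≤ -1 →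
      ‖beachText μ c σ (u + (σ * Real.pi : ℝ) * I)‖ ≤ C) : ∃ C : ℝ, ∀ u : ℝ, u ≤ -1 →
      ‖beachText μ c 1 (u + Real.pi * I) * Complex.exp (μ * (u + Real.pi * I))
        - beachText μ c (-1) (u + (-Real.pi : ℝ) * I) * Complex.exp (μ * (u + (-Real.pi : ℝ) * I))‖
        ≤ C * Real.exp (μ * u) := by
  obtain ⟨C₁, h1⟩ := hb 1 (Or.inl rfl)
  obtain ⟨C₂, h2⟩ := hb (-1) (Or.inr rfl)
  refine ⟨C₁ + C₂, fun u hu => (norm_sub_le _ _).trans ?_⟩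
  rw [norm_mul, norm_mul, norm_exp_ofReal_mul, norm_exp_ofReal_mul, add_mul]
  have e1 : ((u : ℂ) + Real.pi * I).re = u := by simp
  have e2 : ((u : ℂ) + (-Real.pi : ℝ) * I).re = u := by simp
  have h1 := h1 u hu
  have h2 := h2 u hu
  simp only [one_mul, neg_mul] at h1 h2
  rw [e1, e2]
  gcongr

theorem exists_jump_dirichlet {α μ U : ℝ} (h : BeachParams α μ U) (c : ℝ) :
    ∃ C : ℝ, ∀ u : ℝ, u ≤ -1 →
      ‖beachText μ c 1 (u + Real.pi * I) * Complex.exp ((0 : ℝ) * (u + Real.pi * I))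
        - beachText μ c (-1) (u + (-Real.pi : ℝ) * I)
          * Complex.exp ((0 : ℝ) * (u + (-Real.pi : ℝ) * I))‖
        ≤ C * Real.exp (2 * μ * u) := by
  obtain ⟨C, -, hC⟩ := exists_beachText_jump h c
  refine ⟨C, fun u hu => ?_⟩
  have := hC u hu
  simp only [ofReal_zero, zero_mul, Complex.exp_zero, mul_one, ofReal_neg, neg_mul]
  rwa [← sub_eq_add_neg]

/-! ### Behaviour at the vertex. -/

/-- Near the vertex the contour integral of a symbol of order `e^{m Re w}` is of size
`‖z‖ ^ (-m)`. -/
theorem exists_hook_le_rpow {Q : ℂ → ℂ} {α U C m : ℝ} (hα : 0 < α)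
    (hU : Real.pi / 2 + α < U) (hU' : U < Real.pi)
    (hd : ∀ w : ℂ, 1 ≤ w.re → |w.im| ≤ U → DifferentiableAt ℂ Q w)
    (hb : ∀ w : ℂ, 1 ≤ w.re → |w.im| ≤ U → ‖Q w‖ ≤ C * Real.exp (m * w.re)) :
    ∃ K, ∀ z ∈ puncturedSector α, ‖z‖ ≤ 2 * Real.exp (-1) →
      ‖hook (fun w => Q w * Complex.exp (z * Complex.exp w)) 1 (-U) U‖ ≤ K * ‖z‖ ^ (-m) := by
  obtain ⟨c, hc0, hc, -⟩ := exists_decay hα hU hU'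
  have hπ := Real.pi_pos
  have hU0 : 0 < U := by linarith
  have hC : 0 ≤ C := by
    have := (norm_nonneg _).trans (hb 1 (by simp) (by simpa using hU0.le))
    exact nonneg_of_mul_nonneg_left this (Real.exp_pos _)
  set G : ℝ := ∫ u in Ioi (0 : ℝ), Real.exp (m * u - 2 * c * Real.exp u) with hG
  refine ⟨(C * G + C * Real.exp 2 * |U - -U| + C * G) * 2 ^ m, fun z hz hz1 => ?_⟩
  have hz0 := (exists_polar_of_mem_puncturedSector hz).1
  have hzd := puncturedSector_subset_decaySet hα hU hU' hz
  have hcz : 0 < c * ‖z‖ := by positivity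
  -- The segment is moved right to the scale `|z| e^s = 2`, where `e^{z e^w}` is bounded. The
  -- restriction on `‖z‖` ensures `s ≥ 1`, so that no singularity is crossed.
  set s : ℝ := Real.log (2 / ‖z‖) with hs
  have hes : Real.exp s = 2 / ‖z‖ := Real.exp_log (by positivity)
  have hs2 : ‖z‖ * Real.exp s = 2 := by rw [hes]; field_simp
  have hs1 : 1 ≤ s := by
    rw [hs, Real.le_log_iff_exp_le (by positivity), le_div_iff₀ hz0]
    rw [Real.exp_neg] at hz1
    calc _ ≤ Real.exp 1 * (2 * (Real.exp 1)⁻¹) := by gcongr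
      _ = 2 := by field_simp
  have hms : Real.exp (m * s) = 2 ^ m * ‖z‖ ^ (-m) := by
    rw [mul_comm, Real.exp_mul, hes, Real.div_rpow (by norm_num) hz0.le, Real.rpow_neg hz0.le,
      div_eq_mul_inv]
  have eu : ∀ u : ℝ, 1 ≤ u → ∀ y ∈ Icc (-U) U, 1 ≤ (u + y * I : ℂ).re ∧ |(u + y * I : ℂ).im| ≤ U :=
    fun u hu y hy => ⟨by simpa using hu, by simpa [abs_le] using hy⟩
  have hup : U ∈ Icc (-U) U := ⟨by linarith, le_rfl⟩
  have hlo : -U ∈ Icc (-U) U := ⟨le_rfl, by linarith⟩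
  have hQb : ∀ u : ℝ, 1 ≤ u → ∀ y ∈ Icc (-U) U, ‖Q (u + y * I)‖ ≤ C * Real.exp (m * u) :=
    fun u hu y hy => by simpa using hb _ (eu u hu y hy).1 (eu u hu y hy).2
  have hQc : ∀ u : ℝ, 1 ≤ u → ∀ y ∈ Icc (-U) U, ContinuousAt Q (u + y * I) :=
    fun u hu y hy => (hd _ (eu u hu y hy).1 (eu u hu y hy).2).continuousAt
  have hInt : HookIntegrable (fun w => Q w * Complex.exp (z * Complex.exp w)) s (-U) U :=
    hookIntegrable_mul_exp hU0.le hzd (fun u hu => hQc u (hs1.trans hu.le) U hup)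
      (fun u hu => hQc u (hs1.trans hu.le) (-U) hlo) (fun y hy => hQc s hs1 y hy)
      (fun u hu => hQb u (hs1.trans hu.le) U hup) (fun u hu => hQb u (hs1.trans hu.le) (-U) hlo)
  rw [hook_eq_hook (H := fun w => Q w * Complex.exp (z * Complex.exp w)) (by linarith) hs1
    (fun w h1 _ h3 h4 => (hd w h1 (abs_le.2 ⟨h3, h4⟩)).mul (by fun_prop)) hInt.lower hInt.upper]
  have hray : ∀ y ∈ Icc (-U) U, (z * Complex.exp (y * I)).re ≤ -(c * ‖z‖) →
      ‖∫ u in Ioi s, Q (u + y * I) * Complex.exp (z * Complex.exp (u + y * I))‖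
        ≤ C * G * Real.exp (m * s) := by
    intro y hy hy'
    calc _ ≤ ∫ u in Ioi s, C * Real.exp (m * u - c * ‖z‖ * Real.exp u) := by
          refine norm_integral_le_of_norm_le ((integrableOn_exp_mul_sub_exp m hcz s).const_mul C)
            ((ae_restrict_mem measurableSet_Ioi).mono fun u hu => ?_)
          rw [norm_mul, sub_eq_add_neg, Real.exp_add, ← mul_assoc]
          exact mul_le_mul (hQb u (hs1.trans (le_of_lt hu)) y hy) (norm_exp_mul_exp_le hy')
            (norm_nonneg _) (by positivity)
      _ = _ := by
          rw [integral_const_mul, setIntegral_Ioi_exp_mul_sub_exp hs2]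
          ring
  have b1 := hray U hup (re_mul_exp_le_of_mem hc hz ⟨le_rfl, by linarith⟩)
  have b2 := hray (-U) hlo (re_mul_exp_le_of_mem' hc hz ⟨by linarith, le_rfl⟩)
  have b3 : ‖∫ y in (-U)..U, Q (s + y * I) * Complex.exp (z * Complex.exp (s + y * I))‖
      ≤ C * Real.exp (m * s) * Real.exp 2 * |U - -U| := by
    refine intervalIntegral.norm_integral_le_of_norm_le_const fun y hy => ?_
    rw [uIoc_of_le (by linarith)] at hy
    rw [norm_mul]
    refine mul_le_mul (hQb s hs1 y (Ioc_subset_Icc_self hy)) ?_ (norm_nonneg _) (by positivity)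
    refine (Complex.norm_exp_le_exp_norm _).trans (Real.exp_le_exp.2 (le_of_eq ?_))
    rw [norm_mul, Complex.norm_exp, ← hs2]
    simp
  rw [hook]
  refine (norm_sub_le _ _).trans ((add_le_add (norm_add_le _ _) le_rfl).trans ?_)
  rw [norm_mul, norm_I, one_mul]
  refine (add_le_add (add_le_add b1 b3) b2).trans (le_of_eq ?_)
  rw [hms]
  ring

/-- In `ζ = e^w` the integral is that of `ζ^{k-1} e^{zζ}` over a circle, with a residue at the
origin only for `k = 0`. -/
theorem hook_exp_nat_mul {α U : ℝ} (hα : 0 < α) (hU : Real.pi / 2 + α < U) (hU' : U < Real.pi)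
    {z : ℂ} (hz : z ∈ puncturedSector α) (k : ℕ) (s : ℝ) :
    hook (fun w => Complex.exp (k * w) * Complex.exp (z * Complex.exp w)) s (-U) U
      = 2 * Real.pi * I * 0 ^ k := by
  obtain ⟨c, hc0, hc, -⟩ := exists_decay hα hU hU'
  have hz0 := (exists_polar_of_mem_puncturedSector hz).1
  have hcz : 0 < c * ‖z‖ := by positivity
  have h : DiffContOnCl ℂ (fun ζ : ℂ => ζ ^ k * Complex.exp (z * ζ)) (Metric.ball 0 (Real.exp s)) :=
    (by fun_prop : Differentiable ℂ fun ζ : ℂ => ζ ^ k * Complex.exp (z * ζ)).diffContOnCl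
  have h2 := h.circleIntegral_sub_inv_smul (w := 0) (by simpa using Real.exp_pos s)
  simp only [sub_zero, smul_eq_mul, mul_zero, Complex.exp_zero, mul_one] at h2
  rw [← h2, ← hook_eq_circleIntegral (q := fun ζ => ζ⁻¹ * (ζ ^ k * Complex.exp (z * ζ)))
    (s := s) (U := U) (B := fun x => Real.exp (k * x - c * ‖z‖ * Real.exp x)) hU']
  · congr 1 with w
    rw [Complex.exp_nat_mul]
    have := Complex.exp_ne_zero w
    field_simp
  · intro w _ _ _
    exact DifferentiableAt.mul (differentiableAt_inv (Complex.exp_ne_zero w)) (by fun_prop)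
  · intro x _ y hy
    have h5 := norm_exp_mul_exp_le (u := x) (re_mul_exp_le_of_mem hc hz hy)
    have e : (Complex.exp (x + y * I))⁻¹ * (Complex.exp (x + y * I) ^ k
        * Complex.exp (z * Complex.exp (x + y * I))) * Complex.exp (x + y * I)
        = Complex.exp (x + y * I) ^ k * Complex.exp (z * Complex.exp (x + y * I)) := by
      have := Complex.exp_ne_zero (x + y * I)
      field_simp
    have e2 : ‖Complex.exp (x + y * I)‖ = Real.exp x := by simp [Complex.norm_exp]
    rw [e, norm_mul, norm_pow, e2, sub_eq_add_neg, Real.exp_add, Real.exp_nat_mul]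
    gcongr
  · exact integrableOn_exp_mul_sub_exp _ hcz s
  · exact tendsto_exp_mul_sub_exp _ hcz
  · refine Continuous.mul (Continuous.inv₀ (by fun_prop) fun y => Complex.exp_ne_zero _) (by fun_prop)

theorem exists_beachF_dirichlet_le {α μ U : ℝ} (h : BeachParams α μ U) (k : ℕ) :
    ∃ K, ∀ z ∈ puncturedSector α, ‖z‖ ≤ 2 * Real.exp (-1) →
      ‖beachF μ U 0 k z‖ ≤ K * ‖z‖ ^ (μ - k) := by
  obtain ⟨C, hC, hb⟩ := exists_beachT_le h
  obtain ⟨K, hK⟩ := exists_hook_le_rpow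
    (Q := fun w => beachT μ w * Complex.exp ((0 + k : ℝ) * w)) (C := C) (m := k - μ)
    h.pos h.lt_U h.U_lt_pi
    (fun w h1 h2 => (h.differentiableAt_beachT_of_re (by linarith) h2).mul (by fun_prop))
    (fun w h1 h2 => by
      rw [norm_mul, norm_exp_ofReal_mul]
      calc _ ≤ C * Real.exp (-(μ * w.re)) * Real.exp ((0 + k) * w.re) := by
            gcongr; exact hb w h1 h2
        _ = _ := by
          rw [mul_assoc, ← Real.exp_add]
          ring_nf)
  refine ⟨K, fun z hz hz1 => ?_⟩
  have := hK z hz hz1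
  rwa [neg_sub] at this

/-- The limit of the Neumann symbol at `+∞` is split off and integrated exactly by
`hook_exp_nat_mul`, which gives the vertex value. The rest is smaller by `e^{-Re w/2}`, hence the
exponent `1/2`; any positive exponent would suffice for continuity and for the little-o bounds. -/
theorem exists_beachF_neumann_sub_le {α μ U : ℝ} (h : BeachParams α μ U) :
    ∃ κ : ℂ, ∀ k : ℕ, ∃ K, ∀ z ∈ puncturedSector α, ‖z‖ ≤ 2 * Real.exp (-1) →
      ‖beachF μ U μ k z - κ * 0 ^ k‖ ≤ K * ‖z‖ ^ (1 / 2 - k : ℝ) := by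
  obtain ⟨κ, hκ⟩ := exists_beachT_mul_exp_sub_isBigO h
  obtain ⟨C, hC⟩ := isBigO_principal.1 hκ
  refine ⟨κ * (2 * Real.pi * I), fun k => ?_⟩
  have hd : ∀ w : ℂ, 1 ≤ w.re → |w.im| ≤ U → DifferentiableAt ℂ
      (fun w => (beachT μ w * Complex.exp (μ * w) - κ) * Complex.exp (k * w)) w :=
    fun w h1 h2 => (((h.differentiableAt_beachT_of_re (by linarith) h2).mul
      (by fun_prop)).sub_const κ).mul (by fun_prop)
  have hb : ∀ w : ℂ, 1 ≤ w.re → |w.im| ≤ U →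
      ‖(beachT μ w * Complex.exp (μ * w) - κ) * Complex.exp (k * w)‖
        ≤ C * Real.exp ((k - 1 / 2) * w.re) := by
    intro w h1 h2
    have h3 := hC w ⟨h1, h2⟩
    rw [Real.norm_of_nonneg (Real.exp_pos _).le] at h3
    have e := norm_exp_ofReal_mul k w
    rw [ofReal_natCast] at e
    rw [norm_mul, e]
    calc _ ≤ C * Real.exp (-(w.re / 2)) * Real.exp (k * w.re) := by gcongr
      _ = _ := by
        rw [mul_assoc, ← Real.exp_add]
        ring_nf
  obtain ⟨K, hK⟩ := exists_hook_le_rpow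
    (Q := fun w => (beachT μ w * Complex.exp (μ * w) - κ) * Complex.exp (k * w)) (C := C)
    (m := k - 1 / 2) h.pos h.lt_U h.U_lt_pi hd hb
  refine ⟨K, fun z hz hz1 => ?_⟩
  have hzd := puncturedSector_subset_decaySet h.pos h.lt_U h.U_lt_pi hz
  have hU0 := h.U_pos
  have eu : ∀ u : ℝ, 1 ≤ u → ∀ y ∈ Icc (-U) U, 1 ≤ (u + y * I : ℂ).re ∧ |(u + y * I : ℂ).im| ≤ U :=
    fun u hu y hy => ⟨by simpa using hu, by simpa [abs_le] using hy⟩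
  have hup : U ∈ Icc (-U) U := ⟨by linarith, le_rfl⟩
  have hlo : -U ∈ Icc (-U) U := ⟨le_rfl, by linarith⟩
  have i1 : HookIntegrable (fun w => (beachT μ w * Complex.exp (μ * w) - κ) * Complex.exp (k * w)
      * Complex.exp (z * Complex.exp w)) 1 (-U) U :=
    hookIntegrable_mul_exp (m := k - 1 / 2) (C := C) hU0.le hzd
      (fun u hu => (hd _ (eu u hu.le U hup).1 (eu u hu.le U hup).2).continuousAt)
      (fun u hu => (hd _ (eu u hu.le (-U) hlo).1 (eu u hu.le (-U) hlo).2).continuousAt)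
      (fun y hy => (hd _ (eu 1 le_rfl y hy).1 (eu 1 le_rfl y hy).2).continuousAt)
      (fun u hu => by simpa using hb _ (eu u hu.le U hup).1 (eu u hu.le U hup).2)
      (fun u hu => by simpa using hb _ (eu u hu.le (-U) hlo).1 (eu u hu.le (-U) hlo).2)
  have hκb : ∀ u y : ℝ, ‖κ * Complex.exp (k * (u + y * I))‖ ≤ ‖κ‖ * Real.exp (k * u) := by
    intro u y
    have e := norm_exp_ofReal_mul k (u + y * I)
    rw [ofReal_natCast] at e
    rw [norm_mul, e]
    simp
  have i2 : HookIntegrable (fun w => κ * Complex.exp (k * w)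
      * Complex.exp (z * Complex.exp w)) 1 (-U) U :=
    hookIntegrable_mul_exp (m := k) (C := ‖κ‖) hU0.le hzd (fun u _ => by fun_prop)
      (fun u _ => by fun_prop) (fun y _ => by fun_prop) (fun u _ => hκb u U)
      (fun u _ => hκb u (-U))
  have hsum := hook_fun_add i1 i2
  have h1 : hook (fun w => κ * Complex.exp (k * w) * Complex.exp (z * Complex.exp w)) 1 (-U) U
      = κ * (2 * Real.pi * I) * 0 ^ k := by
    simp only [mul_assoc κ]
    rw [hook_const_mul, hook_exp_nat_mul h.pos h.lt_U h.U_lt_pi hz]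
  have h2 : beachF μ U μ k z = hook (fun w => (beachT μ w * Complex.exp (μ * w) - κ)
      * Complex.exp (k * w) * Complex.exp (z * Complex.exp w)
      + κ * Complex.exp (k * w) * Complex.exp (z * Complex.exp w)) 1 (-U) U := by
    rw [beachF]
    congr 1 with w
    have e : Complex.exp ((μ + k : ℝ) * w) = Complex.exp (μ * w) * Complex.exp (k * w) := by
      rw [← Complex.exp_add]
      push_cast
      ring_nf
    rw [e]
    ring
  rw [h2, hsum, h1, add_sub_cancel_right]
  have := hK z hz hz1
  rwa [neg_sub] at this

/-! ### Differentiation in `z` and the boundary conditions. -/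

theorem BeachParams.one_re_le {α μ U : ℝ} (_h : BeachParams α μ U) {u : ℝ} (hu : 1 ≤ u) {y : ℝ}
    (hy : |y| ≤ U) : 1 ≤ (u + y * I : ℂ).re ∧ |(u + y * I : ℂ).im| ≤ U :=
  ⟨by simpa using hu, by simpa using hy⟩

theorem exists_symbol_le {α μ U : ℝ} (h : BeachParams α μ U) (p : ℝ) :
    ∃ C, 0 ≤ C ∧ ∀ u : ℝ, 1 ≤ u → ∀ y : ℝ, |y| ≤ U →
      ‖beachT μ (u + y * I) * Complex.exp (p * (u + y * I))‖ ≤ C * Real.exp (p * u) := by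
  obtain ⟨C, hC, hb⟩ := exists_beachT_le h
  refine ⟨C, hC, fun u hu y hy => ?_⟩
  obtain ⟨h1, h2⟩ := h.one_re_le hu hy
  rw [norm_mul, norm_exp_ofReal_mul]
  have e : ((u : ℂ) + y * I).re = u := by simp
  have h3 := hb _ h1 h2
  rw [e] at h3 ⊢
  gcongr
  refine h3.trans (mul_le_of_le_one_right hC (Real.exp_le_one_iff.2 ?_))
  have := h.one_lt
  nlinarith

theorem BeachParams.differentiableAt_symbol {α μ U : ℝ} (h : BeachParams α μ U) (p : ℝ) {u : ℝ}
    (hu : 1 ≤ u) {y : ℝ} (hy : |y| ≤ U) :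
    DifferentiableAt ℂ (fun w => beachT μ w * Complex.exp (p * w)) (u + y * I) := by
  obtain ⟨h1, h2⟩ := h.one_re_le hu hy
  exact (h.differentiableAt_beachT_of_re (by linarith) h2).mul (by fun_prop)

theorem hookIntegrable_symbol {α μ U : ℝ} (h : BeachParams α μ U) (p : ℝ) {z : ℂ}
    (hz : z ∈ decaySet U) :
    HookIntegrable (fun w => beachT μ w * Complex.exp (p * w) * Complex.exp (z * Complex.exp w))
      1 (-U) U := by
  obtain ⟨C, hC, hb⟩ := exists_symbol_le h p
  have hU := abs_of_pos h.U_pos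
  have hU' : |-U| ≤ U := by rw [abs_neg, hU]
  refine hookIntegrable_mul_exp (Q := fun w => beachT μ w * Complex.exp (p * w)) (m := p) (C := C)
    h.U_pos.le hz
    (fun u hu => (h.differentiableAt_symbol p hu.le hU.le).continuousAt)
    (fun u hu => (h.differentiableAt_symbol p hu.le hU').continuousAt)
    (fun y hy => ?_) (fun u hu => hb u hu.le U hU.le) (fun u hu => hb u hu.le (-U) hU')
  exact (h.differentiableAt_symbol p le_rfl (abs_le.2 hy)).continuousAt

theorem hasDerivAt_beachF {α μ U : ℝ} (h : BeachParams α μ U) (l : ℝ) (k : ℕ) {z : ℂ}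
    (hz : z ∈ decaySet U) : HasDerivAt (beachF μ U l k) (beachF μ U l (k + 1) z) z := by
  obtain ⟨C, hC, hb⟩ := exists_symbol_le h (l + k)
  have hU := abs_of_pos h.U_pos
  have hU' : |-U| ≤ U := by rw [abs_neg, hU]
  have hc : ∀ u : ℝ, 1 ≤ u → ∀ y : ℝ, |y| ≤ U →
      ContinuousAt (fun w => beachT μ w * Complex.exp ((l + k : ℝ) * w)) (u + y * I) :=
    fun u hu y hy => (h.differentiableAt_symbol (l + k) hu hy).continuousAt
  have key := hasDerivAt_hook (Q := fun w => beachT μ w * Complex.exp ((l + k : ℝ) * w)) (s := 1)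
    (m := l + k) (C := C) h.U_pos.le hz
    (fun u hu => (ContinuousAt.comp (f := fun u : ℝ => (u + U * I : ℂ)) (hc u (le_of_lt hu) U hU.le)
      (by fun_prop)).continuousWithinAt)
    (fun u hu => (ContinuousAt.comp (f := fun u : ℝ => (u + (-U : ℝ) * I : ℂ))
      (hc u (le_of_lt hu) (-U) hU') (by fun_prop)).continuousWithinAt)
    (fun y hy => (ContinuousAt.comp (f := fun y : ℝ => ((1 : ℝ) + y * I : ℂ))
      (hc 1 le_rfl y (abs_le.2 hy)) (by fun_prop)).continuousWithinAt)
    (fun u hu => hb u hu.le U hU.le) (fun u hu => hb u hu.le (-U) hU')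
  refine key.congr_deriv ?_
  rw [beachF]
  congr 1 with w
  rw [mul_assoc (beachT μ w), ← Complex.exp_add]
  congr 3
  push_cast
  ring

theorem ofReal_mem_puncturedSector {α ρ : ℝ} (hα : 0 ≤ α) (hρ : 0 < ρ) :
    (ρ : ℂ) ∈ puncturedSector α :=
  ⟨⟨ρ, 0, hρ.le, by linarith, le_rfl, by simp⟩, by simpa using hρ.ne'⟩

theorem wall_mem_puncturedSector {α ρ : ℝ} (hα : 0 ≤ α) (hρ : 0 < ρ) :
    (ρ : ℂ) * Complex.exp (-α * I) ∈ puncturedSector α :=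
  ⟨⟨ρ, -α, hρ.le, le_rfl, by linarith, by push_cast; rfl⟩, by
    simpa using hρ.ne'⟩

/-- The combination entering the Robin condition is purely imaginary. -/
theorem beachF_robin {α μ U : ℝ} (h : BeachParams α μ U) (l : ℝ) {ρ : ℝ} (hρ : 0 < ρ) :
    (beachF μ U l 1 ρ + I * beachF μ U l 0 ρ).re = 0 := by
  have hz := puncturedSector_subset_decaySet h.pos h.lt_U h.U_lt_pi
    (ofReal_mem_puncturedSector h.pos.le hρ)
  have i1 := hookIntegrable_symbol h (l + (1 : ℕ)) hz
  have i0 := hookIntegrable_symbol h (l + (0 : ℕ)) hz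
  have i0' : HookIntegrable (fun w => I * (beachT μ w * Complex.exp ((l + (0 : ℕ) : ℝ) * w)
      * Complex.exp (ρ * Complex.exp w))) 1 (-U) U :=
    ⟨i0.lower.const_mul I, i0.upper.const_mul I, i0.arc.const_mul I⟩
  have hsum := hook_fun_add i1 i0'
  rw [hook_const_mul] at hsum
  have hU := h.U_pos
  have hne : ∀ u : ℝ, 1 ≤ u → ∀ y : ℝ, Complex.exp (u + y * I) + I ≠ 0 := fun u hu y =>
    exp_add_I_ne_zero_of_re (by simp; linarith)
  -- The combination `F' + iF` multiplies the symbol by `e^w + i`, which cancels the denominator and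
  -- leaves the conjugation symmetric `B`.
  have hpt : ∀ w : ℂ, Complex.exp w + I ≠ 0 →
      beachT μ w * Complex.exp ((l + (1 : ℕ) : ℝ) * w) * Complex.exp (ρ * Complex.exp w)
        + I * (beachT μ w * Complex.exp ((l + (0 : ℕ) : ℝ) * w) * Complex.exp (ρ * Complex.exp w))
      = beachB μ w * Complex.exp (l * w) * Complex.exp (ρ * Complex.exp w) := by
    intro w hw
    have e : Complex.exp ((l + (1 : ℕ) : ℝ) * w) = Complex.exp (l * w) * Complex.exp w := by
      rw [← Complex.exp_add]
      push_cast
      ring_nf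
    rw [e, beachT]
    simp only [Nat.cast_zero, add_zero]
    field_simp
  rw [hook_congr (K := fun w => beachB μ w * Complex.exp (l * w) * Complex.exp (ρ * Complex.exp w))
    (by linarith) (fun u hu => hpt _ (hne u hu.le _)) (fun u hu => hpt _ (hne u hu.le _))
    (fun y _ => hpt _ (hne 1 le_rfl y))] at hsum
  have hconj := hook_conj (σ := 1) (b := U)
    (H := fun w => beachB μ w * Complex.exp (l * w) * Complex.exp (ρ * Complex.exp w))
    (fun w _ => by
      simp only [beachB_conj, map_mul, ← Complex.exp_conj, conj_ofReal, ofReal_one, one_mul])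
    hU.le 1
  rw [hsum] at hconj
  have := congrArg re hconj
  rw [ofReal_one, mul_one, conj_re, neg_re] at this
  change (beachF μ U l 1 ρ + I * beachF μ U l 0 ρ).re = _ at this
  change _ = -(beachF μ U l 1 ρ + I * beachF μ U l 0 ρ).re at this
  linarith

/-- On the wall the contour may be centred at `Im w = α`. -/
theorem beachF_wall {α μ U : ℝ} (h : BeachParams α μ U) (l : ℝ) (k : ℕ) {ρ : ℝ} (hρ : 0 < ρ) :
    beachF μ U l k (ρ * Complex.exp (-α * I))
      = hook (fun w => beachT μ (w + α * I) * Complex.exp ((l + k : ℝ) * (w + α * I))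
          * Complex.exp (ρ * Complex.exp w)) 1 (-(U - α)) (U - α) := by
  obtain ⟨c, hc0, -, hc⟩ := exists_decay h.pos h.lt_U h.U_lt_pi
  obtain ⟨C, hC, hb⟩ := exists_symbol_le h (l + k)
  have hα := h.pos
  have hU1 := h.lt_U
  have hπ := Real.pi_pos
  have hcρ : 0 < c * ρ := by positivity
  set z : ℂ := ρ * Complex.exp (-α * I) with hz
  set H : ℂ → ℂ := fun w => beachT μ w * Complex.exp ((l + k : ℝ) * w)
    * Complex.exp (z * Complex.exp w) with hH
  have hd : ∀ u : ℝ, 1 ≤ u → ∀ y : ℝ, |y| ≤ U → DifferentiableAt ℂ H (u + y * I) :=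
    fun u hu y hy => (h.differentiableAt_symbol (l + k) hu hy).mul (by fun_prop)
  have hInt : ∀ a b : ℝ, a ∈ Icc (-U) U → b ∈ Icc (-U) U →
      IntervalIntegrable (fun y : ℝ => H ((1 : ℝ) + y * I)) volume a b := by
    intro a b ha hb
    refine ContinuousOn.intervalIntegrable fun y hy => ?_
    have hy' := (convex_Icc (-U) U).ordConnected.uIcc_subset ha hb hy
    exact (ContinuousAt.comp (f := fun y : ℝ => ((1 : ℝ) + y * I : ℂ))
      (hd 1 le_rfl y (abs_le.2 hy')).continuousAt (by fun_prop)).continuousWithinAt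
  have m1 : -U ∈ Icc (-U) U := ⟨le_rfl, by linarith⟩
  have m2 : 2 * α - U ∈ Icc (-U) U := ⟨by linarith, by linarith⟩
  have m3 : U ∈ Icc (-U) U := ⟨by linarith, le_rfl⟩
  have hadd := hook_add (hInt _ _ m1 m2) (hInt _ _ m2 m3)
  -- On the wall `arg z = -α` the exponential decays in all directions from `-U` to `2α - U`, so the
  -- lower ray may be turned. The contour from `2α - U` to `U` is symmetric about `Im w = α`.
  have hzero : hook H 1 (-U) (2 * α - U) = 0 := by
    refine hook_eq_zero (B := fun x => C * Real.exp ((l + k) * x - c * ρ * Real.exp x)) (by linarith)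
      (fun w h1 h2 h3 => ?_) (fun x hx y hy => ?_)
      ((integrableOn_exp_mul_sub_exp _ hcρ 1).const_mul C)
      (by simpa using (tendsto_exp_mul_sub_exp (l + k) hcρ).const_mul C)
    · rw [← re_add_im w]
      exact hd _ h1 _ (abs_le.2 ⟨h2, by linarith⟩)
    · have hre : (z * Complex.exp (y * I)).re ≤ -(c * ρ) := by
        have e : z = ρ * Complex.exp ((-α : ℝ) * I) := by rw [hz]; push_cast; rfl
        rw [e, re_mul_exp_polar]
        nlinarith [hc y hy]
      simp only [hH]
      rw [norm_mul, sub_eq_add_neg, Real.exp_add, ← mul_assoc]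
      exact mul_le_mul (hb x hx y (abs_le.2 ⟨hy.1, by linarith [hy.2]⟩)) (norm_exp_mul_exp_le hre)
        (norm_nonneg _) (by positivity)
  rw [hzero, zero_add] at hadd
  have htr := hook_translate H 1 (-(U - α)) (U - α) α
  rw [show -(U - α) + α = 2 * α - U by ring, sub_add_cancel, hadd] at htr
  rw [beachF, ← hH, ← htr]
  congr 1 with w
  simp only [hH]
  congr 2
  rw [hz, Complex.exp_add, mul_mul_mul_comm, ← Complex.exp_add]
  simp

/-- For `l = 0` the recentred integrand inherits the antisymmetry of `beachT_wall`, so the integral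
is real. -/
theorem beachF_dirichlet {α μ U : ℝ} (h : BeachParams α μ U) {ρ : ℝ} (hρ : 0 < ρ) :
    (beachF μ U 0 0 (ρ * Complex.exp (-α * I))).im = 0 := by
  rw [beachF_wall h 0 0 hρ]
  have hconj := hook_conj (σ := -1) (b := U - α)
    (H := fun w => beachT μ (w + α * I) * Complex.exp ((0 + (0 : ℕ) : ℝ) * (w + α * I))
          * Complex.exp (ρ * Complex.exp w))
    (fun w hw => by
      have h1 := beachT_wall h (w := w) (by linarith [h.U_lt])
      simp only [h1, map_mul, ← Complex.exp_conj, conj_ofReal]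
      simp) (by linarith [h.lt_U, Real.pi_pos]) 1
  have := congrArg im hconj
  simp only [ofReal_neg, ofReal_one, mul_neg, mul_one, neg_im, conj_im] at this
  linarith

/-- Since `μα = π/2`, the phases combine to `e^{-iα} e^{(μ+1)(w + iα)} = i e^{(μ+1)w}`. The factor
`i` turns antisymmetry into symmetry, and the integral is purely imaginary. -/
theorem beachF_neumann {α μ U : ℝ} (h : BeachParams α μ U) {ρ : ℝ} (hρ : 0 < ρ) :
    (Complex.exp (-α * I) * beachF μ U μ 1 (ρ * Complex.exp (-α * I))).re = 0 := by
  rw [beachF_wall h μ 1 hρ, ← hook_const_mul]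
  have hμα : (μ : ℂ) * α = Real.pi / 2 := by
    have := congrArg (fun x : ℝ => (x : ℂ)) h.mul_eq
    push_cast at this
    exact this
  have e : ∀ w : ℂ, Complex.exp (-α * I) * (beachT μ (w + α * I)
      * Complex.exp ((μ + (1 : ℕ) : ℝ) * (w + α * I)) * Complex.exp (ρ * Complex.exp w))
      = I * beachT μ (w + α * I) * Complex.exp ((μ + 1 : ℝ) * w)
        * Complex.exp (ρ * Complex.exp w) := by
    intro w
    have e1 : Complex.exp (-α * I) * Complex.exp ((μ + (1 : ℕ) : ℝ) * (w + α * I))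
        = I * Complex.exp ((μ + 1 : ℝ) * w) := by
      have e2 : -α * I + (μ + (1 : ℕ) : ℝ) * (w + α * I)
          = Real.pi / 2 * I + (μ + 1 : ℝ) * w := by
        push_cast
        linear_combination I * hμα
      rw [← Complex.exp_add, e2, Complex.exp_add, Complex.exp_pi_div_two_mul_I]
    linear_combination beachT μ (w + α * I) * Complex.exp (ρ * Complex.exp w) * e1
  simp only [e]
  have hconj := hook_conj (σ := 1) (b := U - α)
    (H := fun w => I * beachT μ (w + α * I) * Complex.exp ((μ + 1 : ℝ) * w)
        * Complex.exp (ρ * Complex.exp w))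
    (fun w hw => by
      have h1 := beachT_wall h (w := w) (by linarith [h.U_lt])
      simp only [h1, map_mul, ← Complex.exp_conj, conj_ofReal, conj_I]
      simp) (by linarith [h.lt_U, Real.pi_pos]) 1
  have := congrArg re hconj
  rw [ofReal_one, mul_one, conj_re, neg_re] at this
  linarith

/-! ### Normalisation of the wave. -/

/-- The value of the even factor of the symbol at the pole is positive. -/
theorem beachE_beachPole (μ : ℝ) : beachE μ beachPole = Real.exp (logE μ beachPole).re := by
  have h1 : starRingEnd ℂ beachPole = -beachPole := by
    rw [beachPole, map_mul, conj_ofReal, conj_I]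
    ring
  have h2 : starRingEnd ℂ (logE μ beachPole) = logE μ beachPole := by
    rw [← logE_conj, h1, logE_neg]
  rw [beachE, ofReal_exp, conj_eq_iff_re.1 h2]

/-- The normalising constant. -/
def beachNorm (μ : ℝ) : ℝ := (2 * Real.pi * Real.exp (logE μ beachPole).re)⁻¹

/-- The normalised complex potential and its derivatives. -/
def beachPotential (μ U l : ℝ) (k : ℕ) (z : ℂ) : ℂ := -I * beachNorm μ * beachF μ U l k z

/-- As `E` is positive at the pole `-iπ/2`, the phase comes only from `i e^{-(μ-1)w/2} e^{l w}`
there and equals `π/4 (1 + μ - 2l)`: this is `χ_D` for `l = 0` and `χ_N` for `l = μ`. Each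
derivative adds a factor `e^w = -i`. -/
theorem beachNorm_mul (μ l : ℝ) (k : ℕ) (z : ℂ) :
    -I * beachNorm μ * (2 * Real.pi * (beachB μ beachPole * Complex.exp ((l + k : ℝ) * beachPole))
          * Complex.exp (-(I * z)))
      = -(Complex.exp (Real.pi / 4 * (1 + μ - 2 * l) * I) * (-I) ^ k * Complex.exp (-(I * z))) := by
  have hn : (beachNorm μ : ℂ) * (2 * Real.pi * Real.exp (logE μ beachPole).re) = 1 := by
    rw [beachNorm]
    have h1 : (Real.exp (logE μ beachPole).re : ℂ) ≠ 0 := ofReal_ne_zero.2 (Real.exp_pos _).ne'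
    have h2 : (Real.pi : ℂ) ≠ 0 := ofReal_ne_zero.2 Real.pi_ne_zero
    push_cast at h1 ⊢
    field_simp
  have hk : Complex.exp ((l + k : ℝ) * beachPole) = Complex.exp (l * beachPole) * (-I) ^ k := by
    rw [← exp_beachPole, ← Complex.exp_nat_mul, ← Complex.exp_add]
    push_cast
    ring_nf
  have hph : I * (Complex.exp (-((μ - 1) / 2) * beachPole) * Complex.exp (l * beachPole))
      = Complex.exp (Real.pi / 4 * (1 + μ - 2 * l) * I) := by
    nth_rewrite 1 [← Complex.exp_pi_div_two_mul_I]
    rw [← Complex.exp_add, ← Complex.exp_add, beachPole]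
    congr 1
    push_cast
    ring
  rw [beachB, beachE_beachPole, hk, ← hph]
  linear_combination (-I) * (Complex.exp (-((μ - 1) / 2) * beachPole) * Complex.exp (l * beachPole)
    * (-I) ^ k * Complex.exp (-(I * z))) * hn

/-! ### From complex potentials to real harmonic functions. -/

theorem hasFDerivAt_re {g : ℂ → ℂ} {g' z : ℂ} (hg : HasDerivAt g g' z) {F : ℂ → ℝ}
    (hF : F =ᶠ[𝓝 z] fun z => (g z).re) :
    ∃ F' : ℂ →L[ℝ] ℝ, HasFDerivAt F F' z ∧ ∀ v, F' v = (g' * v).re := by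
  have h1 : HasFDerivAt g ((ContinuousLinearMap.toSpanSingleton ℂ g').restrictScalars ℝ) z :=
    hg.hasFDerivAt.restrictScalars ℝ
  have h2 := reCLM.hasFDerivAt.comp z h1
  refine ⟨_, h2.congr_of_eventuallyEq hF, fun v => ?_⟩
  simp [mul_comm]

theorem fderiv_re {g : ℂ → ℂ} {g' z : ℂ} (hg : HasDerivAt g g' z) {F : ℂ → ℝ}
    (hF : F =ᶠ[𝓝 z] fun z => (g z).re) (v : ℂ) : fderiv ℝ F z v = (g' * v).re := by
  obtain ⟨F', h1, h2⟩ := hasFDerivAt_re hg hF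
  rw [h1.fderiv, h2]

/-- A sequence of functions on an open set, each the complex derivative of the one before. -/
def IsDerivChain (Ω : Set ℂ) (g : ℕ → ℂ → ℂ) : Prop :=
  ∀ k, ∀ z ∈ Ω, HasDerivAt (g k) (g (k + 1) z) z

theorem IsDerivChain.fderiv_eq {Ω : Set ℂ} (hΩ : IsOpen Ω) {g : ℕ → ℂ → ℂ} (hg : IsDerivChain Ω g)
    {F : ℂ → ℝ} {k : ℕ} {c : ℂ} (hF : EqOn F (fun z => (c * g k z).re) Ω) {z : ℂ} (hz : z ∈ Ω)
    (v : ℂ) : fderiv ℝ F z v = (c * v * g (k + 1) z).re := by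
  rw [fderiv_re ((hg k z hz).const_mul c) (hF.eventuallyEq_of_mem (hΩ.mem_nhds hz))]
  ring_nf

/-- On real parts of holomorphic functions `∂/∂x` acts as the complex derivative and `∂/∂y` as `i`
times it. -/
theorem IsDerivChain.partialD_eq {Ω : Set ℂ} (hΩ : IsOpen Ω) {g : ℕ → ℂ → ℂ}
    (hg : IsDerivChain Ω g) {F : ℂ → ℝ} (hF : EqOn F (fun z => (g 0 z).re) Ω) (a b : ℕ) :
    EqOn (partialD a b F) (fun z => (I ^ b * g (a + b) z).re) Ω := by
  have hy : EqOn (dy^[b] F) (fun z => (I ^ b * g b z).re) Ω := by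
    induction b with
    | zero => simpa using hF
    | succ b ih =>
      intro z hz
      rw [Function.iterate_succ_apply', dy, hg.fderiv_eq hΩ ih hz, pow_succ]
  rw [partialD]
  induction a with
  | zero => simpa using hy
  | succ a ih =>
    intro z hz
    rw [Function.iterate_succ_apply', dx, hg.fderiv_eq hΩ ih hz, mul_one, Nat.add_right_comm]

theorem IsDerivChain.abs_partialD_le {Ω : Set ℂ} (hΩ : IsOpen Ω) {g : ℕ → ℂ → ℂ}
    (hg : IsDerivChain Ω g) {F : ℂ → ℝ} (hF : EqOn F (fun z => (g 0 z).re) Ω) (a b : ℕ) {z : ℂ}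
    (hz : z ∈ Ω) : |partialD a b F z| ≤ ‖g (a + b) z‖ := by
  rw [hg.partialD_eq hΩ hF a b hz]
  refine (abs_re_le_norm _).trans (le_of_eq ?_)
  rw [norm_mul, norm_pow, norm_I, one_pow, one_mul]

theorem IsDerivChain.norm_gradient_le {Ω : Set ℂ} (hΩ : IsOpen Ω) {g : ℕ → ℂ → ℂ}
    (hg : IsDerivChain Ω g) {F : ℂ → ℝ} (hF : EqOn F (fun z => (g 0 z).re) Ω) {z : ℂ}
    (hz : z ∈ Ω) : ‖gradient F z‖ ≤ ‖g 1 z‖ := by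
  rw [gradient, LinearIsometryEquiv.norm_map]
  refine ContinuousLinearMap.opNorm_le_bound _ (norm_nonneg _) fun v => ?_
  rw [hg.fderiv_eq hΩ (c := 1) (k := 0) (by simpa using hF) hz, one_mul, mul_comm, zero_add,
    ← norm_mul]
  exact abs_re_le_norm _

theorem IsDerivChain.harmonicAt {Ω : Set ℂ} (hΩ : IsOpen Ω) {g : ℕ → ℂ → ℂ}
    (hg : IsDerivChain Ω g) {F : ℂ → ℝ} (hF : EqOn F (fun z => (g 0 z).re) Ω) {z : ℂ}
    (hz : z ∈ Ω) : InnerProductSpace.HarmonicAt F z := by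
  rw [InnerProductSpace.harmonicAt_congr_nhds (hF.eventuallyEq_of_mem (hΩ.mem_nhds hz))]
  refine AnalyticAt.harmonicAt_re ?_
  exact DifferentiableOn.analyticAt
    (fun z hz => (hg 0 z hz).differentiableAt.differentiableWithinAt) (hΩ.mem_nhds hz)

theorem wave_eq_re (χ : ℝ) (z : ℂ) :
    wave χ z = (Complex.exp (χ * I) * Complex.exp (-(I * z))).re := by
  rw [wave, ← Complex.exp_add, Complex.exp_re]
  have h1 : (χ * I + -(I * z)).re = z.im := by simp
  have h2 : (χ * I + -(I * z)).im = -(z.re - χ) := by simp; ring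
  rw [h1, h2, Real.cos_neg]

theorem im_nonpos_of_mem_sector {α : ℝ} (hα' : α ≤ Real.pi) {z : ℂ} (hz : z ∈ sector α) : z.im ≤ 0 := by
  obtain ⟨ρ, θ, hρ, h1, h2, rfl⟩ := hz
  rw [im_ofReal_mul, exp_ofReal_mul_I_im]
  have : Real.sin θ ≤ 0 := Real.sin_nonpos_of_nonpos_of_neg_pi_le h2 (by linarith)
  nlinarith

theorem abs_wave_le (χ : ℝ) {α : ℝ} (hα : α ≤ Real.pi) {z : ℂ} (hz : z ∈ sector α) :
    |wave χ z| ≤ 1 := by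
  rw [wave, abs_mul, abs_of_pos (Real.exp_pos _)]
  exact mul_le_one₀ (Real.exp_le_one_iff.2 (im_nonpos_of_mem_sector hα hz)) (abs_nonneg _)
    (Real.abs_cos_le_one _)

theorem isDerivChain_wave (Ω : Set ℂ) (c : ℂ) :
    IsDerivChain Ω fun k z => c * (-I) ^ k * Complex.exp (-(I * z)) := by
  intro k z _
  have h := (((hasDerivAt_id z).const_mul I).neg.cexp).const_mul (c * (-I) ^ k)
  refine h.congr_deriv ?_
  simp [pow_succ]
  ring

theorem isDerivChain_const (Ω : Set ℂ) (c : ℂ) : IsDerivChain Ω fun k _ => c * 0 ^ k := by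
  intro k z _
  simpa using hasDerivAt_const z (c * 0 ^ k)

theorem IsDerivChain.sub {Ω : Set ℂ} {f g : ℕ → ℂ → ℂ} (hf : IsDerivChain Ω f)
    (hg : IsDerivChain Ω g) : IsDerivChain Ω fun k z => f k z - g k z :=
  fun k z hz => (hf k z hz).sub (hg k z hz)

/-- A complex potential whose real part solves the sloping beach problem: `v` is its value at the
vertex, `χ` the phase of the outgoing wave, and `t` an irrelevant imaginary constant. -/
structure IsBeachPotential (α ν δ χ : ℝ) (Ω : Set ℂ) (f : ℕ → ℂ → ℂ) (v : ℂ) (t : ℝ) : Prop where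
  isOpen : IsOpen Ω
  subset : puncturedSector α ⊆ Ω
  zero_notMem : (0 : ℂ) ∉ Ω
  chain : IsDerivChain Ω f
  robin : ∀ ρ : ℝ, 0 < ρ → (f 1 ρ + I * f 0 ρ).im = 0
  vertex : ∀ k : ℕ, ∃ K, ∀ z ∈ puncturedSector α, ‖z‖ ≤ 2 * Real.exp (-1) →
    ‖f k z - v * 0 ^ k‖ ≤ K * ‖z‖ ^ (δ - k)
  remainder : ∀ k : ℕ, ∃ K, ∀ z ∈ puncturedSector α,
    ‖f k z - Complex.exp (χ * I) * (-I) ^ k * Complex.exp (-(I * z)) - t * I * 0 ^ k‖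
      ≤ K * ‖z‖ ^ (-ν - k)

/-- The real part of a complex potential, extended to the vertex. -/
def realPotential (f : ℕ → ℂ → ℂ) (v : ℂ) (z : ℂ) : ℝ := if z = 0 then v.re else (f 0 z).re

namespace IsBeachPotential

variable {α ν δ χ : ℝ} {Ω : Set ℂ} {f : ℕ → ℂ → ℂ} {v : ℂ} {t : ℝ}

theorem eqOn (h : IsBeachPotential α ν δ χ Ω f v t) :
    EqOn (realPotential f v) (fun z => (f 0 z).re) Ω := fun z hz => by
  rw [realPotential, if_neg fun h0 : z = 0 => h.zero_notMem (h0 ▸ hz)]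

/-- The constant `t i`, left over from the push to `-∞` in the Dirichlet case, has zero real part
and drops out of the remainder. -/
theorem eqOn_remainder (h : IsBeachPotential α ν δ χ Ω f v t) :
    EqOn (fun z => realPotential f v z - wave χ z)
      (fun z => (f 0 z - Complex.exp (χ * I) * (-I) ^ 0 * Complex.exp (-(I * z))
        - t * I * 0 ^ 0).re) Ω := fun z hz => by
  simp only [h.eqOn hz, wave_eq_re, pow_zero, mul_one, sub_re]
  simp

theorem chain_remainder (h : IsBeachPotential α ν δ χ Ω f v t) :
    IsDerivChain Ω fun k z => f k z - Complex.exp (χ * I) * (-I) ^ k * Complex.exp (-(I * z))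
      - t * I * 0 ^ k :=
  (h.chain.sub (isDerivChain_wave Ω _)).sub (isDerivChain_const Ω _)

theorem exists_abs_partialD_remainder_le (h : IsBeachPotential α ν δ χ Ω f v t) (k : ℕ) :
    ∃ K, ∀ a b : ℕ, a + b = k → ∀ z ∈ puncturedSector α,
      |partialD a b (fun z => realPotential f v z - wave χ z) z| ≤ K * ‖z‖ ^ (-ν - k) := by
  obtain ⟨K, hK⟩ := h.remainder k
  refine ⟨K, fun a b hab z hz => ?_⟩
  have := h.chain_remainder.abs_partialD_le h.isOpen h.eqOn_remainder a b (h.subset hz)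
  rw [hab] at this
  exact this.trans (hK z hz)

theorem exists_remainder_le (h : IsBeachPotential α ν δ χ Ω f v t) :
    ∃ K, ∀ z ∈ puncturedSector α, |realPotential f v z - wave χ z| ≤ K * ‖z‖ ^ (-ν) ∧
      ‖gradient (fun z => realPotential f v z - wave χ z) z‖ ≤ K * ‖z‖ ^ (-ν - 1) := by
  obtain ⟨K₀, h0⟩ := h.exists_abs_partialD_remainder_le 0
  obtain ⟨K₁, h1⟩ := h.remainder 1
  refine ⟨max K₀ K₁, fun z hz => ⟨?_, ?_⟩⟩
  · have := h0 0 0 rfl z hz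
    simp only [partialD, Function.iterate_zero, id, Nat.cast_zero, sub_zero] at this
    exact this.trans (by gcongr; exact le_max_left _ _)
  · have h2 := h1 z hz
    rw [Nat.cast_one] at h2
    exact ((h.chain_remainder.norm_gradient_le h.isOpen h.eqOn_remainder (h.subset hz)).trans
      h2).trans (by gcongr; exact le_max_right _ _)

theorem partialD_isBigO (h : IsBeachPotential α ν δ χ Ω f v t) {a b : ℕ}
    (hv : v * 0 ^ (a + b) = 0) : partialD a b (realPotential f v)
      =O[𝓝[puncturedSector α] 0] fun z => ‖z‖ ^ (δ - ((a + b : ℕ) : ℝ)) := by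
  obtain ⟨K, hK⟩ := h.vertex (a + b)
  refine IsBigO.of_bound K ?_
  have hball : ∀ᶠ z : ℂ in 𝓝[puncturedSector α] 0, ‖z‖ ≤ 2 * Real.exp (-1) := by
    refine eventually_nhdsWithin_of_eventually_nhds ?_
    filter_upwards [Metric.closedBall_mem_nhds (0 : ℂ) (show 0 < 2 * Real.exp (-1) by positivity)]
      with z hz
    simpa using hz
  filter_upwards [hball, self_mem_nhdsWithin] with z hz1 hz
  have h1 := h.chain.abs_partialD_le h.isOpen h.eqOn a b (h.subset hz)
  have h2 := hK z hz hz1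
  rw [hv, sub_zero] at h2
  rw [Real.norm_eq_abs, Real.norm_of_nonneg (by positivity)]
  exact h1.trans h2

theorem continuousOn (h : IsBeachPotential α ν δ χ Ω f v t) (hδ : 0 < δ) :
    ContinuousOn (realPotential f v) (sector α) := by
  intro z hz
  rcases eq_or_ne z 0 with rfl | h0
  · have hval : realPotential f v 0 = v.re := if_pos rfl
    obtain ⟨K, hK⟩ := h.vertex 0
    rw [ContinuousWithinAt, hval, tendsto_iff_norm_sub_tendsto_zero]
    have hlim : Tendsto (fun z : ℂ => |K| * ‖z‖ ^ δ) (𝓝[sector α] 0) (𝓝 0) := by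
      have : ContinuousAt (fun z : ℂ => |K| * ‖z‖ ^ δ) 0 :=
        ContinuousAt.mul continuousAt_const
          (continuous_norm.continuousAt.rpow_const (Or.inr hδ.le))
      have h2 := this.tendsto
      simp only [norm_zero, Real.zero_rpow hδ.ne', mul_zero] at h2
      exact h2.mono_left nhdsWithin_le_nhds
    refine squeeze_zero' (Eventually.of_forall fun _ => norm_nonneg _) ?_ hlim
    have hball : ∀ᶠ z : ℂ in 𝓝[sector α] 0, ‖z‖ ≤ 2 * Real.exp (-1) := by
      refine eventually_nhdsWithin_of_eventually_nhds ?_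
      filter_upwards [Metric.closedBall_mem_nhds (0 : ℂ) (show 0 < 2 * Real.exp (-1) by positivity)]
        with z hz
      simpa using hz
    filter_upwards [hball, self_mem_nhdsWithin] with z hz1 hz
    rcases eq_or_ne z 0 with rfl | h0
    · rw [hval, sub_self, norm_zero]
      positivity
    · have h1 := hK z ⟨hz, h0⟩ hz1
      simp only [pow_zero, mul_one, Nat.cast_zero, sub_zero] at h1
      rw [h.eqOn (h.subset ⟨hz, h0⟩), ← sub_re]
      exact ((abs_re_le_norm _).trans h1).trans (by gcongr; exact le_abs_self K)
  · obtain ⟨F', hF', -⟩ := hasFDerivAt_re (h.chain 0 z (h.subset ⟨hz, h0⟩))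
      (h.eqOn.eventuallyEq_of_mem (h.isOpen.mem_nhds (h.subset ⟨hz, h0⟩)))
    exact hF'.continuousAt.continuousWithinAt

theorem harmonicOnNhd (h : IsBeachPotential α ν δ χ Ω f v t) :
    InnerProductSpace.HarmonicOnNhd (realPotential f v) (puncturedSector α) :=
  fun _ hz => h.chain.harmonicAt h.isOpen h.eqOn (h.subset hz)

theorem dy_eq (h : IsBeachPotential α ν δ χ Ω f v t) (hα : 0 ≤ α) {z : ℂ} (hz : z ∈ surfaceRay) :
    dy (realPotential f v) z = realPotential f v z := by
  obtain ⟨ρ, hρ, rfl⟩ := hz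
  have hz := h.subset (ofReal_mem_puncturedSector hα hρ)
  have h1 := h.robin ρ hρ
  rw [dy, h.chain.fderiv_eq h.isOpen (c := 1) (k := 0) (by simpa using h.eqOn) hz, h.eqOn hz]
  simp at h1 ⊢
  linarith

theorem fderiv_wallNormal (h : IsBeachPotential α ν δ χ Ω f v t) (hα : 0 ≤ α)
    (hw : ∀ ρ : ℝ, 0 < ρ →
      (Complex.exp (-α * I) * f 1 (ρ * Complex.exp (-α * I))).im = 0) {z : ℂ}
    (hz : z ∈ wallRay α) : fderiv ℝ (realPotential f v) z (wallNormal α) = 0 := by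
  obtain ⟨ρ, hρ, rfl⟩ := hz
  have hz := h.subset (wall_mem_puncturedSector hα hρ)
  have h1 := hw ρ hρ
  rw [h.chain.fderiv_eq h.isOpen (c := 1) (k := 0) (by simpa using h.eqOn) hz, wallNormal, one_mul,
    mul_assoc, zero_add, neg_mul, neg_re, I_mul_re, h1]
  simp

theorem exists_abs_le (h : IsBeachPotential α ν δ χ Ω f v t) (hδ : 0 < δ) (hν : 0 < ν)
    (hα : α ≤ Real.pi) : ∃ M, ∀ z ∈ sector α, |realPotential f v z| ≤ M := by
  obtain ⟨K, hK⟩ := h.vertex 0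
  obtain ⟨K', hK'⟩ := h.exists_remainder_le
  set r : ℝ := 2 * Real.exp (-1) with hr
  have hr0 : 0 < r := by positivity
  refine ⟨‖v‖ + |K| * r ^ δ + (1 + |K'| * r ^ (-ν)), fun z hz => ?_⟩
  have p1 : 0 ≤ |K| * r ^ δ := by positivity
  have p2 : 0 ≤ |K'| * r ^ (-ν) := by positivity
  rcases eq_or_ne z 0 with rfl | h0
  · have hval : realPotential f v 0 = v.re := if_pos rfl
    rw [hval]
    linarith [abs_re_le_norm v]
  · have hz' : z ∈ puncturedSector α := ⟨hz, h0⟩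
    rcases le_total ‖z‖ r with h1 | h1
    · have h2 := hK z hz' h1
      simp only [pow_zero, mul_one, Nat.cast_zero, sub_zero] at h2
      have h3 : K * ‖z‖ ^ δ ≤ |K| * r ^ δ := by
        gcongr
        exact le_abs_self K
      have h4 := norm_le_norm_sub_add (f 0 z) v
      rw [h.eqOn (h.subset hz')]
      linarith [abs_re_le_norm (f 0 z)]
    · have h2 := (hK' z hz').1
      have h3 : K' * ‖z‖ ^ (-ν) ≤ |K'| * r ^ (-ν) := by
        have : ‖z‖ ^ (-ν) ≤ r ^ (-ν) := Real.rpow_le_rpow_of_nonpos hr0 h1 (by linarith)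
        calc _ ≤ |K'| * ‖z‖ ^ (-ν) := by gcongr; exact le_abs_self K'
          _ ≤ _ := by gcongr
      have h4 := abs_wave_le χ hα hz
      have h5 := abs_sub_abs_le_abs_sub (realPotential f v z) (wave χ z)
      linarith [norm_nonneg v]

end IsBeachPotential

theorem neg_I_mul_ofReal_mul_im (r : ℝ) (w : ℂ) : (-I * r * w).im = -(r * w.re) := by
  simp

theorem neg_I_mul_ofReal_mul_re (r : ℝ) (w : ℂ) : (-I * r * w).re = r * w.im := by
  simp

theorem exists_isBeachPotential {α μ U l ν δ χ : ℝ} {κ : ℂ} (h : BeachParams α μ U)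
    (hl : l = 0 ∨ 1 ≤ l) (hν : 0 < ν) (hlν : l ≤ ν) (hχ : χ = Real.pi / 4 * (1 + μ - 2 * l))
    (hj : ∀ c : ℝ, (∀ σ : ℝ, (σ = 1 ∨ σ = -1) → ∃ C, ∀ u : ℝ, u ≤ -1 →
      ‖beachText μ c σ (u + (σ * Real.pi : ℝ) * I)‖ ≤ C) → ∃ C : ℝ, ∀ u : ℝ, u ≤ -1 →
      ‖beachText μ c 1 (u + Real.pi * I) * Complex.exp (l * (u + Real.pi * I))
        - beachText μ c (-1) (u + (-Real.pi : ℝ) * I) * Complex.exp (l * (u + (-Real.pi : ℝ) * I))‖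
        ≤ C * Real.exp (ν * u))
    (hv : ∀ k : ℕ, ∃ K, ∀ z ∈ puncturedSector α, ‖z‖ ≤ 2 * Real.exp (-1) →
      ‖beachF μ U l k z - κ * 0 ^ k‖ ≤ K * ‖z‖ ^ (δ - k)) :
    ∃ t : ℝ, IsBeachPotential α ν δ χ (decaySet U) (beachPotential μ U l)
      (-I * beachNorm μ * κ) t := by
  obtain ⟨C₁, hrem⟩ := exists_beachF_sub_le h hl hν hlν hj
  -- A constant survives at `-∞` only when `l + k = 0`. There the limit of the symbol is `-i C₁`,
  -- and the factors `2πi` and `-i * beachNorm μ` turn it into this multiple of `i`.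
  refine ⟨if l = 0 then -(2 * Real.pi * beachNorm μ * C₁) else 0, isOpen_decaySet U,
    puncturedSector_subset_decaySet h.pos h.lt_U h.U_lt_pi, zero_notMem_decaySet U,
    fun k z hz => (hasDerivAt_beachF h l k hz).const_mul _, fun ρ hρ => ?_, fun k => ?_,
    fun k => ?_⟩
  · have e : beachPotential μ U l 1 ρ + I * beachPotential μ U l 0 ρ
        = -I * beachNorm μ * (beachF μ U l 1 ρ + I * beachF μ U l 0 ρ) := by
      simp only [beachPotential]
      ring
    rw [e, neg_I_mul_ofReal_mul_im, beachF_robin h l hρ, mul_zero, neg_zero]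
  · obtain ⟨K, hK⟩ := hv k
    refine ⟨‖-I * beachNorm μ‖ * K, fun z hz hz1 => ?_⟩
    rw [beachPotential, mul_assoc (-I * (beachNorm μ : ℂ)) κ, ← mul_sub, norm_mul, mul_assoc]
    gcongr
    exact hK z hz hz1
  · obtain ⟨K, hK⟩ := hrem k
    refine ⟨‖-I * beachNorm μ‖ * K, fun z hz => ?_⟩
    have h1 := beachNorm_mul μ l k z
    have h2 : Complex.exp (χ * I) = Complex.exp (Real.pi / 4 * (1 + μ - 2 * l) * I) := by
      rw [hχ]
      push_cast
      rfl
    have h3 : -I * beachNorm μ * (2 * Real.pi * I * (if l + k = 0 then C₁ * -I else 0))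
        = ((if l = 0 then -(2 * Real.pi * beachNorm μ * C₁) else 0 : ℝ) : ℂ) * I * 0 ^ k := by
      rcases hl with rfl | hl
      · rcases Nat.eq_zero_or_pos k with rfl | hk
        · simp only [Nat.cast_zero, add_zero, if_true, pow_zero]
          push_cast
          linear_combination 2 * Real.pi * beachNorm μ * C₁ * I * I_sq
        · have hk' : (k : ℝ) ≠ 0 := by exact_mod_cast hk.ne'
          rw [if_neg (by simpa using hk'), zero_pow hk.ne']
          ring
      · have hk' : (0 : ℝ) ≤ k := Nat.cast_nonneg k
        rw [if_neg (by linarith), if_neg (by linarith)]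
        simp
    have e : beachPotential μ U l k z
        - Complex.exp (χ * I) * (-I) ^ k * Complex.exp (-(I * z))
        - ((if l = 0 then -(2 * Real.pi * beachNorm μ * C₁) else 0 : ℝ) : ℂ) * I * 0 ^ k
        = -I * beachNorm μ * (beachF μ U l k z
          + 2 * Real.pi * (beachB μ beachPole * Complex.exp ((l + k : ℝ) * beachPole))
            * Complex.exp (-(I * z)) - 2 * Real.pi * I * (if l + k = 0 then C₁ * -I else 0)) := by
      rw [← h3, h2, beachPotential]
      linear_combination -h1
    rw [e, norm_mul, mul_assoc ‖-I * (beachNorm μ : ℂ)‖, ← neg_add' ν]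
    exact mul_le_mul_of_nonneg_left (hK z hz) (norm_nonneg _)

/-! ### The two solutions. -/

/-- The choice `l = μ`: the factor `e^{μw}` provides the remainder exponent `ν = μ` and makes the
symbol converge at `+∞`, with a vertex value that need not vanish. -/
theorem exists_neumann {α : ℝ} (hα : 0 < α) (hα' : α < Real.pi / 2) :
    ∃ Ω f v t, IsBeachPotential α (mu α) (1 / 2) (chiN α) Ω f v t ∧
      IsRobinNeumannSolution α (realPotential f v) := by
  obtain ⟨U, h⟩ := exists_beachParams hα hα'
  have hμ := h.one_lt
  obtain ⟨κ, hκ⟩ := exists_beachF_neumann_sub_le h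
  obtain ⟨t, ht⟩ := exists_isBeachPotential (χ := chiN α) h (Or.inr hμ.le) (by linarith) le_rfl
    (by rw [chiN]; ring) (fun c hc => exists_jump_neumann hc) hκ
  refine ⟨_, _, _, t, ht, ht.continuousOn (by norm_num), ht.harmonicOnNhd,
    fun z hz => ht.dy_eq hα.le hz, fun z hz => ht.fderiv_wallNormal hα.le (fun ρ hρ => ?_) hz⟩
  rw [beachPotential, mul_left_comm, neg_I_mul_ofReal_mul_im, beachF_neumann h hρ]
  simp

/-- The choice `l = 0`: the jump gives `ν = 2μ`, and the decay `e^{-μ Re w}` of the bare symbol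
gives `δ = μ` with vertex value `0`. -/
theorem exists_dirichlet {α : ℝ} (hα : 0 < α) (hα' : α < Real.pi / 2) :
    ∃ Ω f t, IsBeachPotential α (2 * mu α) (mu α) (chiD α) Ω f 0 t ∧
      IsRobinDirichletSolution α (realPotential f 0) := by
  obtain ⟨U, h⟩ := exists_beachParams hα hα'
  have hμ := h.one_lt
  obtain ⟨t, ht⟩ := exists_isBeachPotential (l := 0) (ν := 2 * mu α) (δ := mu α) (κ := 0)
    (χ := chiD α) h (Or.inl rfl) (by linarith) (by linarith) (by rw [chiD]; ring)
    (fun c _ => exists_jump_dirichlet h c) (fun k => by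
      simpa using exists_beachF_dirichlet_le h k)
  rw [mul_zero] at ht
  refine ⟨_, _, t, ht, ht.continuousOn (by linarith), ht.harmonicOnNhd,
    fun z hz => ht.dy_eq hα.le hz, fun z hz => ?_⟩
  obtain ⟨ρ, hρ, rfl⟩ := hz
  rw [ht.eqOn (ht.subset (wall_mem_puncturedSector hα.le hρ))]
  simp only [beachPotential]
  rw [neg_I_mul_ofReal_mul_re, beachF_dirichlet h hρ, mul_zero]

theorem isLittleO_norm_rpow {α δ : ℝ} (hδ : 0 < δ) (k : ℝ) :
    (fun z : ℂ => ‖z‖ ^ (δ - k)) =o[𝓝[puncturedSector α] 0] fun z => ‖z‖ ^ (-k) := by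
  refine (isLittleO_iff_tendsto' ?_).2 ?_
  · filter_upwards [self_mem_nhdsWithin] with z hz h0
    have := (exists_polar_of_mem_puncturedSector hz).1
    exact absurd h0 (by positivity)
  · have h1 : Tendsto (fun z : ℂ => ‖z‖ ^ δ) (𝓝[puncturedSector α] 0) (𝓝 0) := by
      have h2 : ContinuousAt (fun z : ℂ => ‖z‖ ^ δ) 0 :=
        continuous_norm.continuousAt.rpow_const (Or.inr hδ.le)
      have h3 := h2.tendsto
      simp only [norm_zero, Real.zero_rpow hδ.ne'] at h3
      exact h3.mono_left nhdsWithin_le_nhds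
    refine h1.congr' ?_
    filter_upwards [self_mem_nhdsWithin] with z hz
    have := (exists_polar_of_mem_puncturedSector hz).1
    rw [← Real.rpow_sub this]
    ring_nf

/-! ### The right angle. -/

theorem eqOn_wave (χ : ℝ) : EqOn (wave χ)
    (fun z => (Complex.exp (χ * I) * (-I) ^ 0 * Complex.exp (-(I * z))).re) univ :=
  fun z _ => by simp [wave_eq_re]

theorem fderiv_wave (χ : ℝ) (z w : ℂ) : fderiv ℝ (wave χ) z w
    = (w * (-I * (Complex.exp (χ * I) * Complex.exp (-(I * z))))).re := by
  have h := (isDerivChain_wave univ (Complex.exp (χ * I))).fderiv_eq isOpen_univ (F := wave χ)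
    (k := 0) (c := 1) (by simpa using eqOn_wave χ) (mem_univ z) w
  rw [h]
  congr 1
  ring

theorem dy_wave (χ : ℝ) (z : ℂ) : dy (wave χ) z = wave χ z := by
  rw [dy, fderiv_wave, wave_eq_re, ← mul_assoc, mul_neg, I_mul_I, neg_neg, one_mul]

theorem harmonicAt_wave (χ : ℝ) (z : ℂ) : InnerProductSpace.HarmonicAt (wave χ) z :=
  (isDerivChain_wave univ (Complex.exp (χ * I))).harmonicAt isOpen_univ (eqOn_wave χ) (mem_univ z)

theorem continuous_wave (χ : ℝ) : Continuous (wave χ) := by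
  unfold wave
  fun_prop

theorem exp_neg_pi_div_two_mul_I : Complex.exp (-(Real.pi / 2 : ℝ) * I) = -I := by
  push_cast
  rw [neg_mul, Complex.exp_neg, Complex.exp_pi_div_two_mul_I, inv_I]

theorem wave_zero : wave 0 = fun z => Real.exp z.im * Real.cos z.re := by
  ext z
  rw [wave, sub_zero]

theorem wave_pi_div_two : wave (Real.pi / 2) = fun z => Real.exp z.im * Real.sin z.re := by
  ext z
  rw [wave, Real.cos_sub_pi_div_two]

theorem mu_pi_div_two : mu (Real.pi / 2) = 1 := by
  rw [mu]
  have := Real.pi_ne_zero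
  field_simp

theorem isRobinNeumannSolution_wave : IsRobinNeumannSolution (Real.pi / 2) (wave 0) where
  continuousOn := (continuous_wave 0).continuousOn
  harmonic := fun z _ => harmonicAt_wave 0 z
  robin := fun z _ => dy_wave 0 z
  neumann := by
    rintro _ ⟨ρ, -, rfl⟩
    rw [wallNormal, exp_neg_pi_div_two_mul_I, fderiv_wave]
    have e : -(I * ((ρ : ℂ) * -I)) = ((-ρ : ℝ) : ℂ) := by
      push_cast
      linear_combination (ρ : ℂ) * I_sq
    have h := Complex.exp_ofReal_im (-ρ)
    rw [ofReal_neg] at h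
    rw [e]
    simp [h]

theorem isRobinDirichletSolution_wave :
    IsRobinDirichletSolution (Real.pi / 2) (wave (Real.pi / 2)) where
  continuousOn := (continuous_wave _).continuousOn
  harmonic := fun z _ => harmonicAt_wave _ z
  robin := fun z _ => dy_wave _ z
  dirichlet := by
    rintro _ ⟨ρ, -, rfl⟩
    rw [exp_neg_pi_div_two_mul_I, wave]
    simp

end SlopingBeach

end

/-! ### Assembly. -/

theorem theorem2p1 :
    (∀ α : ℝ, 0 < α → α < Real.pi / 2 →
      ∃ (φN φD RN RD : ℂ → ℝ) (C : ℝ), 0 < C ∧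
        SlopingBeach.IsRobinNeumannSolution α φN ∧
        SlopingBeach.IsRobinDirichletSolution α φD ∧
        -- boundedness on the closed sector
        (∃ M : ℝ, ∀ z ∈ SlopingBeach.sector α, |φN z| ≤ M ∧ |φD z| ≤ M) ∧
        -- decomposition and remainder bounds, Robin–Neumann case
        (∀ z, φN z = SlopingBeach.wave (SlopingBeach.chiN α) z + RN z) ∧
        (∀ z ∈ SlopingBeach.puncturedSector α,
          |RN z| ≤ C * ‖z‖ ^ (-SlopingBeach.mu α) ∧
          ‖gradient RN z‖ ≤ C * ‖z‖ ^ (-SlopingBeach.mu α - 1)) ∧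
        -- decomposition and remainder bounds, Robin–Dirichlet case
        (∀ z, φD z = SlopingBeach.wave (SlopingBeach.chiD α) z + RD z) ∧
        (∀ z ∈ SlopingBeach.puncturedSector α,
          |RD z| ≤ C * ‖z‖ ^ (-2 * SlopingBeach.mu α) ∧
          ‖gradient RD z‖ ≤ C * ‖z‖ ^ (-2 * SlopingBeach.mu α - 1)) ∧
        -- derivatives at the vertex
        (∀ a b : ℕ, 1 ≤ a + b →
          SlopingBeach.partialD a b φN
            =o[𝓝[SlopingBeach.puncturedSector α] 0] fun z => ‖z‖ ^ (-((a + b : ℕ) : ℝ))) ∧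
        (∀ a b : ℕ,
          SlopingBeach.partialD a b φD
            =O[𝓝[SlopingBeach.puncturedSector α] 0]
              fun z => ‖z‖ ^ (SlopingBeach.mu α - ((a + b : ℕ) : ℝ))) ∧
        -- derivatives of the remainders on the whole sector
        (∀ k : ℕ, ∃ Ck : ℝ, ∀ a b : ℕ, a + b = k → ∀ z ∈ SlopingBeach.puncturedSector α,
          |SlopingBeach.partialD a b RN z| ≤ Ck * ‖z‖ ^ (-SlopingBeach.mu α - k) ∧
          |SlopingBeach.partialD a b RD z| ≤ Ck * ‖z‖ ^ (-2 * SlopingBeach.mu α - k))) ∧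
    -- the right angle
    (SlopingBeach.IsRobinNeumannSolution (Real.pi / 2)
        (fun z => Real.exp z.im * Real.cos z.re) ∧
      SlopingBeach.IsRobinDirichletSolution (Real.pi / 2)
        (fun z => Real.exp z.im * Real.sin z.re) ∧
      (∃ M : ℝ, ∀ z ∈ SlopingBeach.sector (Real.pi / 2),
        |Real.exp z.im * Real.cos z.re| ≤ M ∧ |Real.exp z.im * Real.sin z.re| ≤ M) ∧
      (∀ z : ℂ, Real.exp z.im * Real.cos z.re
        = SlopingBeach.wave (SlopingBeach.chiN (Real.pi / 2)) z) ∧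
      (∀ z : ℂ, Real.exp z.im * Real.sin z.re
        = SlopingBeach.wave (SlopingBeach.chiD (Real.pi / 2)) z)) := by
  refine ⟨fun α hα hα' => ?_, ?_⟩
  · obtain ⟨Ω₁, f₁, v, t₁, hN, sN⟩ := SlopingBeach.exists_neumann hα hα'
    obtain ⟨Ω₂, f₂, t₂, hD, sD⟩ := SlopingBeach.exists_dirichlet hα hα'
    obtain ⟨U, hU⟩ := SlopingBeach.exists_beachParams hα hα'
    have hμ := hU.one_lt
    have hπ : α ≤ Real.pi := by linarith [Real.pi_pos]
    obtain ⟨KN, hKN⟩ := hN.exists_remainder_le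
    obtain ⟨KD, hKD⟩ := hD.exists_remainder_le
    obtain ⟨MN, hMN⟩ := hN.exists_abs_le (by norm_num) (by linarith) hπ
    obtain ⟨MD, hMD⟩ := hD.exists_abs_le (by linarith) (by linarith) hπ
    refine ⟨_, _, fun z => SlopingBeach.realPotential f₁ v z
        - SlopingBeach.wave (SlopingBeach.chiN α) z,
      fun z => SlopingBeach.realPotential f₂ 0 z - SlopingBeach.wave (SlopingBeach.chiD α) z,
      max 1 (max KN KD), by positivity, sN, sD,
      ⟨max MN MD, fun z hz => ⟨(hMN z hz).trans (le_max_left _ _),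
        (hMD z hz).trans (le_max_right _ _)⟩⟩,
      fun z => by ring, fun z hz => ?_, fun z => by ring, fun z hz => ?_, fun a b hab => ?_,
      fun a b => hD.partialD_isBigO (zero_mul _), fun k => ?_⟩
    · have hK : KN ≤ max 1 (max KN KD) := (le_max_left _ _).trans (le_max_right _ _)
      exact ⟨(hKN z hz).1.trans (by gcongr), (hKN z hz).2.trans (by gcongr)⟩
    · have hK : KD ≤ max 1 (max KN KD) := (le_max_right _ _).trans (le_max_right _ _)
      rw [neg_mul]
      exact ⟨(hKD z hz).1.trans (by gcongr), (hKD z hz).2.trans (by gcongr)⟩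
    -- For order `k ≥ 1` the vertex constant drops out, and `O(ρ^{1/2 - k})` is `o(ρ^{-k})`.
    · exact (hN.partialD_isBigO (by rw [zero_pow (by omega), mul_zero])).trans_isLittleO
        (SlopingBeach.isLittleO_norm_rpow (by norm_num) _)
    · obtain ⟨K₁, h₁⟩ := hN.exists_abs_partialD_remainder_le k
      obtain ⟨K₂, h₂⟩ := hD.exists_abs_partialD_remainder_le k
      refine ⟨max K₁ K₂, fun a b hab z hz => ⟨(h₁ a b hab z hz).trans ?_, ?_⟩⟩
      · gcongr
        exact le_max_left _ _
      · rw [neg_mul]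
        refine (h₂ a b hab z hz).trans ?_
        gcongr
        exact le_max_right _ _
  · have hN0 : SlopingBeach.chiN (Real.pi / 2) = 0 := by
      rw [SlopingBeach.chiN, SlopingBeach.mu_pi_div_two, sub_self, mul_zero]
    have hD0 : SlopingBeach.chiD (Real.pi / 2) = Real.pi / 2 := by
      rw [SlopingBeach.chiD, SlopingBeach.mu_pi_div_two]
      ring
    have hπ : Real.pi / 2 ≤ Real.pi := by linarith [Real.pi_pos]
    refine ⟨SlopingBeach.wave_zero ▸ SlopingBeach.isRobinNeumannSolution_wave,
      SlopingBeach.wave_pi_div_two ▸ SlopingBeach.isRobinDirichletSolution_wave,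
      ⟨1, fun z hz => ⟨?_, ?_⟩⟩, fun z => ?_, fun z => ?_⟩
    · simpa [SlopingBeach.wave_zero] using SlopingBeach.abs_wave_le 0 hπ hz
    · simpa [SlopingBeach.wave_pi_div_two] using SlopingBeach.abs_wave_le (Real.pi / 2) hπ hz
    · rw [hN0, SlopingBeach.wave_zero]
    · rw [hD0, SlopingBeach.wave_pi_div_two]
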